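/- **Conventions.** A planar map is a connected graph (loops and multiple edges allowed) embedded in the sphere without edge crossings, up to continuous deformation. It is rooted if it has a distinguished oriented edge; the face on the right of the root edge is the outer face, whose degree is the outer degree, and the other faces are the inner faces. The map reduced to a single vertex is counted as a rooted map, of outer degree $0$. A cycle is a simple closed path; the girth is the minimal length of a cycle ($\infty$ for a tree). For $d\ge 0$, a rooted map is $d$-irreducible if its girth is at least $d$ and every cycle of length $d$ is the boundary of an inner face of degree $d$. For $n\ge 0$, $F_n^{(d)}(z;x_{d+1},x_{d+2},\ldots)$ is the generating function of $d$-irreducible rooted maps of outer degree $n$, with weight $z$ per inner face of degree $d$ and $x_i$ per inner face of degree $i\ge d+1$, and $F_n(x_1,x_2,\ldots)=F_n^{(0)}(0;x_1,x_2,\ldots)$. For $d\ge1$, $G_d(x_d,x_{d+1},\ldots)$ is the generating function of rooted maps of girth $d$ and outer degree $d$, with weight $x_i$ per inner face of degree $i$. All series are formal power series with integer coefficients; they are well defined, since for given $n$ only finitely many rooted maps have outer degree $n$ and prescribed numbers of inner faces of each degree. **Theorem.** Let $d\ge 1$ and $n\ge 0$. 1. Select, for every $d$-irreducible rooted map $\mathcal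 M$ of outer degree $n$ and every inner face $f$ of degree $d$ of $\mathcal M$, an edge incident to $f$. Consider the pairs $(\mathcal M,(m_f)_f)$, where $\mathcal M$ is a $d$-irreducible rooted map of outer degree $n$, $f$ runs over its inner faces of degree $d$, and each $m_f$ is a rooted map of girth $d$ and outer degree $d$. Gluing each $m_f$ inside $f$ (the outer boundary of $m_f$ being identified with the boundary of $f$, and the root edge of $m_f$ with the selected edge of $f$) is a bijection from these pairs onto the rooted maps of girth at least $d$ and outer degree $n$. 2. One has $$G_d(x_d,x_{d+1},\ldots)=F_d^{(d-1)}(0;x_d,x_{d+1},\ldots)-\mathrm{Cat}(d/2),$$ where $\mathrm{Cat}(k)=\frac1{k+1}\binom{2k}{k}$ for integer $k$ and $\mathrm{Cat}(k)=0$ otherwise, and $$F_n^{(d-1)}(0;x_d,x_{d+1},\ldots)=F_n^{(d)}\bigl(G_d(x_d,x_{d+1},\ldots);x_{d+1},x_{d+2},\ldots\bigr).$$ 3. There is a unique formal power series $X_d(z;x_{d+1},x_{d+2},\ldots)$ with zero constant term such that $G_d(X_d(z;x_{d+1},\ldots),x_{d+1},\ldots)=z$. Define, for $1\le j\le d$,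 inductively $$X_d^{(d)}=X_d(z;x_{d+1},\ldots),\qquad X_j^{(d)}=X_j\bigl(0;X_{j+1}^{(d)},\ldots,X_d^{(d)},x_{d+1},\ldots\bigr)\quad (j<d).$$ Then all these substitutions are well defined, and $$F_n^{(d)}(z;x_{d+1},\ldots)=F_n\bigl(X_1^{(d)},X_2^{(d)},\ldots,X_d^{(d)},x_{d+1},x_{d+2},\ldots\bigr).$$ (For $d=0$ the last identity reads $F_n^{(0)}=F_n(x_1,x_2,\ldots)$ and holds as well.) -/

import Mathlib

open MvPowerSeries

/-! Planar maps, as combinatorial maps on oriented edges (darts). -/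

/-- A rooted planar map with darts (oriented edges) labelled by `Fin N`.
`α` reverses a dart; `φ x` is the dart following `x` along the boundary of the face on the right
of `x`. So the faces are the cycles of `φ`, the edges are the cycles of `α`, and the vertices are
the cycles of `φ * α`, the cycle of `x` being the origin of `x` (`φ (α x)` starts where `x` starts).
The graph is connected, and it is drawn on the sphere: `V + F = E + 2`.
The root edge is the dart numbered `0`. The case `N = 0` is the map reduced to one vertex,
whose only face is the outer face, of degree `0`. -/
structure LabelledMap where
  N : ℕ
  α : Equiv.Perm (Fin N)
  φ : Equiv.Perm (Fin N)
  α_involutive : ∀ x, α (α x) = x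
  α_ne : ∀ x, α x ≠ x
  connected : ∀ x y, ∃ g ∈ Subgroup.closure {α, φ}, g x = y
  planar : 0 < N →
    Nat.card (Quotient (Equiv.Perm.SameCycle.setoid (φ * α))) +
      Nat.card (Quotient (Equiv.Perm.SameCycle.setoid φ)) =
    Nat.card (Quotient (Equiv.Perm.SameCycle.setoid α)) + 2

namespace LabelledMap

abbrev Vertex (M : LabelledMap) : Type := Quotient (Equiv.Perm.SameCycle.setoid (M.φ * M.α))

abbrev Edge (M : LabelledMap) : Type := Quotient (Equiv.Perm.SameCycle.setoid M.α)

/-- Faces carrying at least one dart; this omits only the outer face of the one-vertex map. -/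
abbrev Face (M : LabelledMap) : Type := Quotient (Equiv.Perm.SameCycle.setoid M.φ)

/-- The origin of a dart. -/
def origin (M : LabelledMap) (x : Fin M.N) : M.Vertex := Quotient.mk _ x

def edgeOf (M : LabelledMap) (x : Fin M.N) : M.Edge := Quotient.mk _ x

/-- The face on the right of a dart. -/
def faceOf (M : LabelledMap) (x : Fin M.N) : M.Face := Quotient.mk _ x

/-- The dart is the root. -/
def IsRoot (M : LabelledMap) (x : Fin M.N) : Prop := (x : ℕ) = 0

/-- The outer face is the face on the right of the root. -/
def IsOuter (M : LabelledMap) (f : M.Face) : Prop := ∃ r, M.IsRoot r ∧ M.faceOf r = f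

noncomputable def degree (M : LabelledMap) (f : M.Face) : ℕ := Nat.card {x // M.faceOf x = f}

noncomputable def outerDegree (M : LabelledMap) : ℕ := Nat.card {x // M.IsOuter (M.faceOf x)}

/-- The inner faces of degree `k`. -/
def InnerFace (M : LabelledMap) (k : ℕ) : Type := {f : M.Face // ¬ M.IsOuter f ∧ M.degree f = k}

/-- A cycle of length `k`: a closed path of `k ≥ 1` darts visiting each of its vertices and each of
its edges once (`finRotate k i` is the index following `i` cyclically). -/
def IsCycle (M : LabelledMap) (k : ℕ) (c : Fin k → Fin M.N) : Prop :=
  0 < k ∧ (∀ i, M.origin (c (finRotate k i)) = M.origin (M.α (c i))) ∧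
    Function.Injective (fun i => M.origin (c i)) ∧ Function.Injective (fun i => M.edgeOf (c i))

/-- The minimal length of a cycle, `⊤` for a tree. -/
noncomputable def girth (M : LabelledMap) : ℕ∞ :=
  ⨅ k ∈ {k : ℕ | ∃ c, M.IsCycle k c}, (k : ℕ∞)

/-- The girth is at least `d`, and every cycle of length `d` is the boundary of an inner face of
degree `d`, i.e. its edges are exactly the edges incident to that face. -/
def IsIrreducible (M : LabelledMap) (d : ℕ) : Prop :=
  (d : ℕ∞) ≤ M.girth ∧ ∀ c, M.IsCycle d c → ∃ f : M.InnerFace d,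
    {a | ∃ i, M.edgeOf (c i) = a} = {a | ∃ x, M.faceOf x = f.1 ∧ M.edgeOf x = a}

/-- Isomorphism of rooted maps. -/
def Iso (M M' : LabelledMap) : Prop :=
  ∃ e : Fin M.N ≃ Fin M'.N, (∀ x, e (M.α x) = M'.α (e x)) ∧ (∀ x, e (M.φ x) = M'.φ (e x)) ∧
    ∀ x, M'.IsRoot (e x) ↔ M.IsRoot x

instance isoSetoid : Setoid LabelledMap where
  r := Iso
  iseqv :=
    { refl := fun _ => ⟨Equiv.refl _, fun _ => rfl, fun _ => rfl, fun _ => Iff.rfl⟩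
      symm := by
        rintro M M' ⟨e, h1, h2, h3⟩
        refine ⟨e.symm, fun x => ?_, fun x => ?_, fun x => ?_⟩
        · rw [Equiv.symm_apply_eq, h1, Equiv.apply_symm_apply]
        · rw [Equiv.symm_apply_eq, h2, Equiv.apply_symm_apply]
        · rw [← h3, Equiv.apply_symm_apply]
      trans := by
        rintro M M' M'' ⟨e, h1, h2, h3⟩ ⟨e', h1', h2', h3'⟩
        exact ⟨e.trans e', fun x => by simp [h1, h1'], fun x => by simp [h2, h2'],
          fun x => by simp [h3, h3']⟩ }

/-- `M'` is obtained from `M` by gluing, inside each inner face `f` of degree `d`, the rooted map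
`m f` (of outer degree `d`), the root edge of `m f` being identified with the edge of the dart `e f`
chosen on `f`.
The darts of `M` and of the `m f` become darts of `M'` through `j` and `k f`. With `f` on the right
of `e f` and the outer face of `m f` on the right of its root `r`, the outer darts
`r, φ r, φ² r, …` of `m f` are identified in this order with the reversals of
`e f, φ⁻¹ (e f), φ⁻² (e f), …`. The faces of `M'` are the faces of `M` other than its inner faces of
degree `d`, and the inner faces of the `m f`; the last condition says that each dart of `M'` has
exactly one of these faces on its right, and that there are no further identifications. -/
def IsGluing (M : LabelledMap) (d : ℕ) (e : M.InnerFace d → Fin M.N)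
    (m : M.InnerFace d → LabelledMap) (M' : LabelledMap) : Prop :=
  ∃ (j : Fin M.N → Fin M'.N) (k : ∀ f, Fin (m f).N → Fin M'.N),
    (∀ x, M.IsRoot x → M'.IsRoot (j x)) ∧
    (∀ x, j (M.α x) = M'.α (j x)) ∧
    (∀ f x, k f ((m f).α x) = M'.α (k f x)) ∧
    (∀ x, (¬ ∃ f : M.InnerFace d, f.1 = M.faceOf x) → j (M.φ x) = M'.φ (j x)) ∧
    (∀ f x, ¬ (m f).IsOuter ((m f).faceOf x) → k f ((m f).φ x) = M'.φ (k f x)) ∧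
    (∀ f r, (m f).IsRoot r → ∀ i : ℕ,
      k f (((m f).φ ^ i) r) = j (M.α ((M.φ⁻¹ ^ i) (e f)))) ∧
    Function.Bijective (Sum.elim
      (fun x : {x // ¬ ∃ f : M.InnerFace d, f.1 = M.faceOf x} => j x.1)
      (fun y : (Σ f, {x // ¬ (m f).IsOuter ((m f).faceOf x)}) => k y.1 y.2.1))

end LabelledMap

/-- Rooted planar maps, up to isomorphism. -/
abbrev RootedMap : Type := Quotient LabelledMap.isoSetoid

/-- A labelled representative of a rooted map. -/
noncomputable def RootedMap.rep (M : RootedMap) : LabelledMap := Quotient.out M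

/-- `d`-irreducible rooted maps of outer degree `n`. -/
abbrev IrrMap (d n : ℕ) : Type :=
  {M : RootedMap // M.rep.outerDegree = n ∧ M.rep.IsIrreducible d}

/-- Rooted maps of girth at least `d` and outer degree `n`. -/
abbrev GirthGeMap (d n : ℕ) : Type :=
  {M : RootedMap // M.rep.outerDegree = n ∧ (d : ℕ∞) ≤ M.rep.girth}

/-- Rooted maps of girth `d` and outer degree `d`. -/
abbrev GirthEqMap (d : ℕ) : Type :=
  {M : RootedMap // M.rep.outerDegree = d ∧ M.rep.girth = (d : ℕ∞)}

/-- A `d`-irreducible map of outer degree `n`, with a rooted map of girth `d` and outer degree `d`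
for each of its inner faces of degree `d`. -/
abbrev FilledMap (d n : ℕ) : Type :=
  Σ M : IrrMap d n, (M.1.rep.InnerFace d → GirthEqMap d)

/-- A choice, for each `d`-irreducible map of outer degree `n`, of a distinguished incident edge
for each of its inner faces of degree `d`. -/
abbrev EdgeSelection (d n : ℕ) : Type :=
  ∀ (M : IrrMap d n) (f : M.1.rep.InnerFace d), {x // M.1.rep.faceOf x = f.1}

/-! Generating functions. All of them live in the formal power series over `ℤ` in variables
indexed by `ℕ`; the variable of index `i` marks the inner faces of degree `i`. In a series attached
to `d`, the variable of index `d` is called `z`, and that of index `i > d` is called `x_i`. -/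

/-- `M` has `μ k` inner faces of degree `k`, for every `k`. -/
def HasInnerDegrees (M : RootedMap) (μ : ℕ →₀ ℕ) : Prop :=
  ∀ k, Nat.card (M.rep.InnerFace k) = μ k

/-- The generating function `F_n^{(d)}(z; x_{d+1}, x_{d+2}, …)`. -/
noncomputable def irrSeries (d n : ℕ) : MvPowerSeries ℕ ℤ := fun μ =>
  (Nat.card {M : RootedMap //
    (M.rep.outerDegree = n ∧ M.rep.IsIrreducible d) ∧ HasInnerDegrees M μ} : ℤ)

/-- The generating function `G_d(x_d, x_{d+1}, …)` of rooted maps of girth `d` and outer degree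
`d`. -/
noncomputable def girthSeries (d : ℕ) : MvPowerSeries ℕ ℤ := fun μ =>
  (Nat.card {M : RootedMap //
    (M.rep.outerDegree = d ∧ M.rep.girth = (d : ℕ∞)) ∧ HasInnerDegrees M μ} : ℤ)

/-- `Cat(n/2)`, which is zero for odd `n`. -/
def catHalf (n : ℕ) : ℤ := if Even n then (catalan (n / 2) : ℤ) else 0

/-- The family of values `z` at index `d` and `x i` at the indices `i > d`. The smaller indices do
not matter for the series attached to `d`, and get the value `0`. -/
noncomputable def weights (d : ℕ) (z : MvPowerSeries ℕ ℤ) (x : ℕ → MvPowerSeries ℕ ℤ) :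
    ℕ → MvPowerSeries ℕ ℤ :=
  fun i => if i < d then 0 else if i = d then z else x i

/-- `S(z; x_{d+1}, x_{d+2}, …)`, for a series `S` attached to `d`. -/
noncomputable def evalAt (d : ℕ) (S z : MvPowerSeries ℕ ℤ) (x : ℕ → MvPowerSeries ℕ ℤ) :
    MvPowerSeries ℕ ℤ :=
  subst (weights d z x) S

/-- `Y` is a series `X_d(z; x_{d+1}, …)` with zero constant term, and
`G_d(X_d(z; x_{d+1}, …), x_{d+1}, …) = z`. -/
def IsInverseSeries (d : ℕ) (Y : MvPowerSeries ℕ ℤ) : Prop :=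
  constantCoeff Y = 0 ∧ (∀ μ : ℕ →₀ ℕ, (∃ i < d, μ i ≠ 0) → coeff μ Y = 0) ∧
    evalAt d (girthSeries d) Y X = X d

/-- The series `X_j^{(d)}(z; x_{d+1}, …)` built from the series `Y i = X_i(z; x_{i+1}, …)`:
`X_d^{(d)} = X_d`, and `X_j^{(d)} = X_j(0; X_{j+1}^{(d)}, …, X_d^{(d)}, x_{d+1}, …)` for `j < d`.
For `j > d` it is `x_j`, so that `renorm Y d` is the family
`X_1^{(d)}, …, X_d^{(d)}, x_{d+1}, x_{d+2}, …`. -/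
noncomputable def renorm (Y : ℕ → MvPowerSeries ℕ ℤ) (d j : ℕ) : MvPowerSeries ℕ ℤ :=
  if j < d then
    evalAt j (Y j) 0 (fun i => if j < i ∧ i ≤ d then renorm Y d i else X i)
  else if j = d then Y d
  else X j
termination_by d - j

/-! Planarity enters through homology modulo 2. For a connected combinatorial map, the boundaries of
sets of faces form a space of dimension F - 1 inside the cycle space, of dimension E - V + 1, so
Euler's formula says exactly that the two spaces agree (`euler_iff_isExact`). This is the form of
the Jordan curve theorem that is needed: a closed trail bounds a union of faces, called a region
(`exists_region_of_trail`). Conversely, a proper region with boundary of minimal size is bounded by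
a simple cycle (`exists_isCycle`). Hence girth at least d means that every proper nonempty region
has at least d boundary darts (`natCast_le_girth`), and d-irreducibility means in addition that the
regions off the root with exactly d boundary darts are single faces (`isIrreducible_iff`).

The size of the boundary is submodular (`card_bd_union_add_inter`). In girth at least d, a cell is
an inner region with d boundary darts. The union of two overlapping cells is a cell, so maximal
cells are disjoint. Deleting the edges inside them leaves a d-irreducible map, and each maximal
cell, its complement being collapsed to an outer face, is a map of girth d and outer degree d; this
makes gluing surjective (`IsCollapse.glued`). For injectivity, `inner_region_bound` uncrosses an
inner region of a gluing with the glued pieces: the girth is at least d and the maximal cells are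
exactly these pieces. Collapses are unique because origins along a minimal boundary are distinct,
and rooted maps have no automorphisms. Gluings exist (`exists_glued`) because vertex potentials on
the pieces can be shifted to agree along common boundaries.

In terms of series, F_n^(d) evaluated at z = G_d counts the maps of girth at least d and outer
degree n. These are also the (d-1)-irreducible maps without inner faces of degree d - 1
(`girthGe_succ_iff`), whence the substitution identity. For n = d they are the maps of girth d and
the plane trees; the latter correspond to noncrossing matchings, counted by Catalan numbers. The
d-gon is the only map contributing the monomial x_d to G_d, so G_d has linear coefficient 1 in x_d
and is inverted by a contraction argument. Inserting the inverse expresses level d + 1 through level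
d, and induction on d gives the last formula. -/

/-! ### Exactness of the cellular complex of a connected combinatorial map, modulo 2 -/

namespace CombMap

open Equiv.Perm

variable {D : Type*}

/-- No proper nonempty set of darts is stable under both permutations. -/
def IsConn (α φ : Equiv.Perm D) : Prop :=
  ∀ p : D → Prop, (∀ x, p x → p (α x)) → (∀ x, p x → p (φ x)) → ∀ x y, p x → p y

/-- The functions modulo 2 which are constant on the cycles of a permutation. -/
def invFun (π : Equiv.Perm D) : Submodule (ZMod 2) (D → ZMod 2) where
  carrier := {a | ∀ x, a (π x) = a x}
  add_mem' := fun ha hb x => by simp [ha x, hb x]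
  zero_mem' := fun _ => rfl
  smul_mem' := fun c a ha x => by simp [ha x]

/-- Every even set of edges is the boundary of a set of faces. -/
def IsExact [Fintype D] (α φ : Equiv.Perm D) : Prop :=
  ∀ w : D → ZMod 2, (∀ x, w (α x) = w x) →
    (∀ a : D → ZMod 2, (∀ x, a (φ (α x)) = a x) → ∑ x, a x * w x = 0) →
    ∃ h : D → ZMod 2, (∀ x, h (φ x) = h x) ∧ ∀ x, w x = h x + h (α x)

theorem eq_of_sameCycle [Finite D] {β : Type*} {π : Equiv.Perm D} {h : D → β}
    (hh : ∀ x, h (π x) = h x) {x y : D} (hxy : π.SameCycle x y) : h x = h y := by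
  classical
  have := Fintype.ofFinite D
  obtain ⟨n, -, -, rfl⟩ := hxy.exists_pow_eq π
  clear hxy
  induction n with
  | zero => rfl
  | succ n ih => rw [pow_succ', Equiv.Perm.mul_apply, hh, ← ih]

theorem isConn_iff [Finite D] {α φ : Equiv.Perm D} :
    IsConn α φ ↔ ∀ x y, ∃ g ∈ Subgroup.closure {α, φ}, g x = y := by
  constructor
  · intro h x y
    refine h (fun y => ∃ g ∈ Subgroup.closure {α, φ}, g x = y) ?_ ?_ x y
      ⟨1, Subgroup.one_mem _, rfl⟩
    · rintro _ ⟨g, hg, rfl⟩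
      exact ⟨α * g, Subgroup.mul_mem _ (Subgroup.subset_closure (by simp)) hg, rfl⟩
    · rintro _ ⟨g, hg, rfl⟩
      exact ⟨φ * g, Subgroup.mul_mem _ (Subgroup.subset_closure (by simp)) hg, rfl⟩
  · intro h p hα hφ x y hx
    obtain ⟨g, hg, rfl⟩ := h x y
    have key : ∀ π : Equiv.Perm D, (∀ x, p x → p (π x)) → ∀ x, p (π x) ↔ p x := by
      intro π hπ x
      classical
      have := Fintype.ofFinite D
      refine ⟨fun hx => ?_, hπ x⟩
      -- By finiteness `x` is a nonnegative power of `π` applied to `π x`, so a set stable under `π`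
      -- is stable under its inverse.
      obtain ⟨n, -, -, hn⟩ := (SameCycle.symm ⟨1, by simp⟩ : π.SameCycle (π x) x).exists_pow_eq π
      rw [← hn]
      clear hn
      induction n with
      | zero => exact hx
      | succ n ih => rw [pow_succ', Equiv.Perm.mul_apply]; exact hπ _ ih
    have : ∀ x, p (g x) ↔ p x := by
      induction hg using Subgroup.closure_induction with
      | mem π hπ =>
        rcases hπ with rfl | rfl
        · exact key _ hα
        · exact key _ hφ
      | one => simp
      | mul a b _ _ iha ihb => intro x; rw [Equiv.Perm.mul_apply, iha, ihb]
      | inv a _ ih => intro x; rw [← ih]; simp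
    exact (this x).2 hx

theorem IsConn.eq [Finite D] {β : Type*} {α φ : Equiv.Perm D} (hc : IsConn α φ) {h : D → β}
    (h1 : ∀ x, h (α x) = h x) (h2 : ∀ x, h (φ x) = h x) (x y : D) : h x = h y :=
  (hc (fun z => h z = h x) (fun z hz => (h1 z).trans hz) (fun z hz => (h2 z).trans hz) x y rfl).symm

/-! ### Dimension counts over the field with two elements -/

section Dim

variable [Fintype D]

/-- Turns the numbers of vertices, edges and faces in Euler's formula into dimensions. -/
theorem finrank_invFun (π : Equiv.Perm D) :
    Module.finrank (ZMod 2) (invFun π) = Nat.card (Quotient (SameCycle.setoid π)) := by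
  classical
  let e : invFun π ≃ₗ[ZMod 2] (Quotient (SameCycle.setoid π) → ZMod 2) :=
    { toFun := fun a q => Quotient.lift a.1 (fun x y h => eq_of_sameCycle a.2 h) q
      invFun := fun b => ⟨fun x => b (Quotient.mk _ x), fun x => by
        exact congrArg b (Quotient.sound (SameCycle.symm ⟨1, by simp⟩))⟩
      left_inv := fun a => rfl
      right_inv := fun b => by ext q; induction q using Quotient.inductionOn; rfl
      map_add' := fun a b => by ext q; induction q using Quotient.inductionOn; rfl
      map_smul' := fun a b => by ext q; induction q using Quotient.inductionOn; rfl }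
  have : Fintype (Quotient (SameCycle.setoid π)) := Fintype.ofFinite _
  rw [e.finrank_eq, Module.finrank_fintype_fun_eq_card, Nat.card_eq_fintype_card]

theorem sum_eq_zero_of_invol {α : Equiv.Perm D} (hα : ∀ x, α (α x) = x) (hne : ∀ x, α x ≠ x)
    {w : D → ZMod 2} (hw : ∀ x, w (α x) = w x) : ∑ x, w x = 0 :=
  Finset.sum_involution (fun x _ => α x) (fun x _ => by rw [hw, CharTwo.add_self_eq_zero])
    (fun x _ _ => hne x) (fun _ _ => Finset.mem_univ _) (fun x _ => hα x)

/-- The dot product. -/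
noncomputable def dotForm (D : Type*) [Fintype D] : LinearMap.BilinForm (ZMod 2) (D → ZMod 2) :=
  dotProductBilin (ZMod 2) (ZMod 2)

theorem dotForm_apply (a b : D → ZMod 2) : dotForm D a b = ∑ x, a x * b x := rfl

theorem finrank_orth (W : Submodule (ZMod 2) (D → ZMod 2)) :
    Module.finrank (ZMod 2) W + Module.finrank (ZMod 2) ((dotForm D).orthogonal W) =
      Fintype.card D := by
  classical
  have hr : (dotForm D).IsRefl := by
    intro a b h
    rw [dotForm_apply] at h ⊢
    simpa [mul_comm] using h
  have := LinearMap.BilinForm.finrank_add_finrank_orthogonal hr W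
  have h0 : (dotForm D).orthogonal ⊤ = ⊥ := by
    rw [eq_bot_iff]
    intro a ha
    rw [LinearMap.BilinForm.mem_orthogonal_iff] at ha
    rw [Submodule.mem_bot]
    ext x
    have := ha (Pi.single x 1) trivial
    rw [dotForm_apply] at this
    simpa [Pi.single_apply] using this
  rw [this, h0]
  simp

/-- Pairing with the indicator of an edge gives the sum of the two values there, which vanishes
exactly when they agree; between two invariant functions the contributions of the two darts of an
edge cancel. -/
theorem invFun_orth {α : Equiv.Perm D} (hα : ∀ x, α (α x) = x) (hne : ∀ x, α x ≠ x) :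
    (dotForm D).orthogonal (invFun α) = invFun α := by
  classical
  ext w
  rw [LinearMap.BilinForm.mem_orthogonal_iff]
  constructor
  · intro h x
    have := h (Pi.single x 1 + Pi.single (α x) 1) (fun y => by
      simp only [Pi.add_apply, Pi.single_apply]
      rw [add_comm, show (α y = α x) = (y = x) by simp, show (α y = x) = (y = α x) by
        rw [eq_iff_iff]; constructor
        · rintro rfl; exact (hα _).symm
        · rintro rfl; exact hα _])
    rw [dotForm_apply] at this
    simp only [Pi.add_apply, Pi.single_apply, add_mul, ite_mul, one_mul, zero_mul,
      Finset.sum_add_distrib, Finset.sum_ite_eq', Finset.mem_univ, if_true] at this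
    rw [add_comm] at this
    exact CharTwo.add_eq_zero.1 this
  · intro h a ha
    rw [dotForm_apply]
    exact sum_eq_zero_of_invol hα hne (fun x => by rw [h x, ha x])

/-- `h ↦ h + h ∘ α` on `φ`-invariant functions. -/
noncomputable def coboundary (α φ : Equiv.Perm D) : invFun φ →ₗ[ZMod 2] (D → ZMod 2) where
  toFun h := fun x => h.1 x + h.1 (α x)
  map_add' := fun a b => by ext x; simp; ring
  map_smul' := fun c a => by ext x; simp; ring

/-- The kernel consists of the functions invariant under both permutations, which are constant by
connectedness. -/
theorem finrank_coboundary [Nonempty D] {α φ : Equiv.Perm D} (hc : IsConn α φ) :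
    Module.finrank (ZMod 2) (LinearMap.range (coboundary α φ)) + 1 =
      Module.finrank (ZMod 2) (invFun φ) := by
  obtain ⟨x0⟩ := ‹Nonempty D›
  rw [← (coboundary α φ).finrank_range_add_finrank_ker]
  congr 1
  symm
  rw [finrank_eq_one_iff']
  refine ⟨⟨⟨fun _ => 1, fun _ => rfl⟩, ?_⟩, ?_, ?_⟩
  · rw [LinearMap.mem_ker]
    ext x
    exact CharTwo.add_self_eq_zero _
  · intro h
    have := congrFun (congrArg (fun z => z.1.1) h) x0
    exact one_ne_zero this
  · rintro ⟨⟨h, hφ⟩, hk⟩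
    rw [LinearMap.mem_ker] at hk
    refine ⟨h x0, ?_⟩
    ext x
    have : ∀ y, h (α y) = h y := fun y => (CharTwo.add_eq_zero.1 (congrFun hk y)).symm
    simpa using hc.eq this hφ x0 x

/-- Since `invFun α` is its own orthogonal, the space is the orthogonal of the sum of edge and
vertex functions. That sum has dimension E + V - 1, the common functions being constant, in a space
of dimension 2E. -/
theorem finrank_cycles [Nonempty D] {α φ : Equiv.Perm D} (hα : ∀ x, α (α x) = x)
    (hne : ∀ x, α x ≠ x) (hc : IsConn α φ) :
    Module.finrank (ZMod 2) (invFun α ⊓ (dotForm D).orthogonal (invFun (φ * α)) :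
        Submodule (ZMod 2) (D → ZMod 2)) + Module.finrank (ZMod 2) (invFun (φ * α)) =
      Module.finrank (ZMod 2) (invFun α) + 1 := by
  obtain ⟨x0⟩ := ‹Nonempty D›
  have h1 : invFun α ⊓ (dotForm D).orthogonal (invFun (φ * α)) =
      (dotForm D).orthogonal (invFun α ⊔ invFun (φ * α)) := by
    conv_lhs => rw [← invFun_orth hα hne]
    ext w
    simp only [Submodule.mem_inf, LinearMap.BilinForm.mem_orthogonal_iff]
    constructor
    · rintro ⟨h1, h2⟩ a ha
      obtain ⟨b, hb, c, hc, rfl⟩ := Submodule.mem_sup.1 ha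
      have := h1 b hb
      have := h2 c hc
      simp_all
    · exact fun h => ⟨fun a ha => h a (Submodule.mem_sup_left ha),
        fun a ha => h a (Submodule.mem_sup_right ha)⟩
  have h2 := finrank_orth (invFun α ⊔ invFun (φ * α))
  have h3 := finrank_orth (invFun α)
  rw [invFun_orth hα hne] at h3
  have h4 := Submodule.finrank_sup_add_finrank_inf_eq (invFun α) (invFun (φ * α))
  have h5 : Module.finrank (ZMod 2) (invFun α ⊓ invFun (φ * α) :
      Submodule (ZMod 2) (D → ZMod 2)) = 1 := by
    rw [finrank_eq_one_iff']
    refine ⟨⟨fun _ => 1, ⟨fun _ => rfl, fun _ => rfl⟩⟩, ?_, ?_⟩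
    · intro h
      exact one_ne_zero (congrFun (congrArg (fun z => z.1) h) x0)
    · rintro ⟨h, ha, hs⟩
      refine ⟨h x0, ?_⟩
      have hφ : ∀ x, h (φ x) = h x := fun x => by
        have := hs (α x)
        rw [Equiv.Perm.mul_apply, hα] at this
        rw [this, ha]
      ext x
      simpa using hc.eq ha hφ x0 x
  rw [h1]
  omega

/-- The edges separating a set of faces from the rest are even in number at each vertex: rotating
all darts one step about their origins exchanges the two halves of the sum. -/
theorem range_coboundary_le {α φ : Equiv.Perm D} (hα : ∀ x, α (α x) = x) :
    LinearMap.range (coboundary α φ) ≤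
      invFun α ⊓ (dotForm D).orthogonal (invFun (φ * α)) := by
  rintro _ ⟨⟨h, hφ⟩, rfl⟩
  refine ⟨fun x => ?_, ?_⟩
  · change h (α x) + h (α (α x)) = h x + h (α x)
    rw [hα, add_comm]
  · rw [SetLike.mem_coe, LinearMap.BilinForm.mem_orthogonal_iff]
    intro a ha
    rw [dotForm_apply]
    change ∑ x, a x * (h x + h (α x)) = 0
    simp_rw [mul_add]
    rw [Finset.sum_add_distrib]
    have : ∑ x, a x * h x = ∑ x, a x * h (α x) := by
      rw [← Equiv.sum_comp (φ * α) (fun x => a x * h x)]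
      refine Finset.sum_congr rfl (fun x _ => ?_)
      rw [ha x, Equiv.Perm.mul_apply, hφ]
    rw [this, CharTwo.add_self_eq_zero]

theorem isExact_iff_range {α φ : Equiv.Perm D} :
    IsExact α φ ↔ invFun α ⊓ (dotForm D).orthogonal (invFun (φ * α)) ≤
      LinearMap.range (coboundary α φ) := by
  constructor
  · rintro h w ⟨h1, h2⟩
    rw [SetLike.mem_coe, LinearMap.BilinForm.mem_orthogonal_iff] at h2
    obtain ⟨g, hg, hw⟩ := h w h1 (fun a ha => h2 a ha)
    exact ⟨⟨g, hg⟩, funext fun x => (hw x).symm⟩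
  · intro h w h1 h2
    obtain ⟨⟨g, hg⟩, rfl⟩ := h (x := w) ⟨h1, by
      rw [SetLike.mem_coe, LinearMap.BilinForm.mem_orthogonal_iff]
      exact fun a ha => h2 a ha⟩
    exact ⟨g, hg, fun _ => rfl⟩

/-- Euler's formula is equivalent to exactness. -/
theorem euler_iff_isExact [Nonempty D] {α φ : Equiv.Perm D} (hα : ∀ x, α (α x) = x)
    (hne : ∀ x, α x ≠ x) (hc : IsConn α φ) :
    (Nat.card (Quotient (SameCycle.setoid (φ * α))) + Nat.card (Quotient (SameCycle.setoid φ)) =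
      Nat.card (Quotient (SameCycle.setoid α)) + 2) ↔ IsExact α φ := by
  -- The image of `coboundary` has dimension F - 1 inside a space of dimension E - V + 1; they
  -- coincide exactly when V + F = E + 2.
  simp only [← finrank_invFun]
  have h1 := finrank_coboundary hc
  have h2 := finrank_cycles hα hne hc
  rw [isExact_iff_range]
  constructor
  · intro h
    refine (Submodule.eq_of_le_of_finrank_eq (range_coboundary_le hα) ?_).ge
    omega
  · intro h
    rw [← le_antisymm (range_coboundary_le hα) h] at h2
    omega

/-- Exactness is self-dual. -/
theorem isExact_dual [Nonempty D] {α φ : Equiv.Perm D} (hα : ∀ x, α (α x) = x)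
    (hne : ∀ x, α x ≠ x) (hc : IsConn α φ) : IsExact α (φ * α) ↔ IsExact α φ := by
  have hc' : IsConn α (φ * α) := by
    intro p h1 h2
    refine hc p h1 (fun x hx => ?_)
    have := h2 _ (h1 x hx)
    rwa [Equiv.Perm.mul_apply, hα] at this
  -- Passing from `φ` to `φ * α` exchanges faces and vertices, in which Euler's formula is
  -- symmetric.
  rw [← euler_iff_isExact hα hne hc, ← euler_iff_isExact hα hne hc', mul_assoc,
    show α * α = 1 from Equiv.ext hα, mul_one, add_comm (Nat.card (Quotient _))]

end Dim

end CombMap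

/-! ### Regions, their boundaries, and closed trails -/

namespace CombMap

open Equiv.Perm

variable {D : Type*}

/-- Two darts have the same origin. -/
def SameV (α φ : Equiv.Perm D) (x y : D) : Prop := (φ * α).SameCycle x y

theorem SameV.refl (α φ : Equiv.Perm D) (x : D) : SameV α φ x x := SameCycle.refl _ _

theorem SameV.symm {α φ : Equiv.Perm D} {x y : D} (h : SameV α φ x y) : SameV α φ y x :=
  SameCycle.symm h

theorem SameV.trans {α φ : Equiv.Perm D} {x y z : D} (h : SameV α φ x y) (h' : SameV α φ y z) :
    SameV α φ x z := SameCycle.trans h h'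

theorem sameV_rot (α φ : Equiv.Perm D) (x : D) : SameV α φ (φ (α x)) x :=
  SameCycle.symm ⟨1, by simp⟩

theorem sameV_next {α φ : Equiv.Perm D} (hα : ∀ x, α (α x) = x) (x : D) :
    SameV α φ (φ x) (α x) := by
  have := sameV_rot α φ (α x)
  rwa [hα] at this

/-- A union of faces, as a set of darts. -/
def IsRegion (φ : Equiv.Perm D) (S : Finset D) : Prop := ∀ x ∈ S, φ x ∈ S

theorem IsRegion.iff {φ : Equiv.Perm D} {S : Finset D} (h : IsRegion φ S) (x : D) :
    φ x ∈ S ↔ x ∈ S := by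
  refine ⟨fun hx => ?_, h x⟩
  have := Finset.surj_on_of_inj_on_of_card_le (s := S) (t := S) (fun a _ => φ a) h
    (fun a b _ _ hab => φ.injective hab) le_rfl _ hx
  obtain ⟨y, hy, e⟩ := this
  rwa [φ.injective e]

section

variable [DecidableEq D]

theorem IsRegion.union {φ : Equiv.Perm D} {S T : Finset D} (h : IsRegion φ S)
    (h' : IsRegion φ T) : IsRegion φ (S ∪ T) := fun x hx => by
  rw [Finset.mem_union] at hx ⊢
  exact hx.imp (h x) (h' x)

theorem IsRegion.inter {φ : Equiv.Perm D} {S T : Finset D} (h : IsRegion φ S)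
    (h' : IsRegion φ T) : IsRegion φ (S ∩ T) := fun x hx => by
  rw [Finset.mem_inter] at hx ⊢
  exact hx.imp (h x) (h' x)

/-- The boundary darts of a set of darts. -/
def bd (α : Equiv.Perm D) (S : Finset D) : Finset D := S.filter (fun x => α x ∉ S)

theorem mem_bd {α : Equiv.Perm D} {S : Finset D} {x : D} : x ∈ bd α S ↔ x ∈ S ∧ α x ∉ S :=
  Finset.mem_filter

theorem bd_subset (α : Equiv.Perm D) (S : Finset D) : bd α S ⊆ S := Finset.filter_subset _ _

/-- Submodularity, the source of all uncrossing arguments. It holds dart by dart: a dart bounding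
the union or the intersection bounds `S` or `T`, and one bounding both of them bounds both `S` and
`T`. -/
theorem card_bd_union_add_inter (α : Equiv.Perm D) (S T : Finset D) :
    (bd α (S ∪ T)).card + (bd α (S ∩ T)).card ≤ (bd α S).card + (bd α T).card := by
  rw [← Finset.card_union_add_card_inter (bd α S), ← Finset.card_union_add_card_inter (bd α (S ∪ T))]
  refine add_le_add (Finset.card_le_card fun x hx => ?_) (Finset.card_le_card fun x hx => ?_)
  · simp only [mem_bd, Finset.mem_union, Finset.mem_inter] at hx ⊢
    tauto
  · simp only [mem_bd, Finset.mem_union, Finset.mem_inter] at hx ⊢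
    tauto

variable [Fintype D]

theorem IsRegion.compl {φ : Equiv.Perm D} {S : Finset D} (h : IsRegion φ S) :
    IsRegion φ Sᶜ := fun x hx => by
  rw [Finset.mem_compl] at hx ⊢
  rwa [h.iff]

theorem mem_bd_compl {α : Equiv.Perm D} (hα : ∀ x, α (α x) = x) {S : Finset D} {x : D} :
    x ∈ bd α Sᶜ ↔ α x ∈ bd α S := by
  simp [mem_bd, hα, and_comm]

theorem card_bd_compl {α : Equiv.Perm D} (hα : ∀ x, α (α x) = x) (S : Finset D) :
    (bd α Sᶜ).card = (bd α S).card :=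
  Finset.card_bij (fun x _ => α x) (fun x hx => (mem_bd_compl hα).1 hx)
    (fun a _ b _ h => α.injective h)
    (fun b hb => ⟨α b, (mem_bd_compl hα).2 (by rwa [hα]), hα b⟩)

theorem bd_nonempty {α φ : Equiv.Perm D} (hc : IsConn α φ) {S : Finset D}
    (hS : IsRegion φ S) (h0 : S.Nonempty) (h1 : S ≠ Finset.univ) : (bd α S).Nonempty := by
  by_contra h
  rw [Finset.not_nonempty_iff_eq_empty, Finset.eq_empty_iff_forall_notMem] at h
  obtain ⟨x, hx⟩ := h0
  refine h1 (Finset.eq_univ_iff_forall.2 fun y => hc (· ∈ S) (fun z hz => ?_) hS x y hx)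
  by_contra hz'
  exact h z (mem_bd.2 ⟨hz, hz'⟩)

/-- All proper nonempty regions have at least `d` boundary darts. -/
def GirthGe (α φ : Equiv.Perm D) (d : ℕ) : Prop :=
  ∀ S : Finset D, IsRegion φ S → S.Nonempty → S ≠ Finset.univ → d ≤ (bd α S).card

/-- Complementation preserves the size of the boundary, so of a region and its complement only the
one without `r` has to be tested. -/
theorem girthGe_of_notMem {α φ : Equiv.Perm D} (hα : ∀ x, α (α x) = x) (r : D) {d : ℕ}
    (h : ∀ S : Finset D, IsRegion φ S → S.Nonempty → r ∉ S → d ≤ (bd α S).card) :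
    GirthGe α φ d := by
  intro S hS h0 h1
  by_cases hr : r ∈ S
  · rw [← card_bd_compl hα]
    refine h _ hS.compl ?_ (by simpa using hr)
    rwa [Finset.nonempty_iff_ne_empty, Ne, Finset.compl_eq_empty_iff]
  · exact h S hS h0 hr

theorem sum_telescope (a : ℕ → ZMod 2) (n : ℕ) :
    ∑ k ∈ Finset.range n, (a k + a (k + 1)) = a 0 + a n := by
  induction n with
  | zero => simp [CharTwo.add_self_eq_zero]
  | succ n ih =>
    rw [Finset.sum_range_succ, ih]
    linear_combination (a n) * (CharTwo.two_eq_zero (R := ZMod 2))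

/-- A closed trail bounds a region. -/
theorem exists_region_of_trail {α φ : Equiv.Perm D} (hα : ∀ x, α (α x) = x)
    (hex : IsExact α φ) (f : ℕ → D) (n : ℕ) (hinj : ∀ k < n, ∀ l < n, f k = f l → k = l)
    (hopp : ∀ k < n, ∀ l < n, f k ≠ α (f l)) (hstep : ∀ k < n, SameV α φ (f (k + 1)) (α (f k)))
    (hclose : SameV α φ (f n) (f 0)) (r : D) :
    ∃ S : Finset D, IsRegion φ S ∧ r ∉ S ∧ (bd α S).card = n ∧
      ∀ x, ((x ∈ S ↔ α x ∉ S) ↔ ∃ k < n, x = f k ∨ x = α (f k)) := by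
  set O : Finset D := (Finset.range n).image f with hO
  have memO : ∀ x, x ∈ O ↔ ∃ k < n, f k = x := by simp [hO]
  have hdis : ∀ x, x ∈ O → α x ∉ O := by
    intro x hx hx'
    obtain ⟨k, hk, rfl⟩ := (memO _).1 hx
    obtain ⟨l, hl, e⟩ := (memO _).1 hx'
    exact hopp l hl k hk e
  -- The indicator of the edges of the trail. It is orthogonal to vertex functions because the sum
  -- along the trail telescopes.
  let w : D → ZMod 2 := fun x => (if x ∈ O then 1 else 0) + (if α x ∈ O then 1 else 0)
  have hw1 : ∀ x, w x = 1 ↔ ∃ k < n, x = f k ∨ x = α (f k) := by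
    intro x
    have : (∃ k < n, x = f k ∨ x = α (f k)) ↔ (x ∈ O ∨ α x ∈ O) := by
      rw [memO, memO]
      constructor
      · rintro ⟨k, hk, rfl | rfl⟩
        · exact Or.inl ⟨k, hk, rfl⟩
        · exact Or.inr ⟨k, hk, (hα _).symm⟩
      · rintro (⟨k, hk, rfl⟩ | ⟨k, hk, e⟩)
        · exact ⟨k, hk, Or.inl rfl⟩
        · exact ⟨k, hk, Or.inr (by rw [e, hα])⟩
    rw [this]
    by_cases h1 : x ∈ O
    · simp [w, h1, hdis x h1]
    · by_cases h2 : α x ∈ O <;> simp [w, h1, h2]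
  obtain ⟨h, hφ, hwh⟩ := hex w (fun x => by simp only [w, hα]; ring) (by
    intro a ha
    have hV : ∀ x y, SameV α φ x y → a x = a y := fun x y hxy => eq_of_sameCycle ha hxy
    simp only [w, mul_add, Finset.sum_add_distrib]
    have e1 : ∑ x, a x * (if α x ∈ O then 1 else 0) = ∑ x, a (α x) * (if x ∈ O then 1 else 0) := by
      rw [← Equiv.sum_comp α]
      simp only [hα]
    rw [e1, ← Finset.sum_add_distrib]
    simp only [mul_ite, mul_one, mul_zero]
    have e2 : ∀ x, ((if x ∈ O then a x else 0) + if x ∈ O then a (α x) else 0) =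
        if x ∈ O then a x + a (α x) else 0 := fun x => by split_ifs <;> simp
    simp only [e2]
    rw [Finset.sum_ite_mem, Finset.univ_inter, hO, Finset.sum_image (fun k hk l hl e =>
      hinj k (by simpa using hk) l (by simpa using hl) e)]
    rw [Finset.sum_congr rfl (g := fun k => a (f k) + a (f (k + 1))) (fun k hk => by
      rw [hV _ _ (hstep k (by simpa using hk))])]
    rw [sum_telescope (fun k => a (f k)) n, hV _ _ hclose, CharTwo.add_self_eq_zero])
  have two : ∀ a b c : ZMod 2, (¬ a = c ↔ ¬ ¬ b = c) ↔ a + b = 1 := by decide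
  -- Comparing with the value at `r`, rather than with zero, keeps `r` outside the region.
  set S : Finset D := Finset.univ.filter (fun x => ¬ h x = h r) with hS
  have memS : ∀ x, x ∈ S ↔ ¬ h x = h r := by simp [hS]
  have hedge : ∀ x, ((x ∈ S ↔ α x ∉ S) ↔ ∃ k < n, x = f k ∨ x = α (f k)) := by
    intro x
    rw [memS, memS, two, ← hwh, hw1]
  refine ⟨S, fun x hx => ?_, by simp [hS], ?_, hedge⟩
  · rw [memS] at hx ⊢
    rwa [hφ]
  -- Each edge of the trail has exactly one of its darts in `S` and so contributes one boundary
  -- dart.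
  · have key : ∀ k < n, f k ∈ S ∧ α (f k) ∉ S ∨ f k ∉ S ∧ α (f k) ∈ S := by
      intro k hk
      have := (hedge (f k)).2 ⟨k, hk, Or.inl rfl⟩
      tauto
    rw [← Finset.card_range n]
    symm
    refine Finset.card_bij (fun k _ => if f k ∈ S then f k else α (f k)) ?_ ?_ ?_
    · intro k hk
      rw [Finset.mem_range] at hk
      rw [mem_bd]
      rcases key k hk with ⟨h1, h2⟩ | ⟨h1, h2⟩
      · rw [if_pos h1]; exact ⟨h1, h2⟩
      · rw [if_neg h1, hα]; exact ⟨h2, h1⟩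
    · intro k hk l hl e
      rw [Finset.mem_range] at hk hl
      split_ifs at e
      · exact hinj k hk l hl e
      · exact absurd e (hopp k hk l hl)
      · exact absurd e.symm (hopp l hl k hk)
      · exact hinj k hk l hl (α.injective e)
    · intro x hx
      rw [mem_bd] at hx
      obtain ⟨k, hk, rfl | rfl⟩ := (hedge x).1 (by tauto)
      · exact ⟨k, Finset.mem_range.2 hk, if_pos hx.1⟩
      · refine ⟨k, Finset.mem_range.2 hk, if_neg ?_⟩
        rw [hα] at hx
        exact hx.2

theorem GirthGe.le_of_trail {α φ : Equiv.Perm D} {d : ℕ} (hg : GirthGe α φ d)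
    (hα : ∀ x, α (α x) = x)
    (hex : IsExact α φ) (f : ℕ → D) (n : ℕ) (hn : 0 < n)
    (hinj : ∀ k < n, ∀ l < n, f k = f l → k = l)
    (hopp : ∀ k < n, ∀ l < n, f k ≠ α (f l)) (hstep : ∀ k < n, SameV α φ (f (k + 1)) (α (f k)))
    (hclose : SameV α φ (f n) (f 0)) : d ≤ n := by
  obtain ⟨S, h1, h2, h3, -⟩ := exists_region_of_trail hα hex f n hinj hopp hstep hclose (f 0)
  rw [← h3]
  refine hg S h1 ?_ (fun h => h2 (h ▸ Finset.mem_univ _))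
  rw [← h3] at hn
  exact (Finset.card_pos.1 hn).mono (bd_subset _ _)

/-- On a boundary of minimal length, the boundary successor is transitive, and origins are
distinct. -/
theorem GirthGe.boundary_cycle {α φ : Equiv.Perm D} {d : ℕ} (hg : GirthGe α φ d)
    (hα : ∀ x, α (α x) = x) (hex : IsExact α φ) {S : Finset D} (hd : (bd α S).card = d)
    (N : {x // x ∈ bd α S} → {x // x ∈ bd α S}) (hN : Function.Injective N)
    (hNV : ∀ x, SameV α φ (N x).1 (α x.1)) (x y : {x // x ∈ bd α S}) :
    (∃ k < d, N^[k] x = y) ∧ N^[d] x = x ∧ (SameV α φ x.1 y.1 → x = y) := by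
  set p := Function.minimalPeriod N x with hp
  have hp0 : 0 < p := Function.minimalPeriod_pos_of_mem_periodicPts (hN.mem_periodicPts x)
  have hinj : ∀ k < p, ∀ l < p, (N^[k] x).1 = (N^[l] x).1 → k = l := fun k hk l hl e =>
    Function.iterate_injOn_Iio_minimalPeriod hk hl (Subtype.ext e)
  have hopp : ∀ k l, (N^[k] x).1 ≠ α (N^[l] x).1 := by
    intro k l e
    have h1 := (mem_bd.1 (N^[k] x).2).1
    have h2 := (mem_bd.1 (N^[l] x).2).2
    exact h2 (e ▸ h1)
  have hstep : ∀ k, SameV α φ (N^[k + 1] x).1 (α (N^[k] x).1) := by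
    intro k
    rw [Function.iterate_succ_apply']
    exact hNV _
  have hcl : N^[p] x = x := Function.iterate_minimalPeriod
  -- The orbit of `x` is a closed trail, hence of length at least `d`; its darts are distinct
  -- boundary darts, of which there are only `d`.
  have hdp : d ≤ p := hg.le_of_trail hα hex (fun k => (N^[k] x).1) p hp0 hinj
    (fun k _ l _ => hopp k l) (fun k _ => hstep k) (by
      change SameV α φ (N^[p] x).1 x.1
      rw [hcl]; exact SameV.refl _ _ _)
  have hpd : p ≤ d := by
    rw [← hd, ← Finset.card_range p]
    exact Finset.card_le_card_of_injOn (fun k => (N^[k] x).1) (fun k _ => (N^[k] x).2)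
      (fun k hk l hl e => hinj k (by simpa using hk) l (by simpa using hl) e)
  have hpd' : p = d := le_antisymm hpd hdp
  have hsurj : ∃ k < d, N^[k] x = y := by
    obtain ⟨k, hk, e⟩ := Finset.surj_on_of_inj_on_of_card_le (s := Finset.range p) (t := bd α S)
      (fun k _ => (N^[k] x).1) (fun k _ => (N^[k] x).2)
      (fun k l hk hl e => hinj k (by simpa using hk) l (by simpa using hl) e)
      (by rw [hd, Finset.card_range]; exact hdp) y.1 y.2
    exact ⟨k, by simpa [hpd'] using hk, Subtype.ext e.symm⟩
  refine ⟨hsurj, hpd' ▸ hcl, fun hV => ?_⟩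
  obtain ⟨k, hk, rfl⟩ := hsurj
  rcases Nat.eq_zero_or_pos k with rfl | hk0
  · rfl
  · exfalso
    -- Two equal origins at distance `k < d` along the boundary would close a trail that is too
    -- short.
    have : d ≤ k := hg.le_of_trail hα hex (fun k => (N^[k] x).1) k hk0
      (fun i hi j hj e => hinj i (by omega) j (by omega) e)
      (fun k _ l _ => hopp k l) (fun k _ => hstep k) hV.symm
    omega

end

/-! ### First return permutations and deletion of the edges inside regions -/

section Ret

variable [Fintype D]

theorem exists_pow_mem (τ : Equiv.Perm D) (R : Finset D) (x : {x // x ∈ R}) :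
    ∃ n, (τ ^ (n + 1)) x.1 ∈ R := by
  classical
  refine ⟨orderOf τ - 1, ?_⟩
  rw [Nat.sub_add_cancel (orderOf_pos τ), pow_orderOf_eq_one]
  exact x.2

open Classical in
/-- The permutation induced on a set by first returns. -/
noncomputable def ret (τ : Equiv.Perm D) (R : Finset D) : Equiv.Perm {x // x ∈ R} :=
  Equiv.ofBijective
    (fun x => ⟨(τ ^ (Nat.find (exists_pow_mem τ R x) + 1)) x.1,
      Nat.find_spec (exists_pow_mem τ R x)⟩) (by
    rw [← Finite.injective_iff_bijective]
    -- If two first returns coincide, cancelling the smaller number of steps puts `x` on the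
    -- excursion from `y` before its return, unless `x = y`.
    have key : ∀ x y : {x // x ∈ R}, ∀ n m, n ≤ m → (∀ k < m, (τ ^ (k + 1)) y.1 ∉ R) →
        (τ ^ (n + 1)) x.1 = (τ ^ (m + 1)) y.1 → x = y := by
      intro x y n m hnm hm e
      obtain ⟨k, rfl⟩ := Nat.exists_eq_add_of_le hnm
      rw [show n + k + 1 = (n + 1) + k by ring, pow_add _ (n + 1) k, Equiv.Perm.mul_apply] at e
      have e := (τ ^ (n + 1)).injective e
      rcases k with _ | k
      · exact Subtype.ext e
      · exact absurd x.2 (e ▸ hm k (by omega))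
    intro x y e
    have e := congrArg Subtype.val e
    rcases le_total (Nat.find (exists_pow_mem τ R x)) (Nat.find (exists_pow_mem τ R y)) with h | h
    · exact key x y _ _ h (fun k hk => Nat.find_min _ hk) e
    · exact (key y x _ _ h (fun k hk => Nat.find_min _ hk) e.symm).symm)

theorem ret_induction (τ : Equiv.Perm D) (R : Finset D) (p : D → Prop) (x : {x // x ∈ R})
    (h0 : p (τ x.1)) (hs : ∀ y ∉ R, p y → p (τ y)) : p (ret τ R x).1 := by
  classical
  change p ((τ ^ (Nat.find (exists_pow_mem τ R x) + 1)) x.1)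
  have : ∀ k ≤ Nat.find (exists_pow_mem τ R x), p ((τ ^ (k + 1)) x.1) := by
    intro k
    induction k with
    | zero => intro _; simpa using h0
    | succ k ih =>
      intro hk
      rw [pow_succ', Equiv.Perm.mul_apply]
      exact hs _ (Nat.find_min (exists_pow_mem τ R x) (by omega)) (ih (by omega))
  exact this _ le_rfl

theorem ret_of_mem (τ : Equiv.Perm D) (R : Finset D) (x : {x // x ∈ R})
    (h0 : τ x.1 ∈ R) : (ret τ R x).1 = τ x.1 := by
  classical
  have h : Nat.find (exists_pow_mem τ R x) = 0 := by
    rw [Nat.find_eq_zero]; simpa using h0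
  change (τ ^ (Nat.find (exists_pow_mem τ R x) + 1)) x.1 = _
  rw [h]; simp

end Ret

end CombMap

/-! ### Deleting the edges inside regions -/

namespace CombMap

open Equiv.Perm

section Delete

variable {D : Type*} [Fintype D] [DecidableEq D]

open Classical in
/-- The darts of the edges which are not inside one of the given regions. -/
noncomputable def keep (α : Equiv.Perm D) (𝒞 : Set (Finset D)) : Finset D :=
  Finset.univ.filter (fun x => ∀ C ∈ 𝒞, x ∈ C → α x ∉ C)

theorem mem_keep {α : Equiv.Perm D} {𝒞 : Set (Finset D)} {x : D} :
    x ∈ keep α 𝒞 ↔ ∀ C ∈ 𝒞, x ∈ C → α x ∉ C := by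
  simp [keep]

/-- The edges inside regions with boundaries of minimal length can be deleted. -/
theorem exists_deletion {α φ : Equiv.Perm D} {d : ℕ} (hα : ∀ x, α (α x) = x)
    (hc : IsConn α φ) (hex : IsExact α φ) (hg : GirthGe α φ d) (𝒞 : Set (Finset D))
    (hreg : ∀ C ∈ 𝒞, IsRegion φ C) (hdisj : ∀ C ∈ 𝒞, ∀ C' ∈ 𝒞, ∀ x, x ∈ C → x ∈ C' → C = C')
    (hd : ∀ C ∈ 𝒞, (bd α C).card = d) :
    ∃ αR φR : Equiv.Perm {x // x ∈ keep α 𝒞}, (∀ x, (αR x).1 = α x.1) ∧ IsConn αR φR ∧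
      IsExact αR φR ∧ (∀ x, (∀ C ∈ 𝒞, x.1 ∉ C) → (φR x).1 = φ x.1) ∧
      (∀ C ∈ 𝒞, ∀ x y, x.1 ∈ C → (y.1 ∈ C ↔ φR.SameCycle x y)) ∧
      ∀ x, SameV α φ (φR x).1 (α x.1) := by
  set R := keep α 𝒞 with hR
  have hRα : ∀ x, x ∈ R → α x ∈ R := by
    intro x hx
    rw [mem_keep] at hx ⊢
    intro C hC h1 h2
    rw [hα] at h2
    exact hx C hC h2 h1
  have hbd : ∀ C ∈ 𝒞, ∀ x, x ∈ bd α C ↔ x ∈ R ∧ x ∈ C := by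
    intro C hC x
    rw [mem_bd, mem_keep]
    constructor
    · rintro ⟨h1, h2⟩
      exact ⟨fun C' hC' h' => hdisj C hC C' hC' x h1 h' ▸ h2, h1⟩
    · rintro ⟨h1, h2⟩
      exact ⟨h2, h1 C hC h2⟩
  let αR : Equiv.Perm {x // x ∈ R} :=
    ⟨fun x => ⟨α x.1, hRα _ x.2⟩, fun x => ⟨α x.1, hRα _ x.2⟩, fun x => Subtype.ext (hα _),
      fun x => Subtype.ext (hα _)⟩
  -- At a dart of a deleted edge, `τ` first passes to the opposite dart, so it turns about the
  -- vertex instead of following the face. Its first return is thus the next kept dart at that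
  -- vertex.
  let sw : D → D := fun x => if x ∈ R then x else α x
  have hsw : Function.Involutive sw := by
    intro x
    by_cases h : x ∈ R
    · simp [sw, h]
    · have : α x ∉ R := fun h' => h (hα x ▸ hRα _ h')
      simp [sw, h, this, hα]
  let τ : Equiv.Perm D := φ * hsw.toPerm sw
  have hτ1 : ∀ x ∈ R, τ x = φ x := fun x hx => by simp [τ, sw, hx]
  have hτ2 : ∀ x ∉ R, τ x = φ (α x) := fun x hx => by simp [τ, sw, hx]
  let φR := ret τ R
  have hoff : ∀ x : {x // x ∈ R}, (∀ C ∈ 𝒞, x.1 ∉ C) → (φR x).1 = φ x.1 := by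
    intro x hx
    rw [← hτ1 x.1 x.2]
    refine ret_of_mem τ R x ?_
    rw [hτ1 x.1 x.2, mem_keep]
    exact fun C hC h => absurd (((hreg C hC).iff _).1 h) (hx C hC)
  have hin : ∀ C ∈ 𝒞, ∀ x : {x // x ∈ R}, x.1 ∈ C → (φR x).1 ∈ C := by
    intro C hC x hx
    refine ret_induction τ R (· ∈ C) x ?_ ?_
    · rw [hτ1 x.1 x.2]; exact hreg C hC _ hx
    · intro y hy h
      rw [hτ2 y hy]
      refine hreg C hC _ ?_
      rw [mem_keep] at hy
      push Not at hy
      obtain ⟨C', hC', h1, h2⟩ := hy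
      rwa [hdisj C hC C' hC' y h h1]
  have hV : ∀ x : {x // x ∈ R}, SameV α φ (φR x).1 (α x.1) := by
    intro x
    refine ret_induction τ R (fun y => SameV α φ y (α x.1)) x ?_ ?_
    · rw [hτ1 x.1 x.2]; exact sameV_next hα _
    · intro y hy h
      rw [hτ2 y hy]
      exact (sameV_rot α φ y).trans h
  -- The kept darts of `C` are its `d` boundary darts. By `boundary_cycle` the new face permutation
  -- is transitive on them, so `C` becomes a single face.
  have hcyc : ∀ C ∈ 𝒞, ∀ x y : {x // x ∈ R}, x.1 ∈ C → y.1 ∈ C → φR.SameCycle x y := by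
    intro C hC x y hx hy
    let N : {x // x ∈ bd α C} → {x // x ∈ bd α C} := fun x =>
      ⟨(φR ⟨x.1, ((hbd C hC x.1).1 x.2).1⟩).1,
        (hbd C hC _).2 ⟨(φR _).2, hin C hC _ ((hbd C hC x.1).1 x.2).2⟩⟩
    have hN : Function.Injective N := by
      intro a b e
      have e := congrArg Subtype.val e
      have e := φR.injective (Subtype.ext e)
      exact Subtype.ext (Subtype.mk.inj e)
    obtain ⟨⟨k, -, e⟩, -, -⟩ := hg.boundary_cycle hα hex (hd C hC) N hN (fun x => hV _)
      ⟨x.1, (hbd C hC _).2 ⟨x.2, hx⟩⟩ ⟨y.1, (hbd C hC _).2 ⟨y.2, hy⟩⟩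
    have : ∀ k, (N^[k] ⟨x.1, (hbd C hC _).2 ⟨x.2, hx⟩⟩).1 = ((φR ^ k) x).1 := by
      intro k
      induction k with
      | zero => rfl
      | succ k ih =>
        rw [Function.iterate_succ_apply', pow_succ', Equiv.Perm.mul_apply]
        change (φR ⟨(N^[k] _).1, _⟩).1 = _
        congr 2
        exact Subtype.ext ih
    refine ⟨k, Subtype.ext ?_⟩
    rw [zpow_natCast, ← this, e]
  refine ⟨αR, φR, fun _ => rfl, ?_, ?_, hoff, ?_, hV⟩
  · intro p h1 h2 x y hx
    have hp : ∀ x y, φR.SameCycle x y → p x → p y := by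
      intro x y h hx
      obtain ⟨n, -, -, rfl⟩ := h.exists_pow_eq φR
      clear h
      induction n with
      | zero => exact hx
      | succ n ih => rw [pow_succ', Equiv.Perm.mul_apply]; exact h2 _ ih
    -- To use connectedness of the original map, `p` is extended to a deleted dart by requiring it
    -- on all kept darts of the region containing its edge.
    let P : D → Prop := fun z => (∃ h : z ∈ R, p ⟨z, h⟩) ∨
      (z ∉ R ∧ ∃ C ∈ 𝒞, z ∈ C ∧ α z ∈ C ∧ ∀ y : {x // x ∈ R}, y.1 ∈ C → p y)
    have key : ∀ C ∈ 𝒞, ∀ z ∈ C, (∀ y : {x // x ∈ R}, y.1 ∈ C → p y) → P z := by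
      intro C hC z hz hall
      by_cases hzR : z ∈ R
      · exact Or.inl ⟨hzR, hall _ hz⟩
      · refine Or.inr ⟨hzR, C, hC, hz, ?_, hall⟩
        rw [mem_keep] at hzR
        push Not at hzR
        obtain ⟨C', hC', h1, h2⟩ := hzR
        rwa [hdisj C hC C' hC' z hz h1]
    have := hc P ?_ ?_ x.1 y.1 (Or.inl ⟨x.2, hx⟩)
    · rcases this with ⟨_, h⟩ | ⟨h, _⟩
      · exact h
      · exact absurd y.2 h
    · rintro z (⟨hz, h⟩ | ⟨hz, C, hC, hzC, hzC', h⟩)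
      · exact Or.inl ⟨hRα _ hz, h1 _ h⟩
      · exact key C hC _ hzC' h
    · rintro z (⟨hz, h⟩ | ⟨hz, C, hC, hzC, hzC', h⟩)
      · by_cases hzC : ∃ C ∈ 𝒞, z ∈ C
        · obtain ⟨C, hC, hzC⟩ := hzC
          exact key C hC _ (hreg C hC _ hzC) (fun y hy => hp _ _ (hcyc C hC ⟨z, hz⟩ y hzC hy) h)
        · push Not at hzC
          have e := hoff ⟨z, hz⟩ hzC
          have h' := h2 _ h
          refine Or.inl ⟨e ▸ (φR ⟨z, hz⟩).2, ?_⟩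
          convert h' using 1
          exact Subtype.ext e.symm
      · exact key C hC _ (hreg C hC _ hzC) h
  · intro w hw1 hw2
    -- Extended by zero, `w` is the boundary of a set of faces of the original map; this set is
    -- constant across the deleted edges, so it descends to the new faces.
    let w' : D → ZMod 2 := fun x => if h : x ∈ R then w ⟨x, h⟩ else 0
    have hsum : ∀ a : D → ZMod 2, ∑ x, a x * w' x = ∑ x : {x // x ∈ R}, a x.1 * w x := by
      intro a
      rw [← Finset.sum_subset (Finset.subset_univ R) (fun x _ hx => by simp [w', hx]),
        ← Finset.sum_coe_sort R]
      refine Finset.sum_congr rfl (fun x _ => ?_)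
      simp [w']
    obtain ⟨h, hφ, hwh⟩ := hex w' (fun x => by
      by_cases hx : x ∈ R
      · have := hw1 ⟨x, hx⟩
        simp only [w', hx, hRα x hx, dif_pos]
        exact this
      · have : α x ∉ R := fun h' => hx (hα x ▸ hRα _ h')
        simp [w', hx, this]) (fun a ha => by
      rw [hsum]
      refine hw2 (fun x => a x.1) (fun x => ?_)
      have := eq_of_sameCycle (π := φ * α) ha (hV (αR x))
      change a (φR (αR x)).1 = a (α (α x.1)) at this
      rw [this, hα])
    refine ⟨fun x => h x.1, fun x => ?_, fun x => ?_⟩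
    · refine ret_induction τ R (fun y => h y = h x.1) x ?_ ?_
      · rw [hτ1 _ x.2, hφ]
      · intro y hy hyx
        rw [hτ2 y hy, hφ]
        have := hwh y
        simp only [w', hy, dif_neg, not_false_iff] at this
        rw [← CharTwo.add_eq_zero.1 this.symm, hyx]
    · have := hwh x.1
      change w x = h x.1 + h (α x.1)
      simpa [w'] using this
  · intro C hC x y hx
    refine ⟨hcyc C hC x y hx, fun h => ?_⟩
    obtain ⟨n, -, -, rfl⟩ := h.exists_pow_eq φR
    clear h
    induction n with
    | zero => exact hx
    | succ n ih => rw [pow_succ', Equiv.Perm.mul_apply]; exact hin C hC _ ih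

end Delete

end CombMap

/-! ### Labelled maps -/

namespace LabelledMap

open CombMap Equiv.Perm

theorem isConn (M : LabelledMap) : IsConn M.α M.φ := isConn_iff.2 M.connected

theorem isExact (M : LabelledMap) : IsExact M.α M.φ := by
  rcases Nat.eq_zero_or_pos M.N with h | h
  · have : IsEmpty (Fin M.N) := by rw [h]; infer_instance
    exact fun w _ _ => ⟨w, fun x => isEmptyElim x, fun x => isEmptyElim x⟩
  · have : Nonempty (Fin M.N) := ⟨⟨0, h⟩⟩
    exact (euler_iff_isExact M.α_involutive M.α_ne M.isConn).1 (M.planar h)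

/-- A rooted planar map from permutations of any finite type. -/
theorem exists_ofType {D : Type*} [Fintype D] (α φ : Equiv.Perm D) (r : D)
    (hα : ∀ x, α (α x) = x) (hne : ∀ x, α x ≠ x) (hc : IsConn α φ) (hex : IsExact α φ) :
    ∃ (L : LabelledMap) (e : D ≃ Fin L.N), (∀ x, e (α x) = L.α (e x)) ∧
      (∀ x, e (φ x) = L.φ (e x)) ∧ ∀ x, L.IsRoot (e x) ↔ x = r := by
  classical
  have hpos : 0 < Fintype.card D := Fintype.card_pos_iff.2 ⟨r⟩
  -- The swap gives `r` the label `0`, which marks the root.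
  let e : D ≃ Fin (Fintype.card D) :=
    (Fintype.equivFin D).trans (Equiv.swap (Fintype.equivFin D r) ⟨0, hpos⟩)
  have her : e r = ⟨0, hpos⟩ := by simp [e]
  let α' := e.permCongr α
  let φ' := e.permCongr φ
  have h1 : ∀ x, e (α x) = α' (e x) := fun x => by simp [α', Equiv.permCongr_apply]
  have h2 : ∀ x, e (φ x) = φ' (e x) := fun x => by simp [φ', Equiv.permCongr_apply]
  have hα' : ∀ x, α' (α' x) = x := fun x => by
    obtain ⟨x, rfl⟩ := e.surjective x
    rw [← h1, ← h1, hα]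
  have hne' : ∀ x, α' x ≠ x := fun x => by
    obtain ⟨x, rfl⟩ := e.surjective x
    rw [← h1]
    exact fun h => hne x (e.injective h)
  have hc' : IsConn α' φ' := by
    intro p hp1 hp2 x y hx
    obtain ⟨x, rfl⟩ := e.surjective x
    obtain ⟨y, rfl⟩ := e.surjective y
    exact hc (fun z => p (e z)) (fun z hz => by rw [h1]; exact hp1 _ hz)
      (fun z hz => by rw [h2]; exact hp2 _ hz) x y hx
  have hex' : IsExact α' φ' := by
    intro w hw1 hw2
    obtain ⟨h, hh1, hh2⟩ := hex (fun x => w (e x)) (fun x => by rw [h1, hw1]) (fun a ha => by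
      rw [← hw2 (fun x => a (e.symm x)) (fun x => ?_), ← Equiv.sum_comp e]
      · simp
      · obtain ⟨x, rfl⟩ := e.surjective x
        rw [← h1, ← h2]
        simpa using ha x)
    refine ⟨fun x => h (e.symm x), fun x => ?_, fun x => ?_⟩
    · obtain ⟨x, rfl⟩ := e.surjective x
      rw [← h2]
      simpa using hh1 x
    · obtain ⟨x, rfl⟩ := e.surjective x
      rw [← h1]
      simpa using hh2 x
  have : Nonempty (Fin (Fintype.card D)) := ⟨⟨0, hpos⟩⟩
  refine ⟨⟨Fintype.card D, α', φ', hα', hne', isConn_iff.1 hc',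
    fun _ => (euler_iff_isExact hα' hne' hc').2 hex'⟩, e, h1, h2, fun x => ?_⟩
  change (e x : ℕ) = 0 ↔ x = r
  rw [← e.injective.eq_iff (a := x) (b := r), her, Fin.ext_iff]

theorem faceOf_eq {M : LabelledMap} {x y : Fin M.N} :
    M.faceOf x = M.faceOf y ↔ M.φ.SameCycle x y := Quotient.eq

theorem origin_eq {M : LabelledMap} {x y : Fin M.N} :
    M.origin x = M.origin y ↔ SameV M.α M.φ x y := Quotient.eq

theorem edgeOf_eq {M : LabelledMap} {x y : Fin M.N} :
    M.edgeOf x = M.edgeOf y ↔ x = y ∨ x = M.α y := by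
  have : M.edgeOf x = M.edgeOf y ↔ M.α.SameCycle x y := Quotient.eq
  rw [this]
  constructor
  · intro h
    obtain ⟨n, -, -, hn⟩ := (SameCycle.symm h).exists_pow_eq M.α
    clear h this
    induction n generalizing x with
    | zero => exact Or.inl hn.symm
    | succ n ih =>
      rw [pow_succ', Equiv.Perm.mul_apply] at hn
      rw [← hn]
      rcases ih rfl with h | h
      · exact Or.inr (congrArg _ h)
      · left
        rw [h, M.α_involutive]
  · rintro (rfl | rfl)
    · exact SameCycle.refl _ _
    · exact SameCycle.symm ⟨1, by simp⟩

end LabelledMap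

/-! ### Girth and irreducibility in terms of regions -/

namespace CombMap

open Equiv.Perm

variable {D : Type*} [Fintype D] [DecidableEq D]

/-- Deleting the edges inside `S` turns `S` into a face, and the face permutation there is a
boundary successor as required by `boundary_cycle`. -/
theorem GirthGe.exists_next {α φ : Equiv.Perm D} {d : ℕ} (hg : GirthGe α φ d)
    (hα : ∀ x, α (α x) = x) (hc : IsConn α φ) (hex : IsExact α φ) {S : Finset D}
    (hS : IsRegion φ S) (hd : (bd α S).card = d) :
    ∃ N : {x // x ∈ bd α S} → {x // x ∈ bd α S}, Function.Injective N ∧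
      ∀ x, SameV α φ (N x).1 (α x.1) := by
  obtain ⟨-, φR, -, -, -, -, hface, hV⟩ := exists_deletion hα hc hex hg {S}
    (by simpa using hS) (by simp) (by simpa using hd)
  have hbd : ∀ x, x ∈ bd α S ↔ x ∈ keep α {S} ∧ x ∈ S := by
    intro x
    rw [mem_bd, mem_keep]
    simp
    tauto
  refine ⟨fun x => ⟨(φR ⟨x.1, ((hbd x.1).1 x.2).1⟩).1, (hbd _).2 ⟨(φR _).2, ?_⟩⟩, ?_, ?_⟩
  · exact (hface S rfl ⟨x.1, ((hbd x.1).1 x.2).1⟩ _ ((hbd x.1).1 x.2).2).2 ⟨1, by simp⟩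
  · intro a b e
    have e := congrArg Subtype.val e
    have e := φR.injective (Subtype.ext e)
    exact Subtype.ext (Subtype.mk.inj e)
  · exact fun x => hV _

/-- Rigidity of minimal boundaries. It makes collapses unique and forces the matching of darts when
a map is decomposed. -/
theorem GirthGe.origin_inj {α φ : Equiv.Perm D} {d : ℕ} (hg : GirthGe α φ d)
    (hα : ∀ x, α (α x) = x) (hc : IsConn α φ) (hex : IsExact α φ) {S : Finset D}
    (hS : IsRegion φ S) (hd : (bd α S).card = d) {x y : D} (hx : x ∈ bd α S) (hy : y ∈ bd α S)
    (h : SameV α φ x y) : x = y := by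
  obtain ⟨N, hN, hNV⟩ := hg.exists_next hα hc hex hS hd
  exact congrArg Subtype.val ((hg.boundary_cycle hα hex hd N hN hNV ⟨x, hx⟩ ⟨y, hy⟩).2.2 h)

end CombMap

namespace LabelledMap

open CombMap Equiv.Perm

variable {M : LabelledMap}

theorem IsCycle.exists_region {n : ℕ} {c : Fin n → Fin M.N} (h : M.IsCycle n c) (r : Fin M.N) :
    ∃ S : Finset (Fin M.N), IsRegion M.φ S ∧ r ∉ S ∧ (bd M.α S).card = n ∧
      ∀ x, ((x ∈ S ↔ M.α x ∉ S) ↔ ∃ i, x = c i ∨ x = M.α (c i)) := by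
  obtain ⟨h0, h1, h2, h3⟩ := h
  obtain ⟨n, rfl⟩ : ∃ m, n = m + 1 := ⟨n - 1, by omega⟩
  have hlt : ∀ k, k % (n + 1) < n + 1 := fun k => Nat.mod_lt _ (Nat.succ_pos n)
  have hcast : ∀ k < n + 1, ∀ l < n + 1,
      (⟨k % (n + 1), hlt k⟩ : Fin (n + 1)) = ⟨l % (n + 1), hlt l⟩ → k = l := by
    intro k hk l hl e
    have := congrArg Fin.val e
    simpa only [Nat.mod_eq_of_lt hk, Nat.mod_eq_of_lt hl] using this
  obtain ⟨S, e1, e2, e3, e4⟩ := exists_region_of_trail M.α_involutive M.isExact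
    (fun k => c ⟨k % (n + 1), hlt k⟩) (n + 1)
    (fun k hk l hl e => hcast k hk l hl (h2 (congrArg M.origin e)))
    (fun k hk l hl e => by
      have : (⟨k % (n + 1), hlt k⟩ : Fin (n + 1)) = ⟨l % (n + 1), hlt l⟩ :=
        h3 (edgeOf_eq.2 (Or.inr e))
      rw [this] at e
      exact M.α_ne _ e.symm)
    (fun k hk => by
      rw [← origin_eq, ← h1, finRotate_apply]
      congr 2
      exact Fin.ext (by simp [Fin.val_add]))
    (by
      simp only [Nat.mod_self, Nat.zero_mod]
      exact SameV.refl _ _ _) r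
  refine ⟨S, e1, e2, e3, fun x => (e4 x).trans ?_⟩
  constructor
  · rintro ⟨k, hk, h⟩
    exact ⟨_, h⟩
  · rintro ⟨i, h⟩
    exact ⟨i, i.2, by simpa [Nat.mod_eq_of_lt i.2] using h⟩

/-- The boundary successor has orbits of full length `d` with distinct origins, so its iterates list
the boundary as a simple cycle. -/
theorem exists_isCycle {d : ℕ} (hg : GirthGe M.α M.φ d) {S : Finset (Fin M.N)}
    (hS : IsRegion M.φ S) (h0 : S.Nonempty) (h1 : S ≠ Finset.univ) (hd : (bd M.α S).card = d) :
    ∃ c, M.IsCycle d c ∧ ∀ x, x ∈ bd M.α S ↔ ∃ i, c i = x := by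
  obtain ⟨x0, hx0⟩ := bd_nonempty M.isConn hS h0 h1
  have hpos : 0 < d := by rw [← hd]; exact Finset.card_pos.2 ⟨x0, hx0⟩
  obtain ⟨N, hN, hNV⟩ := hg.exists_next M.α_involutive M.isConn M.isExact hS hd
  have key := hg.boundary_cycle M.α_involutive M.isExact hd N hN hNV
  have hsurj : ∀ x, x ∈ bd M.α S ↔ ∃ i : Fin d, (N^[i] ⟨x0, hx0⟩).1 = x := by
    intro x
    constructor
    · intro hx
      obtain ⟨k, hk, e⟩ := (key ⟨x0, hx0⟩ ⟨x, hx⟩).1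
      exact ⟨⟨k, hk⟩, congrArg Subtype.val e⟩
    · rintro ⟨i, rfl⟩
      exact (N^[i] _).2
  have hinj : Function.Injective (fun i : Fin d => (⟨(N^[i] ⟨x0, hx0⟩).1, (N^[i] ⟨x0, hx0⟩).2⟩ :
      {x // x ∈ bd M.α S})) := by
    have : Function.Surjective (fun i : Fin d =>
        (⟨(N^[i] ⟨x0, hx0⟩).1, (N^[i] ⟨x0, hx0⟩).2⟩ : {x // x ∈ bd M.α S})) := by
      rintro ⟨x, hx⟩
      obtain ⟨i, hi⟩ := (hsurj x).1 hx
      exact ⟨i, Subtype.ext hi⟩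
    exact ((Fintype.bijective_iff_surjective_and_card _).2 ⟨this, by simp [hd]⟩).1
  refine ⟨fun i => (N^[i] ⟨x0, hx0⟩).1, ⟨hpos, ?_, ?_, ?_⟩, hsurj⟩
  · intro i
    rw [origin_eq]
    obtain ⟨n, rfl⟩ : ∃ m, d = m + 1 := ⟨d - 1, by omega⟩
    have : N^[(finRotate (n + 1) i : Fin (n + 1))] ⟨x0, hx0⟩ = N (N^[i] ⟨x0, hx0⟩) := by
      rw [← Function.iterate_succ_apply' N]
      by_cases hi : i = Fin.last n
      · rw [hi, finRotate_last]
        exact (key ⟨x0, hx0⟩ ⟨x0, hx0⟩).2.1.symm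
      · rw [coe_finRotate_of_ne_last hi]
    beta_reduce
    rw [this]
    exact hNV _
  · intro i j e
    exact hinj ((key _ _).2.2 (origin_eq.1 e))
  · intro i j e
    rcases edgeOf_eq.1 e with e | e
    · exact hinj (Subtype.ext e)
    · exact absurd (e ▸ (mem_bd.1 (N^[i] ⟨x0, hx0⟩).2).1) (mem_bd.1 (N^[j] ⟨x0, hx0⟩).2).2

/-- Replaces cycles by regions. A cycle bounds a region with the same number of boundary darts; a
region with the smallest boundary is surrounded by a cycle of that length. -/
theorem natCast_le_girth {d : ℕ} : (d : ℕ∞) ≤ M.girth ↔ GirthGe M.α M.φ d := by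
  have hgir : (d : ℕ∞) ≤ M.girth ↔ ∀ k c, M.IsCycle k c → d ≤ k := by
    simp [girth, le_iInf_iff]
  rw [hgir]
  constructor
  · intro h S
    induction hn : (bd M.α S).card using Nat.strong_induction_on generalizing S with
    | _ n ih =>
      intro hS h0 h1
      by_contra hlt
      -- The induction hypothesis excludes smaller boundaries, so `n` is a minimum and
      -- `exists_isCycle` applies.
      have hg : GirthGe M.α M.φ n := by
        intro T hT hT0 hT1
        by_contra hlt'
        have := ih _ (by omega) T rfl hT hT0 hT1
        omega
      obtain ⟨c, hc, -⟩ := exists_isCycle hg hS h0 h1 hn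
      exact hlt (h _ _ hc)
  · intro h k c hc
    obtain ⟨S, h1, h2, h3, -⟩ := hc.exists_region (c ⟨0, hc.1⟩)
    rw [← h3]
    refine h S h1 ?_ (fun h => h2 (h ▸ Finset.mem_univ _))
    have := hc.1
    rw [← h3] at this
    exact (Finset.card_pos.1 this).mono (bd_subset _ _)

theorem girth_eq_natCast {d : ℕ} : M.girth = d ↔ GirthGe M.α M.φ d ∧
    ∃ S, IsRegion M.φ S ∧ S.Nonempty ∧ S ≠ Finset.univ ∧ (bd M.α S).card = d := by
  constructor
  · intro h
    have hd : GirthGe M.α M.φ d := natCast_le_girth.1 h.ge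
    refine ⟨hd, ?_⟩
    have : ¬ ((d + 1 : ℕ) : ℕ∞) ≤ M.girth := by
      rw [h, Nat.cast_le]; omega
    rw [natCast_le_girth, GirthGe] at this
    push Not at this
    obtain ⟨S, h1, h2, h3, h4⟩ := this
    exact ⟨S, h1, h2, h3, le_antisymm (by omega) (hd S h1 h2 h3)⟩
  · rintro ⟨hg, S, h1, h2, h3, h4⟩
    refine le_antisymm ?_ (natCast_le_girth.2 hg)
    obtain ⟨c, hc, -⟩ := exists_isCycle hg h1 h2 h3 h4
    exact iInf₂_le (f := fun (k : ℕ) (_ : k ∈ {k : ℕ | ∃ c, M.IsCycle k c}) => (k : ℕ∞)) d ⟨c, hc⟩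

open Classical in
/-- The darts of a face. -/
noncomputable def faceDarts (M : LabelledMap) (f : M.Face) : Finset (Fin M.N) :=
  Finset.univ.filter (fun x => M.faceOf x = f)

theorem mem_faceDarts {f : M.Face} {x : Fin M.N} : x ∈ M.faceDarts f ↔ M.faceOf x = f := by
  simp [faceDarts]

theorem faceOf_φ (x : Fin M.N) : M.faceOf (M.φ x) = M.faceOf x :=
  faceOf_eq.2 (SameCycle.symm ⟨1, by simp⟩)

theorem isRegion_faceDarts (f : M.Face) : IsRegion M.φ (M.faceDarts f) := fun x hx => by
  rw [mem_faceDarts] at hx ⊢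
  rw [faceOf_φ, hx]

theorem card_faceDarts (f : M.Face) : (M.faceDarts f).card = M.degree f := by
  classical
  rw [degree, Nat.card_eq_fintype_card, Fintype.card_subtype]
  congr 1

theorem exists_faceOf (f : M.Face) : ∃ x, M.faceOf x = f := Quotient.exists_rep f

theorem faceDarts_nonempty (f : M.Face) : (M.faceDarts f).Nonempty := by
  obtain ⟨x, hx⟩ := exists_faceOf f
  exact ⟨x, mem_faceDarts.2 hx⟩

theorem isRoot_unique {r r' : Fin M.N} (h : M.IsRoot r) (h' : M.IsRoot r') : r = r' :=
  Fin.ext (h.trans h'.symm)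

theorem exists_isRoot (x : Fin M.N) : ∃ r, M.IsRoot r := ⟨⟨0, x.pos⟩, rfl⟩

theorem isOuter_iff {r : Fin M.N} (h : M.IsRoot r) (f : M.Face) : M.IsOuter f ↔ M.faceOf r = f :=
  ⟨fun ⟨_, h1, h2⟩ => isRoot_unique h h1 ▸ h2, fun h' => ⟨r, h, h'⟩⟩

/-- A region without the outer face. -/
structure IsInnerRegion (M : LabelledMap) (S : Finset (Fin M.N)) : Prop where
  region : IsRegion M.φ S
  nonempty : S.Nonempty
  root : ∀ r, M.IsRoot r → r ∉ S

theorem IsInnerRegion.ne_univ {S : Finset (Fin M.N)} (h : M.IsInnerRegion S) :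
    S ≠ Finset.univ := by
  obtain ⟨x, hx⟩ := h.nonempty
  obtain ⟨r, hr⟩ := exists_isRoot x
  exact fun e => h.root r hr (e ▸ Finset.mem_univ _)

theorem girthGe_of_inner {d : ℕ}
    (h : ∀ S, M.IsInnerRegion S → d ≤ (bd M.α S).card) : GirthGe M.α M.φ d := by
  intro S h1 h2 h3
  obtain ⟨x, hx⟩ := h2
  obtain ⟨r, hr⟩ := exists_isRoot x
  exact girthGe_of_notMem M.α_involutive r (fun S h1 h2 h3 => h S ⟨h1, h2, fun r' hr' =>
    isRoot_unique hr hr' ▸ h3⟩) S h1 ⟨x, hx⟩ h3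

theorem isInnerRegion_faceDarts {f : M.Face} (h : ¬ M.IsOuter f) :
    M.IsInnerRegion (M.faceDarts f) :=
  ⟨isRegion_faceDarts f, faceDarts_nonempty f, fun r hr h' => h ⟨r, hr, mem_faceDarts.1 h'⟩⟩

/-- The face has `d` darts and, being a proper region, at least `d` boundary darts. So no edge has
it on both sides. -/
theorem bd_faceDarts {d : ℕ} (hg : GirthGe M.α M.φ d) (f : M.InnerFace d) :
    bd M.α (M.faceDarts f.1) = M.faceDarts f.1 := by
  have h := isInnerRegion_faceDarts f.2.1
  refine Finset.eq_of_subset_of_card_le (bd_subset _ _) ?_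
  rw [card_faceDarts, f.2.2]
  exact hg _ h.region h.nonempty h.ne_univ

/-- When the girth is at least `d`, an inner region with `d` boundary darts and the cycle around it
determine each other, so the condition on cycles becomes one on regions. -/
theorem isIrreducible_iff {d : ℕ} : M.IsIrreducible d ↔ GirthGe M.α M.φ d ∧
    ∀ S, M.IsInnerRegion S → (bd M.α S).card = d → ∃ f : M.InnerFace d, S = M.faceDarts f.1 := by
  rw [IsIrreducible, natCast_le_girth]
  refine and_congr_right fun hg => ⟨fun h S hS hd => ?_, fun h c hc => ?_⟩
  · obtain ⟨c, hc, hcS⟩ := exists_isCycle hg hS.region hS.nonempty hS.ne_univ hd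
    obtain ⟨f, hf⟩ := h c hc
    refine ⟨f, ?_⟩
    have hT := isInnerRegion_faceDarts f.2.1
    have hbd := bd_faceDarts hg f
    have e1 : ∀ x, (∃ y ∈ bd M.α S, M.edgeOf y = M.edgeOf x) ↔
        ∃ y ∈ bd M.α (M.faceDarts f.1), M.edgeOf y = M.edgeOf x := by
      intro x
      have := Set.ext_iff.1 hf (M.edgeOf x)
      simp only [Set.mem_ofPred_eq] at this
      rw [hbd]
      simp only [mem_faceDarts]
      rw [← this]
      constructor
      · rintro ⟨y, hy, e⟩
        obtain ⟨i, rfl⟩ := (hcS y).1 hy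
        exact ⟨i, e⟩
      · rintro ⟨i, e⟩
        exact ⟨_, (hcS _).2 ⟨i, rfl⟩, e⟩
    have e2 : ∀ (S : Finset (Fin M.N)) x, (∃ y ∈ bd M.α S, M.edgeOf y = M.edgeOf x) ↔
        (x ∈ S ↔ M.α x ∉ S) := by
      intro S x
      simp only [edgeOf_eq, mem_bd]
      constructor
      · rintro ⟨y, hy, rfl | rfl⟩
        · tauto
        · rw [M.α_involutive] at hy; tauto
      · intro h
        by_cases hx : x ∈ S
        · exact ⟨x, ⟨hx, h.1 hx⟩, Or.inl rfl⟩
        · exact ⟨M.α x, ⟨by tauto, by rwa [M.α_involutive]⟩, Or.inr rfl⟩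
    simp only [e2] at e1
    obtain ⟨x0, hx0⟩ := hS.nonempty
    obtain ⟨r, hr⟩ := exists_isRoot x0
    -- Two regions with the same boundary edges are equal or complementary; as both miss the root,
    -- they are equal.
    have := M.isConn.eq (h := fun x => (x ∈ S ↔ x ∈ M.faceDarts f.1))
      (fun x => by have := e1 x; rw [eq_iff_iff]; tauto)
      (fun x => by rw [hS.region.iff, hT.region.iff]) r
    ext x
    rw [← this x]
    have := hS.root r hr
    have := hT.root r hr
    tauto
  · obtain ⟨r, hr⟩ := exists_isRoot (c ⟨0, hc.1⟩)
    obtain ⟨S, h1, h2, h3, h4⟩ := hc.exists_region r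
    have hS : M.IsInnerRegion S := ⟨h1, (Finset.card_pos.1 (h3 ▸ hc.1)).mono (bd_subset _ _),
      fun r' hr' => isRoot_unique hr hr' ▸ h2⟩
    obtain ⟨f, rfl⟩ := h S hS h3
    refine ⟨f, ?_⟩
    have hbd := bd_faceDarts hg f
    ext a
    simp only [Set.mem_ofPred_eq]
    constructor
    · rintro ⟨i, rfl⟩
      have := (h4 (c i)).2 ⟨i, Or.inl rfl⟩
      by_cases hx : c i ∈ M.faceDarts f.1
      · exact ⟨c i, mem_faceDarts.1 hx, rfl⟩
      · exact ⟨M.α (c i), mem_faceDarts.1 (by tauto), edgeOf_eq.2 (Or.inr rfl)⟩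
    · rintro ⟨x, hx, rfl⟩
      have hx := mem_faceDarts.2 hx
      rw [← hbd, mem_bd] at hx
      obtain ⟨i, hi⟩ := (h4 x).1 (by tauto)
      exact ⟨i, (edgeOf_eq.2 hi).symm⟩

end LabelledMap

/-! ### Collapsing regions -/

namespace LabelledMap

open CombMap Equiv.Perm

/-- Through `ι`, the map `L` is obtained from `M` by deleting the edges inside the regions of `𝒞`,
so that each of these regions becomes a face. -/
structure IsCollapse (L M : LabelledMap) (𝒞 : Set (Finset (Fin M.N))) (ι : Fin L.N → Fin M.N) :
    Prop where
  region : ∀ C ∈ 𝒞, IsRegion M.φ C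
  disj : ∀ C ∈ 𝒞, ∀ C' ∈ 𝒞, ∀ x, x ∈ C → x ∈ C' → C = C'
  injective : Function.Injective ι
  mem_range : ∀ y, (∃ x, ι x = y) ↔ ∀ C ∈ 𝒞, y ∈ C → M.α y ∉ C
  map_α : ∀ x, ι (L.α x) = M.α (ι x)
  map_φ : ∀ x, (∀ C ∈ 𝒞, ι x ∉ C) → ι (L.φ x) = M.φ (ι x)
  face : ∀ C ∈ 𝒞, ∀ x y, ι x ∈ C → (ι y ∈ C ↔ L.φ.SameCycle x y)
  -- Successors in `L` start where they should in `M`. On a collapsed region this determines `L.φ`,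
  -- as soon as distinct boundary darts have distinct origins.
  vertex : ∀ x, SameV M.α M.φ (ι (L.φ x)) (M.α (ι x))

theorem exists_isCollapse {M : LabelledMap} {d : ℕ} (hg : GirthGe M.α M.φ d)
    (𝒞 : Set (Finset (Fin M.N))) (hreg : ∀ C ∈ 𝒞, IsRegion M.φ C)
    (hdisj : ∀ C ∈ 𝒞, ∀ C' ∈ 𝒞, ∀ x, x ∈ C → x ∈ C' → C = C')
    (hd : ∀ C ∈ 𝒞, (bd M.α C).card = d) (r : Fin M.N) (hr : ∀ C ∈ 𝒞, r ∈ C → M.α r ∉ C) :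
    ∃ (L : LabelledMap) (ι : Fin L.N → Fin M.N), L.IsCollapse M 𝒞 ι ∧
      ∀ x, L.IsRoot x ↔ ι x = r := by
  obtain ⟨αR, φR, h1, h2, h3, h4, h5, h6⟩ :=
    exists_deletion M.α_involutive M.isConn M.isExact hg 𝒞 hreg hdisj hd
  have hα : ∀ x, αR (αR x) = x := fun x => Subtype.ext (by rw [h1, h1, M.α_involutive])
  have hne : ∀ x, αR x ≠ x := fun x h => M.α_ne x.1 (by rw [← h1, h])
  obtain ⟨L, e, e1, e2, e3⟩ := exists_ofType αR φR ⟨r, mem_keep.2 hr⟩ hα hne h2 h3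
  have e1' : ∀ y, e.symm (L.α y) = αR (e.symm y) := fun y => by
    rw [Equiv.symm_apply_eq, e1, Equiv.apply_symm_apply]
  have e2' : ∀ y, e.symm (L.φ y) = φR (e.symm y) := fun y => by
    rw [Equiv.symm_apply_eq, e2, Equiv.apply_symm_apply]
  refine ⟨L, fun x => (e.symm x).1, ⟨hreg, hdisj, ?_, ?_, ?_, ?_, ?_, ?_⟩, ?_⟩
  · exact Subtype.val_injective.comp e.symm.injective
  · intro y
    rw [← mem_keep]
    constructor
    · rintro ⟨x, rfl⟩
      exact (e.symm x).2
    · exact fun h => ⟨e ⟨y, h⟩, by simp⟩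
  · intro x
    rw [e1', h1]
  · intro x hx
    rw [e2', h4 _ hx]
  · intro C hC x y hx
    rw [h5 C hC _ (e.symm y) hx]
    have : ∀ n : ℤ, ∀ x, e.symm ((L.φ ^ n) x) = (φR ^ n) (e.symm x) := by
      have : L.φ = e.permCongr φR := by
        ext1 x
        rw [Equiv.permCongr_apply, ← e2', Equiv.apply_symm_apply]
      intro n x
      rw [this]
      have h := map_zpow (e.permCongrHom) φR n
      rw [Equiv.symm_apply_eq]
      change ((e.permCongrHom φR) ^ n) x = _
      rw [← h]
      simp [Equiv.permCongrHom]
    constructor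
    · rintro ⟨n, hn⟩
      exact ⟨n, e.symm.injective (by rw [this, hn])⟩
    · rintro ⟨n, hn⟩
      exact ⟨n, by rw [← this, hn]⟩
  · intro x
    rw [e2']
    exact h6 _
  · intro x
    obtain ⟨x, rfl⟩ := e.surjective x
    rw [e3]
    simp [Subtype.ext_iff]

theorem mem_of_sameCycle {L : LabelledMap} {U : Finset (Fin L.N)} (hU : IsRegion L.φ U) {x y : Fin L.N}
    (hxy : L.φ.SameCycle x y) (hx : x ∈ U) : y ∈ U := by
  have := eq_of_sameCycle (h := (· ∈ U)) (fun x => by rw [hU.iff]) hxy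
  exact this ▸ hx

theorem minimalPeriod_eq_of_semiconj {A B : Type*} {f : A → A} {g : B → B} {i : A → B}
    (p : A → Prop) (hp : ∀ x, p x → p (f x)) (hinj : ∀ x y, p x → p y → i x = i y → x = y)
    (h : ∀ x, p x → i (f x) = g (i x)) {x : A} (hx : p x) :
    Function.minimalPeriod g (i x) = Function.minimalPeriod f x := by
  have key : ∀ n, p (f^[n] x) ∧ i (f^[n] x) = g^[n] (i x) := by
    intro n
    induction n with
    | zero => exact ⟨hx, rfl⟩
    | succ n ih =>
      rw [Function.iterate_succ_apply', Function.iterate_succ_apply', ← ih.2]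
      exact ⟨hp _ ih.1, h _ ih.1⟩
  refine Function.minimalPeriod_eq_minimalPeriod_iff.2 (fun n => ?_)
  rw [Function.IsPeriodicPt, Function.IsFixedPt, Function.IsPeriodicPt, Function.IsFixedPt,
    ← (key n).2]
  exact ⟨fun h => hinj _ _ (key n).1 hx h, congrArg i⟩

variable {L M : LabelledMap} {𝒞 : Set (Finset (Fin M.N))} {ι : Fin L.N → Fin M.N}

theorem sameCycle_iff_iterate {x y : Fin M.N} :
    M.φ.SameCycle x y ↔ ∃ k < Function.minimalPeriod M.φ x, M.φ^[k] x = y := by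
  have hp : 0 < Function.minimalPeriod M.φ x :=
    Function.minimalPeriod_pos_of_mem_periodicPts (M.φ.injective.mem_periodicPts x)
  constructor
  · intro h
    obtain ⟨n, -, -, rfl⟩ := h.exists_pow_eq M.φ
    refine ⟨n % Function.minimalPeriod M.φ x, Nat.mod_lt _ hp, ?_⟩
    rw [Function.iterate_mod_minimalPeriod_eq, Equiv.Perm.iterate_eq_pow]
  · rintro ⟨k, -, rfl⟩
    exact ⟨k, by rw [zpow_natCast, Equiv.Perm.iterate_eq_pow]⟩

theorem degree_faceOf (x : Fin M.N) : M.degree (M.faceOf x) = Function.minimalPeriod M.φ x := by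
  classical
  rw [← card_faceDarts, ← Finset.card_range (Function.minimalPeriod M.φ x)]
  symm
  refine Finset.card_bij (fun k _ => M.φ^[k] x) ?_ ?_ ?_
  · intro k hk
    rw [mem_faceDarts, eq_comm, faceOf_eq, sameCycle_iff_iterate]
    exact ⟨k, by simpa using hk, rfl⟩
  · intro k hk l hl e
    exact Function.iterate_injOn_Iio_minimalPeriod (by simpa using hk) (by simpa using hl) e
  · intro y hy
    rw [mem_faceDarts, eq_comm, faceOf_eq, sameCycle_iff_iterate] at hy
    obtain ⟨k, hk, e⟩ := hy
    exact ⟨k, by simpa using hk, e⟩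

theorem outerDegree_eq {r : Fin M.N} (hr : M.IsRoot r) :
    M.outerDegree = Function.minimalPeriod M.φ r := by
  rw [← degree_faceOf, outerDegree, degree]
  refine Nat.card_congr (Equiv.subtypeEquivRight fun x => ?_)
  rw [isOuter_iff hr, eq_comm]

theorem outerDegree_eq_zero (h : M.N = 0) : M.outerDegree = 0 := by
  have : IsEmpty (Fin M.N) := by rw [h]; infer_instance
  rw [outerDegree, Nat.card_of_isEmpty]

theorem exists_root_of_outerDegree_pos (h : 0 < M.outerDegree) : ∃ r, M.IsRoot r := by
  rw [outerDegree] at h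
  have : Nonempty {x // M.IsOuter (M.faceOf x)} := by
    by_contra h'
    rw [not_nonempty_iff] at h'
    rw [Nat.card_of_isEmpty] at h
    exact lt_irrefl _ h
  obtain ⟨x⟩ := this
  exact exists_isRoot x.1

namespace IsCollapse

variable (h : L.IsCollapse M 𝒞 ι)
include h

theorem comp_iso {L' : LabelledMap} (e : Fin L'.N ≃ Fin L.N) (e1 : ∀ x, e (L'.α x) = L.α (e x))
    (e2 : ∀ x, e (L'.φ x) = L.φ (e x)) : L'.IsCollapse M 𝒞 (ι ∘ e) := by
  refine ⟨h.region, h.disj, h.injective.comp e.injective, fun y => ?_, fun x => ?_,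
    fun x hx => ?_, fun C hC x y hx => ?_, fun x => ?_⟩
  · rw [← h.mem_range]
    exact ⟨fun ⟨x, hx⟩ => ⟨e x, hx⟩, fun ⟨x, hx⟩ => ⟨e.symm x, by simpa using hx⟩⟩
  · simp only [Function.comp_apply, e1, h.map_α]
  · simp only [Function.comp_apply, e2]
    exact h.map_φ _ hx
  · rw [Function.comp_apply, h.face C hC _ _ hx]
    have key : ∀ (n : ℕ) x, e ((L'.φ ^ n) x) = (L.φ ^ n) (e x) := by
      intro n x
      induction n with
      | zero => rfl
      | succ n ih => rw [pow_succ', pow_succ', Equiv.Perm.mul_apply, Equiv.Perm.mul_apply, e2, ih]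
    constructor
    · intro hxy
      obtain ⟨n, -, -, hn⟩ := hxy.exists_pow_eq L.φ
      exact ⟨n, e.injective (by rw [zpow_natCast, key, hn])⟩
    · intro hxy
      obtain ⟨n, -, -, hn⟩ := hxy.exists_pow_eq L'.φ
      exact ⟨n, by rw [zpow_natCast, ← key, hn]⟩
  · simp only [Function.comp_apply, e2]
    exact h.vertex _

theorem notMem {C : Finset (Fin M.N)} (hC : C ∈ 𝒞) {x : Fin L.N} (hx : ι x ∈ C) :
    M.α (ι x) ∉ C := (h.mem_range _).1 ⟨x, rfl⟩ C hC hx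

theorem φ_mem {C : Finset (Fin M.N)} (hC : C ∈ 𝒞) {x : Fin L.N} (hx : ι x ∈ C) :
    ι (L.φ x) ∈ C := (h.face C hC _ _ hx).2 ⟨1, by simp⟩

theorem φ_mem_iff {C : Finset (Fin M.N)} (hC : C ∈ 𝒞) {x : Fin L.N} :
    ι (L.φ x) ∈ C ↔ ι x ∈ C :=
  ⟨fun hx => (h.face C hC _ _ hx).2 (SameCycle.symm ⟨1, by simp⟩), h.φ_mem hC⟩

theorem exists_of_mem_bd {C : Finset (Fin M.N)} (hC : C ∈ 𝒞) {y : Fin M.N} (hy : y ∈ bd M.α C) :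
    ∃ x, ι x = y := by
  rw [h.mem_range]
  intro C' hC' hy'
  rw [mem_bd] at hy
  exact h.disj C hC C' hC' y hy.1 hy' ▸ hy.2

open Classical in
/-- Collapses of the same regions are isomorphic. -/
theorem exists_equiv {L' : LabelledMap} {ι' : Fin L'.N → Fin M.N} (h' : L'.IsCollapse M 𝒞 ι')
    (hV : ∀ C ∈ 𝒞, ∀ x y, x ∈ bd M.α C → y ∈ bd M.α C → SameV M.α M.φ x y → x = y) :
    ∃ e : Fin L.N ≃ Fin L'.N, (∀ x, e (L.α x) = L'.α (e x)) ∧ (∀ x, e (L.φ x) = L'.φ (e x)) ∧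
      ∀ x, ι' (e x) = ι x := by
  have hex : ∀ x, ∃ y, ι' y = ι x := fun x => (h'.mem_range _).2 ((h.mem_range _).1 ⟨x, rfl⟩)
  have hex' : ∀ y, ∃ x, ι x = ι' y := fun x => (h.mem_range _).2 ((h'.mem_range _).1 ⟨x, rfl⟩)
  choose f hf using hex
  choose g hg using hex'
  refine ⟨⟨f, g, fun x => h.injective (by rw [hg, hf]), fun x => h'.injective (by rw [hf, hg])⟩,
    fun x => h'.injective ?_, fun x => h'.injective ?_, hf⟩
  · change ι' (f _) = ι' (L'.α (f x))
    rw [hf, h.map_α, h'.map_α, hf]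
  · change ι' (f _) = ι' (L'.φ (f x))
    rw [hf]
    by_cases hx : ∀ C ∈ 𝒞, ι x ∉ C
    · rw [h.map_φ _ hx, h'.map_φ _ (by rwa [hf]), hf]
    · push Not at hx
      obtain ⟨C, hC, hx⟩ := hx
      have m1 := h.φ_mem hC hx
      have m2 := h'.φ_mem hC (x := f x) (by rwa [hf])
      -- Both candidates for the successor lie on the boundary of `C`, and by `vertex` they have the
      -- same origin.
      refine hV C hC _ _ (mem_bd.2 ⟨m1, h.notMem hC m1⟩) (mem_bd.2 ⟨m2, h'.notMem hC m2⟩) ?_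
      refine (h.vertex x).trans ?_
      have := h'.vertex (f x)
      rw [hf] at this
      exact this.symm

open Classical in
/-- The region of `M` covered by a region of a collapse. -/
noncomputable def lift (_ : L.IsCollapse M 𝒞 ι) (U : Finset (Fin L.N)) : Finset (Fin M.N) :=
  Finset.univ.filter (fun y => (∃ x ∈ U, ι x = y) ∨ ∃ C ∈ 𝒞, y ∈ C ∧ ∃ x ∈ U, ι x ∈ C)

theorem mem_lift {U : Finset (Fin L.N)} {y : Fin M.N} :
    y ∈ h.lift U ↔ (∃ x ∈ U, ι x = y) ∨ ∃ C ∈ 𝒞, y ∈ C ∧ ∃ x ∈ U, ι x ∈ C := by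
  simp [lift]

theorem apply_mem_lift {U : Finset (Fin L.N)} (hU : IsRegion L.φ U) {x : Fin L.N} :
    ι x ∈ h.lift U ↔ x ∈ U := by
  rw [mem_lift]
  constructor
  · rintro (⟨z, hz, e⟩ | ⟨C, hC, hx, z, hz, hzC⟩)
    · exact h.injective e ▸ hz
    · exact mem_of_sameCycle hU ((h.face C hC _ _ hzC).1 hx) hz
  · exact fun hx => Or.inl ⟨x, hx, rfl⟩

theorem isRegion_lift {U : Finset (Fin L.N)} (hU : IsRegion L.φ U) :
    IsRegion M.φ (h.lift U) := by
  intro y hy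
  by_cases hyC : ∃ C ∈ 𝒞, y ∈ C
  · obtain ⟨C, hC, hyC⟩ := hyC
    rw [mem_lift] at hy ⊢
    right
    rcases hy with ⟨x, hx, rfl⟩ | ⟨C', hC', hy', hx⟩
    · exact ⟨C, hC, h.region C hC _ hyC, x, hx, hyC⟩
    · exact ⟨C', hC', h.region C' hC' _ hy', hx⟩
  · rw [mem_lift] at hy
    push Not at hyC
    rcases hy with ⟨x, hx, rfl⟩ | ⟨C', hC', hy', hx⟩
    · rw [← h.map_φ x hyC, h.apply_mem_lift hU]
      exact hU _ hx
    · exact absurd hy' (hyC C' hC')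

/-- A deleted edge has both darts in one collapsed region, which a lift contains or avoids entirely;
only kept edges can bound a lift. -/
theorem bd_lift {U : Finset (Fin L.N)} (hU : IsRegion L.φ U) :
    bd M.α (h.lift U) = (bd L.α U).map ⟨ι, h.injective⟩ := by
  ext y
  rw [Finset.mem_map]
  constructor
  · intro hy
    rw [mem_bd] at hy
    obtain ⟨x, rfl⟩ : ∃ x, ι x = y := by
      rw [h.mem_range]
      intro C hC h1 h2
      rw [mem_lift] at hy
      rcases hy.1 with ⟨x, hx, rfl⟩ | ⟨C', hC', hy', hx⟩
      · exact h.notMem hC h1 h2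
      · obtain rfl := h.disj C hC C' hC' _ h1 hy'
        exact hy.2 (h.mem_lift.2 (Or.inr ⟨C, hC, h2, hx⟩))
    refine ⟨x, ?_, rfl⟩
    rwa [← h.map_α, h.apply_mem_lift hU, h.apply_mem_lift hU, ← mem_bd] at hy
  · rintro ⟨x, hx, rfl⟩
    change ι x ∈ _
    rwa [mem_bd, ← h.map_α, h.apply_mem_lift hU, h.apply_mem_lift hU, ← mem_bd]

theorem card_bd_lift {U : Finset (Fin L.N)} (hU : IsRegion L.φ U) :
    (bd M.α (h.lift U)).card = (bd L.α U).card := by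
  rw [h.bd_lift hU, Finset.card_map]

theorem lift_nonempty {U : Finset (Fin L.N)} (hU : IsRegion L.φ U) (h0 : U.Nonempty) :
    (h.lift U).Nonempty := by
  obtain ⟨x, hx⟩ := h0
  exact ⟨ι x, (h.apply_mem_lift hU).2 hx⟩

theorem girthGe {d : ℕ} (hg : GirthGe M.α M.φ d) : GirthGe L.α L.φ d := by
  intro U hU h0 h1
  rw [← h.card_bd_lift hU]
  refine hg _ (h.isRegion_lift hU) (h.lift_nonempty hU h0) (fun e => h1 ?_)
  rw [Finset.eq_univ_iff_forall] at e ⊢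
  exact fun x => (h.apply_mem_lift hU).1 (e _)

theorem minimalPeriod_eq {x : Fin L.N} (hx : ∀ C ∈ 𝒞, ι x ∉ C) :
    Function.minimalPeriod M.φ (ι x) = Function.minimalPeriod L.φ x :=
  minimalPeriod_eq_of_semiconj (fun x => ∀ C ∈ 𝒞, ι x ∉ C)
    (fun _ hx C hC h' => hx C hC ((h.φ_mem_iff hC).1 h'))
    (fun _ _ _ _ e => h.injective e) (fun x hx => h.map_φ x hx) hx

theorem faceDarts_map {C : Finset (Fin M.N)} (hC : C ∈ 𝒞) {x : Fin L.N} (hx : ι x ∈ C) :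
    (L.faceDarts (L.faceOf x)).map ⟨ι, h.injective⟩ = bd M.α C := by
  ext y
  rw [Finset.mem_map]
  constructor
  · rintro ⟨z, hz, rfl⟩
    rw [mem_faceDarts, eq_comm, faceOf_eq, ← h.face C hC _ _ hx] at hz
    exact mem_bd.2 ⟨hz, h.notMem hC hz⟩
  · intro hy
    obtain ⟨z, rfl⟩ := h.exists_of_mem_bd hC hy
    refine ⟨z, ?_, rfl⟩
    rw [mem_faceDarts, eq_comm, faceOf_eq, ← h.face C hC _ _ hx]
    exact (mem_bd.1 hy).1

theorem degree_eq {C : Finset (Fin M.N)} (hC : C ∈ 𝒞) {x : Fin L.N} (hx : ι x ∈ C) :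
    L.degree (L.faceOf x) = (bd M.α C).card := by
  rw [← card_faceDarts, ← h.faceDarts_map hC hx, Finset.card_map]

end IsCollapse

/-! ### Cells -/

/-- An inner region bounded by a cycle of length `d`, when the girth is at least `d`. -/
def IsCell (M : LabelledMap) (d : ℕ) (S : Finset (Fin M.N)) : Prop :=
  M.IsInnerRegion S ∧ (bd M.α S).card = d

/-- The maximal cells. -/
def maxCells (M : LabelledMap) (d : ℕ) : Set (Finset (Fin M.N)) :=
  {S | M.IsCell d S ∧ ∀ T, M.IsCell d T → S ⊆ T → S = T}

theorem IsCell.exists_le {d : ℕ} {S : Finset (Fin M.N)} (h : M.IsCell d S) :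
    ∃ T ∈ M.maxCells d, S ⊆ T := by
  obtain ⟨T, hT, hm⟩ := Set.Finite.exists_le_maximal (Set.toFinite {S | M.IsCell d S}) h
  exact ⟨T, ⟨hm.1, fun U hU hTU => le_antisymm hTU (hm.2 hU hTU)⟩, hT⟩

/-- Uncrossing: the intersection is a proper nonempty region, so it uses at least `d` of the
boundary darts in the submodular inequality. -/
theorem IsInnerRegion.card_bd_union_le {d : ℕ} (hg : GirthGe M.α M.φ d) {S T : Finset (Fin M.N)}
    (hS : M.IsInnerRegion S) (hT : M.IsInnerRegion T) (hTd : (bd M.α T).card = d)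
    (h : (S ∩ T).Nonempty) :
    M.IsInnerRegion (S ∪ T) ∧ (bd M.α (S ∪ T)).card ≤ (bd M.α S).card := by
  have h1 := card_bd_union_add_inter M.α S T
  have h2 : M.IsInnerRegion (S ∩ T) := ⟨hS.region.inter hT.region, h,
    fun r hr hrS => hS.root r hr (Finset.mem_inter.1 hrS).1⟩
  have h3 := hg _ h2.region h2.nonempty h2.ne_univ
  refine ⟨⟨hS.region.union hT.region, hS.nonempty.mono Finset.subset_union_left,
    fun r hr hrS => ?_⟩, by omega⟩
  rcases Finset.mem_union.1 hrS with h | h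
  · exact hS.root r hr h
  · exact hT.root r hr h

/-- By uncrossing, the union of two overlapping maximal cells is a cell containing both, so it
equals each of them. -/
theorem maxCells_disj {d : ℕ} (hg : GirthGe M.α M.φ d) :
    ∀ C ∈ M.maxCells d, ∀ C' ∈ M.maxCells d, ∀ x, x ∈ C → x ∈ C' → C = C' := by
  intro C hC C' hC' x hx hx'
  obtain ⟨h1, h2⟩ := hC.1.1.card_bd_union_le hg hC'.1.1 hC'.1.2 ⟨x, Finset.mem_inter.2 ⟨hx, hx'⟩⟩
  have h3 : M.IsCell d (C ∪ C') := ⟨h1, le_antisymm (hC.1.2 ▸ h2)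
    (hg _ h1.region h1.nonempty h1.ne_univ)⟩
  rw [hC.2 _ h3 Finset.subset_union_left]
  exact (hC'.2 _ h3 Finset.subset_union_right).symm

theorem exists_isCollapse_maxCells {d : ℕ} (hg : GirthGe M.α M.φ d) :
    ∃ (L : LabelledMap) (ι : Fin L.N → Fin M.N), L.IsCollapse M (M.maxCells d) ι ∧
      ∀ x, L.IsRoot x ↔ M.IsRoot (ι x) := by
  rcases Nat.eq_zero_or_pos M.N with h0 | h0
  · have : IsEmpty (Fin M.N) := by rw [h0]; infer_instance
    refine ⟨M, id, ⟨?_, ?_, Function.injective_id, ?_, ?_, ?_, ?_, ?_⟩, ?_⟩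
    · exact fun C hC => hC.1.1.region
    · exact maxCells_disj hg
    all_goals intros; exact isEmptyElim (α := Fin M.N) (by assumption)
  · obtain ⟨L, ι, h1, h2⟩ := exists_isCollapse hg (M.maxCells d) (fun C hC => hC.1.1.region)
      (maxCells_disj hg) (fun C hC => hC.1.2) ⟨0, h0⟩
      (fun C hC h => absurd h (hC.1.1.root _ rfl))
    exact ⟨L, ι, h1, fun x => by rw [h2, Fin.ext_iff]; rfl⟩

end LabelledMap

/-! ### The structure of a gluing -/

namespace LabelledMap

open CombMap Equiv.Perm

/-- The maps which can be glued inside a face of degree `d`. -/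
structure IsFilling (m : LabelledMap) (d : ℕ) : Prop where
  pos : 0 < d
  outerDegree : m.outerDegree = d
  girth : m.girth = d

section Iterate

variable {M : LabelledMap}

theorem pow_eq_pow_iff {d : ℕ} {x : Fin M.N} (h : Function.minimalPeriod M.φ x = d) {i j : ℕ} :
    (M.φ ^ i) x = (M.φ ^ j) x ↔ i ≡ j [MOD d] := by
  subst h
  rw [← Equiv.Perm.iterate_eq_pow, ← Equiv.Perm.iterate_eq_pow,
    ← Function.iterate_mod_minimalPeriod_eq (n := i), ← Function.iterate_mod_minimalPeriod_eq (n := j)]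
  have hp : 0 < Function.minimalPeriod M.φ x :=
    Function.minimalPeriod_pos_of_mem_periodicPts (M.φ.injective.mem_periodicPts x)
  exact ⟨fun h => Function.iterate_injOn_Iio_minimalPeriod (Nat.mod_lt _ hp) (Nat.mod_lt _ hp) h,
    fun h => congrArg (fun n => M.φ^[n] x) h⟩

theorem inv_pow_eq_inv_pow_iff {d : ℕ} {x : Fin M.N} (h : Function.minimalPeriod M.φ x = d)
    {i j : ℕ} : (M.φ⁻¹ ^ i) x = (M.φ⁻¹ ^ j) x ↔ i ≡ j [MOD d] := by
  rw [← (M.φ ^ (i + j)).injective.eq_iff, ← Equiv.Perm.mul_apply, ← Equiv.Perm.mul_apply, inv_pow,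
    inv_pow]
  nth_rewrite 2 [pow_add]
  rw [add_comm i j, pow_add, mul_assoc, mul_assoc, mul_inv_cancel, mul_inv_cancel, mul_one, mul_one,
    pow_eq_pow_iff h]
  exact ⟨fun h => h.symm, fun h => h.symm⟩

end Iterate

theorem not_exists_innerFace_root {M : LabelledMap} {d : ℕ} {r : Fin M.N} (hr : M.IsRoot r) :
    ¬ ∃ f : M.InnerFace d, f.1 = M.faceOf r := by
  rintro ⟨f, hf⟩
  exact f.2.1 ⟨r, hr, hf.symm⟩

/-! ### Simplicity of the outer boundary of a filling -/

namespace IsFilling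

variable {m : LabelledMap} {d : ℕ} (h : m.IsFilling d)
include h

theorem girthGe : GirthGe m.α m.φ d := (girth_eq_natCast.1 h.girth).1

theorem exists_root : ∃ r, m.IsRoot r :=
  exists_root_of_outerDegree_pos (h.outerDegree ▸ h.pos)

theorem minimalPeriod {r : Fin m.N} (hr : m.IsRoot r) : Function.minimalPeriod m.φ r = d := by
  rw [← outerDegree_eq hr, h.outerDegree]

theorem outer_iff {r : Fin m.N} (hr : m.IsRoot r) {z : Fin m.N} :
    m.IsOuter (m.faceOf z) ↔ ∃ i : ℕ, (m.φ ^ i) r = z := by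
  rw [isOuter_iff hr, faceOf_eq, sameCycle_iff_iterate]
  constructor
  · rintro ⟨k, -, hk⟩
    exact ⟨k, by rw [← Equiv.Perm.iterate_eq_pow, hk]⟩
  · rintro ⟨i, rfl⟩
    refine ⟨i % Function.minimalPeriod m.φ r, Nat.mod_lt _ ?_, ?_⟩
    · rw [h.minimalPeriod hr]; exact h.pos
    · rw [Function.iterate_mod_minimalPeriod_eq, Equiv.Perm.iterate_eq_pow]

/-- Finite girth provides a proper nonempty region, hence a face other than the outer one: a filling
is not a tree. -/
theorem outer_ne_univ {r : Fin m.N} : m.faceDarts (m.faceOf r) ≠ Finset.univ := by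
  obtain ⟨-, S, h1, ⟨x, hx⟩, h3, -⟩ := girth_eq_natCast.1 h.girth
  intro e
  refine h3 (Finset.eq_univ_iff_forall.2 fun y => mem_of_sameCycle h1 (x := x) ?_ hx)
  rw [Finset.eq_univ_iff_forall] at e
  rw [← faceOf_eq, mem_faceDarts.1 (e x), mem_faceDarts.1 (e y)]

theorem card_outer {r : Fin m.N} (hr : m.IsRoot r) : (m.faceDarts (m.faceOf r)).card = d := by
  rw [card_faceDarts, degree_faceOf, h.minimalPeriod hr]

theorem bd_outer {r : Fin m.N} (hr : m.IsRoot r) :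
    bd m.α (m.faceDarts (m.faceOf r)) = m.faceDarts (m.faceOf r) := by
  refine Finset.eq_of_subset_of_card_le (bd_subset _ _) ?_
  rw [h.card_outer hr]
  exact h.girthGe _ (isRegion_faceDarts _) (faceDarts_nonempty _) h.outer_ne_univ

theorem not_outer_α {z : Fin m.N} (hz : m.IsOuter (m.faceOf z)) :
    ¬ m.IsOuter (m.faceOf (m.α z)) := by
  obtain ⟨r, hr⟩ := h.exists_root
  rw [isOuter_iff hr, eq_comm, ← mem_faceDarts] at hz ⊢
  rw [← h.bd_outer hr, mem_bd] at hz
  exact hz.2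

theorem eq_of_sameV {z z' : Fin m.N} (hz : m.IsOuter (m.faceOf z))
    (hz' : m.IsOuter (m.faceOf z')) (hV : SameV m.α m.φ z z') : z = z' := by
  obtain ⟨r, hr⟩ := h.exists_root
  rw [isOuter_iff hr, eq_comm, ← mem_faceDarts, ← h.bd_outer hr] at hz hz'
  exact h.girthGe.origin_inj m.α_involutive m.isConn m.isExact (isRegion_faceDarts _)
    (by rw [h.bd_outer hr, h.card_outer hr]) hz hz' hV

/-- A function compatible with the rotation across inner corners is constant around vertices. -/
theorem rot_eq {β : Type*} {g : Fin m.N → β}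
    (hg : ∀ z, ¬ m.IsOuter (m.faceOf z) → g (m.φ z) = g (m.α z)) (z : Fin m.N) :
    g (m.φ z) = g (m.α z) := by
  classical
  by_cases hz : m.IsOuter (m.faceOf z)
  swap
  · exact hg z hz
  -- At the outer corner after `z`, the rotation goes from `φ z` to `α z` the other way round the
  -- vertex. It meets only inner corners, because by simplicity of the outer boundary a vertex has
  -- at most one outer corner.
  have hex : ∃ n : ℕ, ((m.φ * m.α) ^ n) (m.φ z) = m.α z := by
    have : (m.φ * m.α).SameCycle (m.φ z) (m.α z) := sameV_next m.α_involutive z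
    obtain ⟨n, -, -, hn⟩ := this.exists_pow_eq (m.φ * m.α)
    exact ⟨n, hn⟩
  have key : ∀ n ≤ Nat.find hex, g (((m.φ * m.α) ^ n) (m.φ z)) = g (m.φ z) := by
    intro n
    induction n with
    | zero => intro _; rfl
    | succ n ih =>
      intro hn
      rw [← ih (by omega), pow_succ', Equiv.Perm.mul_apply]
      set y := ((m.φ * m.α) ^ n) (m.φ z) with hy
      rw [Equiv.Perm.mul_apply]
      have hyz : y ≠ m.α z := Nat.find_min hex (by omega)
      rw [hg, m.α_involutive]
      intro hout
      refine hyz ?_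
      have e : m.φ (m.α y) = m.φ z := by
        refine h.eq_of_sameV (by rwa [faceOf_φ]) (by rwa [faceOf_φ]) ?_
        refine (sameV_rot m.α m.φ y).trans (SameV.symm ?_)
        exact ⟨n, by rw [zpow_natCast]⟩
      rw [← m.φ.injective e, m.α_involutive]
  rw [← key _ le_rfl, Nat.find_spec hex]

end IsFilling

/-- A gluing of fillings inside the faces of degree `d` of an irreducible map, with the maps `j`
and `k` between the darts. -/
structure Glued (M : LabelledMap) (d : ℕ) (e : M.InnerFace d → Fin M.N)
    (m : M.InnerFace d → LabelledMap) (M' : LabelledMap) (j : Fin M.N → Fin M'.N)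
    (k : ∀ f, Fin (m f).N → Fin M'.N) : Prop where
  irr : M.IsIrreducible d
  face_e : ∀ f, M.faceOf (e f) = f.1
  fill : ∀ f, (m f).IsFilling d
  root : ∀ x, M.IsRoot x → M'.IsRoot (j x)
  j_α : ∀ x, j (M.α x) = M'.α (j x)
  k_α : ∀ f x, k f ((m f).α x) = M'.α (k f x)
  j_φ : ∀ x, (¬ ∃ f : M.InnerFace d, f.1 = M.faceOf x) → j (M.φ x) = M'.φ (j x)
  k_φ : ∀ f x, ¬ (m f).IsOuter ((m f).faceOf x) → k f ((m f).φ x) = M'.φ (k f x)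
  matching : ∀ f r, (m f).IsRoot r → ∀ i : ℕ,
      k f (((m f).φ ^ i) r) = j (M.α ((M.φ⁻¹ ^ i) (e f)))
  bij : Function.Bijective (Sum.elim
      (fun x : {x // ¬ ∃ f : M.InnerFace d, f.1 = M.faceOf x} => j x.1)
      (fun y : (Σ f, {x // ¬ (m f).IsOuter ((m f).faceOf x)}) => k y.1 y.2.1))

/-! ### Recovering the pieces of a gluing -/

namespace Glued

variable {M : LabelledMap} {d : ℕ} {e : M.InnerFace d → Fin M.N}
  {m : M.InnerFace d → LabelledMap} {M' : LabelledMap} {j : Fin M.N → Fin M'.N}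
  {k : ∀ f, Fin (m f).N → Fin M'.N} (h : M.Glued d e m M' j k)
include h

theorem girthGe_left : GirthGe M.α M.φ d := (isIrreducible_iff.1 h.irr).1

theorem minimalPeriod_e (f : M.InnerFace d) : Function.minimalPeriod M.φ (e f) = d := by
  rw [← degree_faceOf, h.face_e, f.2.2]

theorem face_iff {f : M.InnerFace d} {x : Fin M.N} :
    M.faceOf x = f.1 ↔ ∃ i : ℕ, (M.φ⁻¹ ^ i) (e f) = x := by
  rw [← h.face_e, eq_comm, faceOf_eq]
  constructor
  · intro hx
    rw [← sameCycle_inv] at hx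
    obtain ⟨n, -, -, hn⟩ := hx.exists_pow_eq M.φ⁻¹
    exact ⟨n, hn⟩
  · rintro ⟨i, rfl⟩
    rw [← sameCycle_inv]
    exact ⟨i, by rw [zpow_natCast]⟩

theorem face_α_ne {f : M.InnerFace d} {x : Fin M.N} (hx : M.faceOf x = f.1) :
    M.faceOf (M.α x) ≠ f.1 := by
  rw [← mem_faceDarts, ← bd_faceDarts h.girthGe_left f, mem_bd, mem_faceDarts, mem_faceDarts] at hx
  exact hx.2

/-- A dart on the filled face becomes the reversal of an outer dart of the filling, which lies on an
inner face of that filling. This locates it in the disjoint union of `bij`. -/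
theorem exists_outer (f : M.InnerFace d) {x : Fin M.N} (hx : M.faceOf x = f.1) :
    ∃ r, (m f).IsRoot r ∧ ∃ i : ℕ, (M.φ⁻¹ ^ i) (e f) = x ∧
      j x = k f ((m f).α (((m f).φ ^ i) r)) ∧
      ¬ (m f).IsOuter ((m f).faceOf ((m f).α (((m f).φ ^ i) r))) := by
  obtain ⟨r, hr⟩ := (h.fill f).exists_root
  obtain ⟨i, rfl⟩ := h.face_iff.1 hx
  refine ⟨r, hr, i, rfl, ?_, ?_⟩
  · rw [h.k_α, h.matching f r hr, h.j_α, M'.α_involutive]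
  · exact (h.fill f).not_outer_α (((h.fill f).outer_iff hr).2 ⟨i, rfl⟩)

theorem j_inj_off {x x' : Fin M.N} (hx : ¬ ∃ f : M.InnerFace d, f.1 = M.faceOf x)
    (hx' : ¬ ∃ f : M.InnerFace d, f.1 = M.faceOf x') (hj : j x = j x') : x = x' := by
  have := @h.bij.1 (Sum.inl ⟨x, hx⟩) (Sum.inl ⟨x', hx'⟩) hj
  exact congrArg Subtype.val (Sum.inl.inj this)

theorem j_ne_k {x : Fin M.N} (hx : ¬ ∃ f : M.InnerFace d, f.1 = M.faceOf x)
    {f : M.InnerFace d} {z : Fin (m f).N} (hz : ¬ (m f).IsOuter ((m f).faceOf z)) :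
    j x ≠ k f z := fun hj => by
  have := @h.bij.1 (Sum.inl ⟨x, hx⟩) (Sum.inr ⟨f, z, hz⟩) hj
  exact Sum.inl_ne_inr this

theorem k_inj_inner {f : M.InnerFace d} {z z' : Fin (m f).N}
    (hz : ¬ (m f).IsOuter ((m f).faceOf z)) (hz' : ¬ (m f).IsOuter ((m f).faceOf z'))
    (hk : k f z = k f z') : z = z' := by
  have := @h.bij.1 (Sum.inr ⟨f, z, hz⟩) (Sum.inr ⟨f, z', hz'⟩) hk
  have := Sum.inr.inj this
  rw [Sigma.mk.injEq] at this
  exact congrArg Subtype.val (eq_of_heq this.2)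

theorem face_eq_of_k {f f' : M.InnerFace d} {z : Fin (m f).N} {z' : Fin (m f').N}
    (hz : ¬ (m f).IsOuter ((m f).faceOf z)) (hz' : ¬ (m f').IsOuter ((m f').faceOf z'))
    (hk : k f z = k f' z') : f = f' := by
  have := @h.bij.1 (Sum.inr ⟨f, z, hz⟩) (Sum.inr ⟨f', z', hz'⟩) hk
  exact congrArg Sigma.fst (Sum.inr.inj this)

open Classical in
/-- The part of the gluing inside the face `f`. -/
noncomputable def inside (_ : M.Glued d e m M' j k) (f : M.InnerFace d) : Finset (Fin M'.N) :=
  (Finset.univ.filter (fun z => ¬ (m f).IsOuter ((m f).faceOf z))).image (k f)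

theorem mem_inside {f : M.InnerFace d} {y : Fin M'.N} :
    y ∈ h.inside f ↔ ∃ z, ¬ (m f).IsOuter ((m f).faceOf z) ∧ k f z = y := by
  simp [inside]

theorem inside_disj {f f' : M.InnerFace d} {y : Fin M'.N} (hy : y ∈ h.inside f)
    (hy' : y ∈ h.inside f') : f = f' := by
  obtain ⟨z, hz, rfl⟩ := h.mem_inside.1 hy
  obtain ⟨z', hz', hk⟩ := h.mem_inside.1 hy'
  exact h.face_eq_of_k hz hz' hk.symm

theorem j_mem_inside {f : M.InnerFace d} {x : Fin M.N} :
    j x ∈ h.inside f ↔ M.faceOf x = f.1 := by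
  have key : ∀ f : M.InnerFace d, M.faceOf x = f.1 → j x ∈ h.inside f := by
    intro f hx
    obtain ⟨r, -, i, -, h2, h3⟩ := h.exists_outer f hx
    exact h.mem_inside.2 ⟨_, h3, h2.symm⟩
  refine ⟨fun hy => ?_, key f⟩
  by_cases hx : ∃ f : M.InnerFace d, f.1 = M.faceOf x
  · obtain ⟨f', hf'⟩ := hx
    rw [h.inside_disj hy (key f' hf'.symm), hf']
  · obtain ⟨z, hz, hk⟩ := h.mem_inside.1 hy
    exact absurd hk.symm (h.j_ne_k hx hz)

theorem k_mem_inside {f : M.InnerFace d} {z : Fin (m f).N} :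
    k f z ∈ h.inside f ↔ ¬ (m f).IsOuter ((m f).faceOf z) := by
  constructor
  · intro hy hz
    obtain ⟨r, hr⟩ := (h.fill f).exists_root
    obtain ⟨i, rfl⟩ := ((h.fill f).outer_iff hr).1 hz
    rw [h.matching f r hr, h.j_mem_inside] at hy
    exact h.face_α_ne (h.face_iff.2 ⟨i, rfl⟩) hy
  · exact fun hz => h.mem_inside.2 ⟨z, hz, rfl⟩

theorem j_injective : Function.Injective j := by
  intro x x' hj
  by_cases hx : ∃ f : M.InnerFace d, f.1 = M.faceOf x
  · obtain ⟨f, hf⟩ := hx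
    have hx' := h.j_mem_inside.1 (hj ▸ h.j_mem_inside.2 hf.symm)
    obtain ⟨r, hr, i, rfl, e1, n1⟩ := h.exists_outer f hf.symm
    obtain ⟨r', hr', i', rfl, e2, n2⟩ := h.exists_outer f hx'
    obtain rfl := isRoot_unique hr hr'
    rw [e1, e2] at hj
    have := (m f).α.injective (h.k_inj_inner n1 n2 hj)
    rw [pow_eq_pow_iff ((h.fill f).minimalPeriod hr)] at this
    exact (inv_pow_eq_inv_pow_iff (h.minimalPeriod_e f)).2 this
  · refine h.j_inj_off hx ?_ hj
    rintro ⟨f', hf'⟩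
    exact hx ⟨f', (h.j_mem_inside.1 (hj ▸ h.j_mem_inside.2 hf'.symm)).symm⟩

theorem k_injective (f : M.InnerFace d) : Function.Injective (k f) := by
  intro z z' hk
  by_cases hz : (m f).IsOuter ((m f).faceOf z)
  · have hz' : (m f).IsOuter ((m f).faceOf z') := by
      by_contra hz'
      rw [← h.k_mem_inside, ← hk, h.k_mem_inside] at hz'
      exact hz' hz
    obtain ⟨r, hr⟩ := (h.fill f).exists_root
    obtain ⟨i, rfl⟩ := ((h.fill f).outer_iff hr).1 hz
    obtain ⟨i', rfl⟩ := ((h.fill f).outer_iff hr).1 hz'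
    rw [h.matching f r hr, h.matching f r hr] at hk
    have := M.α.injective (h.j_injective hk)
    rw [inv_pow_eq_inv_pow_iff (h.minimalPeriod_e f)] at this
    exact (pow_eq_pow_iff ((h.fill f).minimalPeriod hr)).2 this
  · have hz' : ¬ (m f).IsOuter ((m f).faceOf z') := by
      rw [← h.k_mem_inside, ← hk, h.k_mem_inside]
      exact hz
    exact h.k_inj_inner hz hz' hk

theorem isRegion_inside (f : M.InnerFace d) : IsRegion M'.φ (h.inside f) := by
  intro y hy
  obtain ⟨z, hz, rfl⟩ := h.mem_inside.1 hy
  rw [← h.k_φ f z hz, h.k_mem_inside, faceOf_φ]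
  exact hz

/-- On inner faces this is `k_φ`; `rot_eq` supplies the outer darts, whose successors are not
respected by `k`. -/
theorem k_vertex (f : M.InnerFace d) (z : Fin (m f).N) :
    SameV M'.α M'.φ (k f ((m f).φ z)) (M'.α (k f z)) := by
  rw [← h.k_α, ← origin_eq]
  refine (h.fill f).rot_eq (g := fun z => M'.origin (k f z)) (fun z hz => ?_) z
  rw [h.k_φ f z hz, h.k_α, origin_eq]
  exact sameV_next M'.α_involutive _

/-- On a filled face the matching reverses the direction of travel, so the claim becomes `k_vertex`
for the filling, read backwards. -/
theorem j_vertex (x : Fin M.N) : SameV M'.α M'.φ (j (M.φ x)) (M'.α (j x)) := by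
  by_cases hx : ∃ f : M.InnerFace d, f.1 = M.faceOf x
  · obtain ⟨f, hf⟩ := hx
    obtain ⟨r, hr, i, hi, e1, -⟩ := h.exists_outer f (x := M.φ x) (by rw [faceOf_φ, hf])
    have hi' : (M.φ⁻¹ ^ (i + 1)) (e f) = x := by
      rw [pow_succ', Equiv.Perm.mul_apply, hi]; simp
    rw [e1, ← h.j_α]
    rw [← hi', ← h.matching f r hr, pow_succ', Equiv.Perm.mul_apply, h.k_α]
    exact (h.k_vertex f _).symm
  · rw [h.j_φ x hx]
    exact sameV_next M'.α_involutive _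

/-- Gluing is undone by deleting what was put inside the faces. -/
theorem isCollapse_j : M.IsCollapse M' (Set.range h.inside) j where
  region := by
    rintro _ ⟨f, rfl⟩
    exact h.isRegion_inside f
  disj := by
    rintro _ ⟨f, rfl⟩ _ ⟨f', rfl⟩ y hy hy'
    rw [h.inside_disj hy hy']
  injective := h.j_injective
  mem_range := by
    intro y
    constructor
    · rintro ⟨x, rfl⟩ _ ⟨f, rfl⟩ hx
      rw [← h.j_α, h.j_mem_inside]
      exact h.face_α_ne (h.j_mem_inside.1 hx)
    · intro hy
      obtain ⟨⟨x, hx⟩ | ⟨f, z, hz⟩, rfl⟩ := h.bij.2 y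
      · exact ⟨x, rfl⟩
      · have := hy _ ⟨f, rfl⟩ (h.k_mem_inside.2 hz)
        change M'.α (k f z) ∉ _ at this
        rw [← h.k_α, h.k_mem_inside, not_not] at this
        obtain ⟨r, hr⟩ := (h.fill f).exists_root
        obtain ⟨i, hi⟩ := ((h.fill f).outer_iff hr).1 this
        refine ⟨(M.φ⁻¹ ^ i) (e f), ?_⟩
        change _ = k f z
        rw [← (m f).α_involutive z, ← hi, h.k_α, h.matching f r hr, h.j_α, M'.α_involutive]
  map_α := h.j_α
  map_φ := by
    intro x hx
    refine h.j_φ x ?_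
    rintro ⟨f, hf⟩
    exact hx _ ⟨f, rfl⟩ (h.j_mem_inside.2 hf.symm)
  face := by
    rintro _ ⟨f, rfl⟩ x y hx
    rw [h.j_mem_inside] at hx ⊢
    rw [← faceOf_eq, hx, eq_comm]
  vertex := h.j_vertex

/-- The filling is what remains when everything outside it is collapsed to its outer face. Thus both
kinds of pieces are collapses, and one uniqueness lemma serves for both. -/
theorem isCollapse_k (f : M.InnerFace d) : (m f).IsCollapse M' {(h.inside f)ᶜ} (k f) where
  region := by
    rintro _ rfl
    exact (h.isRegion_inside f).compl
  disj := by
    rintro _ rfl _ rfl _ _ _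
    rfl
  injective := h.k_injective f
  mem_range := by
    intro y
    simp only [Set.mem_singleton_iff, forall_eq, Finset.mem_compl, not_not]
    constructor
    · rintro ⟨z, rfl⟩ hz
      rw [h.k_mem_inside, not_not] at hz
      rw [← h.k_α, h.k_mem_inside]
      exact (h.fill f).not_outer_α hz
    · intro hy
      by_cases hy' : y ∈ h.inside f
      · obtain ⟨z, -, hz⟩ := h.mem_inside.1 hy'
        exact ⟨z, hz⟩
      · obtain ⟨z, -, hz⟩ := h.mem_inside.1 (hy hy')
        exact ⟨(m f).α z, by rw [h.k_α, hz, M'.α_involutive]⟩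
  map_α := h.k_α f
  map_φ := by
    intro x hx
    refine h.k_φ f x ?_
    have := hx _ rfl
    rwa [Finset.mem_compl, not_not, h.k_mem_inside] at this
  face := by
    rintro _ rfl x y hx
    obtain ⟨r, hr⟩ := (h.fill f).exists_root
    rw [Finset.mem_compl, h.k_mem_inside, not_not, isOuter_iff hr] at hx ⊢
    rw [← faceOf_eq, hx]
  vertex := h.k_vertex f

theorem card_bd_inside (f : M.InnerFace d) : (bd M'.α (h.inside f)).card = d := by
  obtain ⟨r, hr⟩ := (h.fill f).exists_root
  have hrm : k f r ∈ (h.inside f)ᶜ := by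
    rw [Finset.mem_compl, h.k_mem_inside, not_not, isOuter_iff hr]
  rw [← card_bd_compl M'.α_involutive, ← (h.isCollapse_k f).degree_eq rfl hrm, degree_faceOf,
    (h.fill f).minimalPeriod hr]

theorem inside_nonempty (f : M.InnerFace d) : (h.inside f).Nonempty :=
  ⟨_, h.j_mem_inside.2 (h.face_e f)⟩

theorem isInnerRegion_inside (f : M.InnerFace d) : M'.IsInnerRegion (h.inside f) := by
  refine ⟨h.isRegion_inside f, h.inside_nonempty f, fun r' hr' hin => ?_⟩
  obtain ⟨r, hr⟩ := exists_isRoot (e f)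
  rw [isRoot_unique hr' (h.root r hr), h.j_mem_inside] at hin
  exact f.2.1 (hin ▸ ⟨r, hr, rfl⟩)

/-- The girth of a gluing and the position of its cells are obtained together, by induction on the
size of the complement of `S`. If `S` meets a glued piece without containing it, adding the piece
enlarges `S` and does not increase its boundary. Otherwise `S` comes from the irreducible map. -/
theorem inner_region_bound (n : ℕ) : ∀ S : Finset (Fin M'.N), M'.IsInnerRegion S →
    M'.N - S.card = n →
    d ≤ (bd M'.α S).card ∧ ((bd M'.α S).card = d → ∃ f, S ⊆ h.inside f) := by
  induction n using Nat.strong_induction_on with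
  | _ n ih =>
  intro S hS hn
  by_cases hsat : ∃ f, (S ∩ h.inside f).Nonempty ∧ ¬ h.inside f ⊆ S
  · obtain ⟨f, hne, hns⟩ := hsat
    have h1 := card_bd_union_add_inter M'.α S (h.inside f)
    rw [h.card_bd_inside] at h1
    -- The common part is a region of the filling off its outer face, to which the girth of the
    -- filling applies; submodularity then bounds the union.
    have h2 : d ≤ (bd M'.α (S ∩ h.inside f)).card := by
      classical
      let U : Finset (Fin (m f).N) :=
        Finset.univ.filter (fun z => ¬ (m f).IsOuter ((m f).faceOf z) ∧ k f z ∈ S)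
      have hU : IsRegion (m f).φ U := by
        intro z hz
        simp only [U, Finset.mem_filter, Finset.mem_univ, true_and] at hz ⊢
        rw [faceOf_φ, h.k_φ f z hz.1]
        exact ⟨hz.1, hS.region _ hz.2⟩
      have hl : (h.isCollapse_k f).lift U = S ∩ h.inside f := by
        ext y
        rw [(h.isCollapse_k f).mem_lift, Finset.mem_inter]
        simp only [U, Finset.mem_filter, Finset.mem_univ, true_and, Set.mem_singleton_iff]
        constructor
        · rintro (⟨z, ⟨hz, hzS⟩, rfl⟩ | ⟨_, rfl, _, z, ⟨hz, hzS⟩, hz'⟩)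
          · exact ⟨hzS, h.k_mem_inside.2 hz⟩
          · rw [Finset.mem_compl, h.k_mem_inside] at hz'
            exact absurd hz hz'
        · rintro ⟨hyS, hy⟩
          obtain ⟨z, hz, rfl⟩ := h.mem_inside.1 hy
          exact Or.inl ⟨z, ⟨hz, hyS⟩, rfl⟩
      rw [← hl, (h.isCollapse_k f).card_bd_lift hU]
      obtain ⟨r, hr⟩ := (h.fill f).exists_root
      refine (h.fill f).girthGe U hU ?_ (fun hu => ?_)
      · obtain ⟨y, hy⟩ := hne
        rw [Finset.mem_inter] at hy
        obtain ⟨z, hz, rfl⟩ := h.mem_inside.1 hy.2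
        exact ⟨z, by simp [U, hz, hy.1]⟩
      · have : r ∈ U := hu ▸ Finset.mem_univ r
        simp only [U, Finset.mem_filter, Finset.mem_univ, true_and] at this
        exact this.1 ((isOuter_iff hr _).2 rfl)
    have hT : M'.IsInnerRegion (S ∪ h.inside f) := by
      refine ⟨hS.region.union (h.isRegion_inside f), hS.nonempty.mono Finset.subset_union_left,
        fun r hr hrS => ?_⟩
      rcases Finset.mem_union.1 hrS with h' | h'
      · exact hS.root r hr h'
      · exact (h.isInnerRegion_inside f).root r hr h'
    have hlt : S.card < (S ∪ h.inside f).card := by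
      refine Finset.card_lt_card (Finset.ssubset_iff_subset_ne.2 ⟨Finset.subset_union_left, ?_⟩)
      intro he
      exact hns (he ▸ Finset.subset_union_right)
    have hle := Finset.card_le_univ (S ∪ h.inside f)
    rw [Fintype.card_fin] at hle
    obtain ⟨g1, g2⟩ := ih _ (by omega) _ hT rfl
    refine ⟨by omega, fun hd => ?_⟩
    obtain ⟨f', hf'⟩ := g2 (by omega)
    exact ⟨f', Finset.subset_union_left.trans hf'⟩
  · push Not at hsat
    have hc := h.isCollapse_j
    classical
    -- Since `S` contains or avoids each glued piece, it is the lift of this region of `M`, with the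
    -- same boundary size.
    let U : Finset (Fin M.N) := Finset.univ.filter (fun x => j x ∈ S)
    have memU : ∀ x, x ∈ U ↔ j x ∈ S := fun x => by simp [U]
    have hU : IsRegion M.φ U := by
      intro x hx
      rw [memU] at hx ⊢
      by_cases hf : ∃ f : M.InnerFace d, f.1 = M.faceOf x
      · obtain ⟨f, hf⟩ := hf
        have hx' := h.j_mem_inside.2 hf.symm
        exact hsat f ⟨_, Finset.mem_inter.2 ⟨hx, hx'⟩⟩ (h.j_mem_inside.2 (by rw [faceOf_φ, hf]))
      · rw [h.j_φ x hf]
        exact hS.region _ hx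
    have hl : hc.lift U = S := by
      ext y
      rw [hc.mem_lift]
      constructor
      · rintro (⟨x, hx, rfl⟩ | ⟨_, ⟨f, rfl⟩, hy, x, hx, hxf⟩)
        · exact (memU x).1 hx
        · exact hsat f ⟨_, Finset.mem_inter.2 ⟨(memU x).1 hx, hxf⟩⟩ hy
      · intro hy
        by_cases hyf : ∃ f, y ∈ h.inside f
        · obtain ⟨f, hf⟩ := hyf
          have := h.j_mem_inside.2 (h.face_e f)
          exact Or.inr ⟨_, ⟨f, rfl⟩, hf, e f, (memU _).2 (hsat f ⟨y, Finset.mem_inter.2 ⟨hy, hf⟩⟩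
            this), this⟩
        · obtain ⟨x, rfl⟩ := (hc.mem_range y).2 (by
            rintro _ ⟨f, rfl⟩ h'
            exact absurd ⟨f, h'⟩ hyf)
          exact Or.inl ⟨x, (memU x).2 hy, rfl⟩
    have hUi : M.IsInnerRegion U := by
      refine ⟨hU, ?_, fun r hr hrU => hS.root _ (h.root r hr) ((memU r).1 hrU)⟩
      obtain ⟨y, hy⟩ := hS.nonempty
      rw [← hl, hc.mem_lift] at hy
      rcases hy with ⟨x, hx, -⟩ | ⟨-, -, -, x, hx, -⟩ <;> exact ⟨x, hx⟩
    obtain ⟨g1, g2⟩ := isIrreducible_iff.1 h.irr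
    have hcard := hc.card_bd_lift hU
    rw [hl] at hcard
    rw [hcard]
    refine ⟨g1 U hU hUi.nonempty hUi.ne_univ, fun hd => ?_⟩
    obtain ⟨f, hf⟩ := g2 U hUi hd
    refine ⟨f, fun y hy => ?_⟩
    rw [← hl, hc.mem_lift] at hy
    rcases hy with ⟨x, hx, rfl⟩ | ⟨_, ⟨f', rfl⟩, hy, x, hx, hxf⟩
    · rw [hf, mem_faceDarts] at hx
      exact h.j_mem_inside.2 hx
    · rw [hf, mem_faceDarts, ← h.j_mem_inside] at hx
      rwa [h.inside_disj hx hxf]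

theorem girthGe : GirthGe M'.α M'.φ d :=
  girthGe_of_inner fun S hS => (h.inner_region_bound _ S hS rfl).1

/-- The glued pieces are disjoint cells and every cell lies in one of them, so they are the maximal
cells. -/
theorem maxCells_eq : M'.maxCells d = Set.range h.inside := by
  have hcell : ∀ f, M'.IsCell d (h.inside f) := fun f =>
    ⟨h.isInnerRegion_inside f, h.card_bd_inside f⟩
  have hle : ∀ S, M'.IsCell d S → ∃ f, S ⊆ h.inside f := fun S hS =>
    (h.inner_region_bound _ S hS.1 rfl).2 hS.2
  ext C
  constructor
  · intro hC
    obtain ⟨f, hf⟩ := hle C hC.1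
    exact ⟨f, (hC.2 _ (hcell f) hf).symm⟩
  · rintro ⟨f, rfl⟩
    refine ⟨hcell f, fun T hT hfT => le_antisymm hfT ?_⟩
    obtain ⟨f', hf'⟩ := hle T hT
    obtain ⟨y, hy⟩ := h.inside_nonempty f
    rwa [h.inside_disj hy (hf' (hfT hy))]

theorem outerDegree_eq : M'.outerDegree = M.outerDegree := by
  rcases Nat.eq_zero_or_pos M.N with h0 | h0
  · have hM : IsEmpty (Fin M.N) := by rw [h0]; infer_instance
    have : IsEmpty (Fin M'.N) := by
      refine ⟨fun y => ?_⟩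
      obtain ⟨⟨x, hx⟩ | ⟨f, z, hz⟩, rfl⟩ := h.bij.2 y
      · exact hM.false x
      · exact hM.false (e f)
    rw [outerDegree_eq_zero h0, LabelledMap.outerDegree, Nat.card_of_isEmpty]
  · have hr : M.IsRoot ⟨0, h0⟩ := rfl
    rw [LabelledMap.outerDegree_eq hr, LabelledMap.outerDegree_eq (h.root _ hr)]
    refine h.isCollapse_j.minimalPeriod_eq ?_
    rintro _ ⟨f, rfl⟩ hf
    exact not_exists_innerFace_root hr ⟨f, (h.j_mem_inside.1 hf).symm⟩

end Glued

end LabelledMap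

/-! ### Decomposition along the maximal cells, and uniqueness -/

namespace LabelledMap

open CombMap Equiv.Perm

section Decompose

variable {L M : LabelledMap} {d : ℕ} {ι : Fin L.N → Fin M.N}

theorem IsCollapse.root_off (h : L.IsCollapse M (M.maxCells d) ι)
    (hr : ∀ x, L.IsRoot x ↔ M.IsRoot (ι x)) {r' : Fin M.N} (hr' : M.IsRoot r') :
    ∃ r, L.IsRoot r ∧ ι r = r' := by
  obtain ⟨r, rfl⟩ := (h.mem_range r').2 (fun C hC hx => absurd hx (hC.1.1.root _ hr'))
  exact ⟨r, (hr r).2 hr', rfl⟩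

theorem IsCollapse.outerDegree_eq (h : L.IsCollapse M (M.maxCells d) ι)
    (hr : ∀ x, L.IsRoot x ↔ M.IsRoot (ι x)) : L.outerDegree = M.outerDegree := by
  rcases Nat.eq_zero_or_pos M.N with h0 | h0
  · have hM : IsEmpty (Fin M.N) := by rw [h0]; infer_instance
    have : IsEmpty (Fin L.N) := ⟨fun x => hM.false (ι x)⟩
    rw [outerDegree_eq_zero h0, LabelledMap.outerDegree, Nat.card_of_isEmpty]
  · obtain ⟨r, h1, h2⟩ := h.root_off hr (r' := ⟨0, h0⟩) rfl
    rw [LabelledMap.outerDegree_eq h1, LabelledMap.outerDegree_eq ((hr r).1 h1),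
      h.minimalPeriod_eq (fun C hC => hC.1.1.root _ ((hr r).1 h1))]

theorem IsCollapse.exists_innerFace (h : L.IsCollapse M (M.maxCells d) ι)
    (hr : ∀ x, L.IsRoot x ↔ M.IsRoot (ι x)) {C : Finset (Fin M.N)} (hC : C ∈ M.maxCells d)
    {x : Fin L.N} (hx : ι x ∈ C) : ∃ f : L.InnerFace d, f.1 = L.faceOf x := by
  refine ⟨⟨L.faceOf x, ?_, by rw [h.degree_eq hC hx, hC.1.2]⟩, rfl⟩
  rintro ⟨r, h1, h2⟩
  rw [eq_comm, faceOf_eq, ← h.face C hC _ _ hx] at h2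
  exact hC.1.1.root _ ((hr r).1 h1) h2

/-- A face of degree `d` not produced by a collapse would be an inner face of `M`. As such it is
itself a cell, contained in a maximal one. -/
theorem IsCollapse.exists_maxCell (hg : GirthGe M.α M.φ d) (h : L.IsCollapse M (M.maxCells d) ι)
    (hr : ∀ x, L.IsRoot x ↔ M.IsRoot (ι x)) (f : L.InnerFace d) {x : Fin L.N}
    (hx : L.faceOf x = f.1) : ∃ C ∈ M.maxCells d, ι x ∈ C := by
  by_contra hno
  push Not at hno
  have hin : ¬ M.IsOuter (M.faceOf (ι x)) := by
    rintro ⟨r', h1, h2⟩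
    obtain ⟨r, h3, rfl⟩ := h.root_off hr h1
    rw [eq_comm, faceOf_eq, sameCycle_iff_iterate] at h2
    obtain ⟨n, -, hn⟩ := h2
    refine f.2.1 ⟨r, h3, ?_⟩
    rw [← hx, eq_comm, faceOf_eq]
    refine ⟨n, h.injective ?_⟩
    rw [← hn, zpow_natCast, ← Equiv.Perm.iterate_eq_pow]
    clear hn
    have : ∀ n, (∀ C ∈ M.maxCells d, ι (L.φ^[n] x) ∉ C) ∧ ι (L.φ^[n] x) = M.φ^[n] (ι x) := by
      intro n
      induction n with
      | zero => exact ⟨hno, rfl⟩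
      | succ n ih =>
        rw [Function.iterate_succ_apply', Function.iterate_succ_apply', ← ih.2, h.map_φ _ ih.1]
        refine ⟨fun C hC => ?_, rfl⟩
        rw [← h.map_φ _ ih.1, h.φ_mem_iff hC]
        exact ih.1 C hC
    exact (this n).2
  have hi := isInnerRegion_faceDarts hin
  have hcard : (M.faceDarts (M.faceOf (ι x))).card = d := by
    rw [card_faceDarts, degree_faceOf, h.minimalPeriod_eq hno, ← degree_faceOf, hx, f.2.2]
  have hcell : M.IsCell d (M.faceDarts (M.faceOf (ι x))) :=
    ⟨hi, le_antisymm (hcard ▸ Finset.card_le_card (bd_subset _ _))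
      (hg _ hi.region hi.nonempty hi.ne_univ)⟩
  obtain ⟨C, hC, hle⟩ := hcell.exists_le
  exact hno C hC (hle (mem_faceDarts.2 rfl))

/-- An inner region with `d` boundary darts lifts to a cell, which lies in a maximal cell; the
latter has become a single face, so the region is that face. -/
theorem IsCollapse.isIrreducible (hg : GirthGe M.α M.φ d)
    (h : L.IsCollapse M (M.maxCells d) ι) (hr : ∀ x, L.IsRoot x ↔ M.IsRoot (ι x)) :
    L.IsIrreducible d := by
  rw [isIrreducible_iff]
  refine ⟨h.girthGe hg, fun U hU hd => ?_⟩
  have hl : M.IsInnerRegion (h.lift U) := by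
    refine ⟨h.isRegion_lift hU.region, h.lift_nonempty hU.region hU.nonempty, fun r' hr' hin => ?_⟩
    obtain ⟨r, h1, rfl⟩ := h.root_off hr hr'
    exact hU.root r h1 ((h.apply_mem_lift hU.region).1 hin)
  have hcard := h.card_bd_lift hU.region
  obtain ⟨C, hC, hle⟩ := IsCell.exists_le (d := d) ⟨hl, hcard.trans hd⟩
  obtain ⟨x, hx⟩ := bd_nonempty L.isConn hU.region hU.nonempty hU.ne_univ
  have hxC : ι x ∈ C := hle ((h.apply_mem_lift hU.region).2 (mem_bd.1 hx).1)
  obtain ⟨f, hf⟩ := h.exists_innerFace hr hC hxC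
  refine ⟨f, Finset.Subset.antisymm (fun z hz => ?_) (fun z hz => ?_)⟩
  · rw [mem_faceDarts, hf, eq_comm, faceOf_eq, ← h.face C hC _ _ hxC]
    exact hle ((h.apply_mem_lift hU.region).2 hz)
  · rw [mem_faceDarts, hf, eq_comm, faceOf_eq] at hz
    exact mem_of_sameCycle hU.region hz (mem_bd.1 hx).1

/-- The complement of `C` becomes the outer face, of degree `d`. All its darts are boundary darts,
so the girth does not exceed `d`. -/
theorem IsCollapse.isFilling (hpos : 0 < d) (hg : GirthGe M.α M.φ d) {C : Finset (Fin M.N)}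
    (hC : (bd M.α C).card = d) (h : L.IsCollapse M {Cᶜ} ι) {z : Fin M.N}
    (hz : z ∈ bd M.α C) (hr : ∀ x, L.IsRoot x ↔ ι x = M.α z) : L.IsFilling d := by
  rw [mem_bd] at hz
  obtain ⟨r, hr'⟩ : ∃ r, ι r = M.α z := by
    rw [h.mem_range]
    rintro _ rfl -
    rw [M.α_involutive, Finset.mem_compl, not_not]
    exact hz.1
  have hrC : ι r ∈ Cᶜ := by rw [hr', Finset.mem_compl]; exact hz.2
  have hdeg := h.degree_eq rfl hrC
  rw [card_bd_compl M.α_involutive, hC] at hdeg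
  refine ⟨hpos, ?_, girth_eq_natCast.2 ⟨h.girthGe hg, L.faceDarts (L.faceOf r),
    isRegion_faceDarts _, faceDarts_nonempty _, fun hu => ?_, ?_⟩⟩
  · rw [LabelledMap.outerDegree_eq ((hr r).2 hr'), ← degree_faceOf, hdeg]
  · have : L.α r ∈ L.faceDarts (L.faceOf r) := hu ▸ Finset.mem_univ _
    rw [mem_faceDarts, eq_comm, faceOf_eq, ← h.face _ rfl _ _ hrC, h.map_α, hr', M.α_involutive,
      Finset.mem_compl] at this
    exact this hz.1
  · rw [← hdeg, ← card_faceDarts]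
    congr 1
    refine Finset.filter_true_of_mem (fun x hx => ?_)
    rw [mem_faceDarts, eq_comm, faceOf_eq, ← h.face _ rfl _ _ hrC] at hx ⊢
    rw [h.map_α]
    exact h.notMem rfl hx

/-- A map is the gluing of the pieces delimited by its maximal cells. -/
theorem IsCollapse.glued (hpos : 0 < d) (hg : GirthGe M.α M.φ d)
    (h : L.IsCollapse M (M.maxCells d) ι)
    (hr : ∀ x, L.IsRoot x ↔ M.IsRoot (ι x)) {e : L.InnerFace d → Fin L.N}
    (he : ∀ f, L.faceOf (e f) = f.1) {C : L.InnerFace d → Finset (Fin M.N)}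
    (hC : ∀ f, C f ∈ M.maxCells d) (heC : ∀ f, ι (e f) ∈ C f) {m : L.InnerFace d → LabelledMap}
    {k : ∀ f, Fin (m f).N → Fin M.N} (hm : ∀ f, (m f).IsCollapse M {(C f)ᶜ} (k f))
    (hmr : ∀ f x, (m f).IsRoot x ↔ k f x = M.α (ι (e f))) : L.Glued d e m M ι k := by
  have hbd : ∀ f x, L.faceOf x = f.1 → ι x ∈ bd M.α (C f) := by
    intro f x hx
    have hxC : ι x ∈ C f := by
      rw [h.face _ (hC f) _ _ (heC f), ← faceOf_eq, he, hx]
    exact mem_bd.2 ⟨hxC, h.notMem (hC f) hxC⟩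
  have hfill : ∀ f, (m f).IsFilling d := fun f =>
    (hm f).isFilling hpos hg (hC f).1.2 (hbd f _ (he f)) (hmr f)
  have houter : ∀ f z, (m f).IsOuter ((m f).faceOf z) ↔ k f z ∉ C f := by
    intro f z
    obtain ⟨r, hr⟩ := (hfill f).exists_root
    have hrC : k f r ∈ (C f)ᶜ := by
      rw [(hmr f r).1 hr, Finset.mem_compl]
      exact (mem_bd.1 (hbd f _ (he f))).2
    rw [isOuter_iff hr, faceOf_eq, ← (hm f).face _ rfl _ _ hrC, Finset.mem_compl]
  have hface : ∀ x, (∃ f : L.InnerFace d, f.1 = L.faceOf x) ↔ ∃ f, ι x ∈ C f := by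
    intro x
    constructor
    · rintro ⟨f, hf⟩
      exact ⟨f, (mem_bd.1 (hbd f x hf.symm)).1⟩
    · rintro ⟨f, hf⟩
      exact h.exists_innerFace hr (hC f) hf
  have hall : ∀ C' ∈ M.maxCells d, ∃ f, C' = C f := by
    intro C' hC'
    obtain ⟨y, hy⟩ := bd_nonempty M.isConn hC'.1.1.region hC'.1.1.nonempty hC'.1.1.ne_univ
    obtain ⟨x, rfl⟩ := h.exists_of_mem_bd hC' hy
    obtain ⟨f, hf⟩ := h.exists_innerFace hr hC' (mem_bd.1 hy).1
    exact ⟨f, h.disj _ hC' _ (hC f) _ (mem_bd.1 hy).1 (mem_bd.1 (hbd f x hf.symm)).1⟩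
  have hCinj : ∀ f f' y, y ∈ C f → y ∈ C f' → f = f' := by
    intro f f' y hy hy'
    have heq := h.disj _ (hC f) _ (hC f') y hy hy'
    apply Subtype.ext
    rw [← he f, ← he f', faceOf_eq, ← h.face _ (hC f) _ _ (heC f), heq]
    exact heC f'
  refine ⟨h.isIrreducible hg hr, he, hfill, fun x => (hr x).1, h.map_α, fun f => (hm f).map_α,
    fun x hx => h.map_φ x ?_, fun f x hx => (hm f).map_φ x ?_, ?_, ?_, ?_⟩
  · intro C' hC' hxC
    exact hx (h.exists_innerFace hr hC' hxC)
  · rintro _ rfl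
    rw [houter, not_not] at hx
    rwa [Finset.mem_compl, not_not]
  · intro f r hr i
    induction i with
    | zero =>
      rw [pow_zero, pow_zero, Equiv.Perm.one_apply, Equiv.Perm.one_apply, h.map_α,
        (hmr f r).1 hr]
    | succ i ih =>
      have hcirc : L.faceOf ((L.φ⁻¹ ^ (i + 1)) (e f)) = f.1 := by
        rw [← he f, eq_comm, faceOf_eq, ← sameCycle_inv]
        exact ⟨(i + 1 : ℕ), by rw [zpow_natCast]⟩
      have hout : ∀ i : ℕ, k f (((m f).φ ^ i) r) ∈ (C f)ᶜ := by
        intro i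
        rw [Finset.mem_compl, ← houter, (hfill f).outer_iff hr]
        exact ⟨i, rfl⟩
      -- The two darts to be identified lie on the boundary of the complement of `C f` and, by the
      -- preceding step of the walk, have the same origin.
      refine hg.origin_inj M.α_involutive M.isConn M.isExact (hC f).1.1.region.compl
        (by rw [card_bd_compl M.α_involutive, (hC f).1.2]) (x := k f _) (y := ι _) ?_ ?_ ?_
      · exact mem_bd.2 ⟨hout _, (hm f).notMem rfl (hout _)⟩
      · rw [mem_bd_compl M.α_involutive, h.map_α, M.α_involutive]
        exact hbd f _ hcirc
      · rw [pow_succ', Equiv.Perm.mul_apply]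
        refine ((hm f).vertex _).trans ?_
        rw [ih, h.map_α, h.map_α, M.α_involutive]
        have := h.vertex ((L.φ⁻¹ ^ (i + 1)) (e f))
        have hφ : L.φ ((L.φ⁻¹ ^ (i + 1)) (e f)) = (L.φ⁻¹ ^ i) (e f) := by
          rw [pow_succ', Equiv.Perm.mul_apply]; simp
        rwa [hφ] at this
  · rintro (⟨x, hx⟩ | ⟨f, z, hz⟩) (⟨x', hx'⟩ | ⟨f', z', hz'⟩) heq
    · obtain rfl := h.injective heq
      rfl
    · change ι x = k f' z' at heq
      rw [houter, not_not, ← heq] at hz'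
      exact absurd ((hface x).2 ⟨f', hz'⟩) hx
    · change k f z = ι x' at heq
      rw [houter, not_not, heq] at hz
      exact absurd ((hface x').2 ⟨f, hz⟩) hx'
    · change k f z = k f' z' at heq
      have hz1 := hz
      have hz2 := hz'
      rw [houter, not_not] at hz1 hz2
      obtain rfl := hCinj f f' _ hz1 (heq ▸ hz2)
      obtain rfl := (hm f).injective heq
      rfl
  · intro y
    by_cases hy : ∃ f, y ∈ C f
    · obtain ⟨f, hf⟩ := hy
      obtain ⟨z, rfl⟩ := ((hm f).mem_range y).2 (by
        rintro _ rfl h'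
        exact absurd hf (Finset.mem_compl.1 h'))
      exact ⟨Sum.inr ⟨f, z, by rwa [houter, not_not]⟩, rfl⟩
    · obtain ⟨x, rfl⟩ := (h.mem_range y).2 (by
        intro C' hC' h'
        obtain ⟨f, rfl⟩ := hall C' hC'
        exact absurd ⟨f, h'⟩ hy)
      exact ⟨Sum.inl ⟨x, by rwa [hface]⟩, rfl⟩

end Decompose

/-- A rooted map has no automorphism. -/
theorem eq_of_fix {M : LabelledMap} {g : Fin M.N → Fin M.N} (h1 : ∀ x, g (M.α x) = M.α (g x))
    (h2 : ∀ x, g (M.φ x) = M.φ (g x)) (hr : ∀ r, M.IsRoot r → g r = r) (x : Fin M.N) :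
    g x = x := by
  obtain ⟨r, hr'⟩ := exists_isRoot x
  exact M.isConn (fun x => g x = x) (fun x hx => by rw [h1, hx]) (fun x hx => by rw [h2, hx]) r x
    (hr r hr')

/-! ### Uniqueness of the pieces and of the result of a gluing -/

namespace Glued

section

variable {M : LabelledMap} {d : ℕ} {e : M.InnerFace d → Fin M.N}
  {m : M.InnerFace d → LabelledMap} {M' : LabelledMap} {j : Fin M.N → Fin M'.N}
  {k : ∀ f, Fin (m f).N → Fin M'.N} (h : M.Glued d e m M' j k)
include h

theorem sameV_bd {C : Finset (Fin M'.N)} (hC : C ∈ M'.maxCells d) {x y : Fin M'.N}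
    (hx : x ∈ bd M'.α C) (hy : y ∈ bd M'.α C) (hV : SameV M'.α M'.φ x y) : x = y :=
  h.girthGe.origin_inj M'.α_involutive M'.isConn M'.isExact hC.1.1.region hC.1.2 hx hy hV

theorem collapse : M.IsCollapse M' (M'.maxCells d) j := h.maxCells_eq ▸ h.isCollapse_j

theorem root_iff (x : Fin M.N) : M.IsRoot x ↔ M'.IsRoot (j x) := by
  refine ⟨h.root x, fun hx => ?_⟩
  obtain ⟨r, hr⟩ := exists_isRoot x
  rwa [← h.j_injective (isRoot_unique hx (h.root r hr))] at hr

/-- The irreducible map of a gluing is unique. -/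
theorem iso_left {M₂ : LabelledMap} {e₂ : M₂.InnerFace d → Fin M₂.N}
    {m₂ : M₂.InnerFace d → LabelledMap} {j₂ : Fin M₂.N → Fin M'.N}
    {k₂ : ∀ f, Fin (m₂ f).N → Fin M'.N} (h₂ : M₂.Glued d e₂ m₂ M' j₂ k₂) : Iso M M₂ := by
  obtain ⟨g, g1, g2, g3⟩ := h.collapse.exists_equiv h₂.collapse
    (fun C hC x y hx hy hV => h.sameV_bd hC hx hy hV)
  exact ⟨g, g1, g2, fun x => by rw [h₂.root_iff, g3, ← h.root_iff]⟩

/-- The fillings of a gluing are unique. -/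
theorem iso_fill {m₂ : M.InnerFace d → LabelledMap} {j₂ : Fin M.N → Fin M'.N}
    {k₂ : ∀ f, Fin (m₂ f).N → Fin M'.N} (h₂ : M.Glued d e m₂ M' j₂ k₂) (f : M.InnerFace d) :
    Iso (m f) (m₂ f) := by
  have hj : j₂ = j := by
    -- The comparison of the two collapses is an automorphism of the rooted map `M`, hence the
    -- identity.
    obtain ⟨g, g1, g2, g3⟩ := h.collapse.exists_equiv h₂.collapse
      (fun C hC x y hx hy hV => h.sameV_bd hC hx hy hV)
    ext1 x
    rw [← g3, eq_of_fix g1 g2 (fun r hr => ?_) x]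
    exact h₂.j_injective (isRoot_unique (by rw [g3]; exact h.root r hr) (h₂.root r hr))
  subst hj
  -- Both are maximal cells containing the image of `e f`.
  have hin : h.inside f = h₂.inside f := by
    have m1 : h.inside f ∈ M'.maxCells d := h.maxCells_eq ▸ ⟨f, rfl⟩
    have m2 : h₂.inside f ∈ M'.maxCells d := h₂.maxCells_eq ▸ ⟨f, rfl⟩
    exact maxCells_disj h.girthGe _ m1 _ m2 (j₂ (e f)) (h.j_mem_inside.2 (h.face_e f))
      (h₂.j_mem_inside.2 (h.face_e f))
  have c1 := h.isCollapse_k f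
  have c2 := h₂.isCollapse_k f
  rw [← hin] at c2
  have m1 : h.inside f ∈ M'.maxCells d := h.maxCells_eq ▸ ⟨f, rfl⟩
  obtain ⟨g, g1, g2, g3⟩ := c1.exists_equiv c2 (by
    rintro _ rfl x y hx hy hV
    exact h.girthGe.origin_inj M'.α_involutive M'.isConn M'.isExact m1.1.1.region.compl
      (by rw [card_bd_compl M'.α_involutive, m1.1.2]) hx hy hV)
  refine ⟨g, g1, g2, ?_⟩
  obtain ⟨r, hr⟩ := (h.fill f).exists_root
  obtain ⟨r₂, hr₂⟩ := (h₂.fill f).exists_root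
  have hrr : g r = r₂ := by
    apply h₂.k_injective f
    rw [g3]
    have a1 := h.matching f r hr 0
    have a2 := h₂.matching f r₂ hr₂ 0
    simp only [pow_zero, Equiv.Perm.one_apply] at a1 a2
    rw [a1, a2]
  intro x
  constructor
  · intro hx
    rwa [g.injective ((isRoot_unique hx hr₂).trans hrr.symm)]
  · intro hx
    rw [isRoot_unique hx hr, hrr]
    exact hr₂

theorem nonempty_left (y : Fin M'.N) : Nonempty (Fin M.N) := by
  obtain ⟨⟨x, -⟩ | ⟨f, -⟩, -⟩ := h.bij.2 y
  · exact ⟨x⟩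
  · exact ⟨e f⟩

/-- The result of a gluing is unique. -/
theorem iso_right {M'' : LabelledMap} {j₂ : Fin M.N → Fin M''.N}
    {k₂ : ∀ f, Fin (m f).N → Fin M''.N} (h₂ : M.Glued d e m M'' j₂ k₂) : Iso M' M'' := by
  let E := Equiv.ofBijective _ h.bij
  let E₂ := Equiv.ofBijective _ h₂.bij
  -- By `bij` the darts of both results are identified with the same disjoint union.
  let F := E.symm.trans E₂
  have Fj0 : ∀ x, (¬ ∃ f : M.InnerFace d, f.1 = M.faceOf x) → F (j x) = j₂ x := by
    intro x hx
    have : E.symm (j x) = Sum.inl ⟨x, hx⟩ := by rw [Equiv.symm_apply_eq]; rfl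
    change E₂ (E.symm (j x)) = _
    rw [this]; rfl
  have Fk0 : ∀ f z, ¬ (m f).IsOuter ((m f).faceOf z) → F (k f z) = k₂ f z := by
    intro f z hz
    have : E.symm (k f z) = Sum.inr ⟨f, z, hz⟩ := by rw [Equiv.symm_apply_eq]; rfl
    change E₂ (E.symm (k f z)) = _
    rw [this]; rfl
  have Fj : ∀ x, F (j x) = j₂ x := by
    intro x
    by_cases hx : ∃ f : M.InnerFace d, f.1 = M.faceOf x
    · obtain ⟨f, hf⟩ := hx
      obtain ⟨r, hr, i, hi, h1, h2⟩ := h.exists_outer f hf.symm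
      rw [h1, Fk0 _ _ h2, h₂.k_α, h₂.matching f r hr, hi, h₂.j_α, M''.α_involutive]
    · exact Fj0 x hx
  have Fk : ∀ f z, F (k f z) = k₂ f z := by
    intro f z
    by_cases hz : (m f).IsOuter ((m f).faceOf z)
    · obtain ⟨r, hr⟩ := (h.fill f).exists_root
      obtain ⟨i, rfl⟩ := ((h.fill f).outer_iff hr).1 hz
      rw [h.matching f r hr, h₂.matching f r hr, Fj]
    · exact Fk0 f z hz
  refine ⟨F, fun y => ?_, fun y => ?_, fun y => ?_⟩
  · obtain ⟨⟨x, hx⟩ | ⟨f, z, hz⟩, rfl⟩ := h.bij.2 y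
    · change F (M'.α (j x)) = M''.α (F (j x))
      rw [← h.j_α, Fj, Fj, h₂.j_α]
    · change F (M'.α (k f z)) = M''.α (F (k f z))
      rw [← h.k_α, Fk, Fk, h₂.k_α]
  · obtain ⟨⟨x, hx⟩ | ⟨f, z, hz⟩, rfl⟩ := h.bij.2 y
    · change F (M'.φ (j x)) = M''.φ (F (j x))
      rw [← h.j_φ x hx, Fj, Fj, h₂.j_φ x hx]
    · change F (M'.φ (k f z)) = M''.φ (F (k f z))
      rw [← h.k_φ f z hz, Fk, Fk, h₂.k_φ f z hz]
  · obtain ⟨x⟩ := h.nonempty_left y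
    obtain ⟨r, hr⟩ := exists_isRoot x
    constructor
    · intro hy
      rw [F.injective ((isRoot_unique hy (h₂.root r hr)).trans (Fj r).symm)]
      exact h.root r hr
    · intro hy
      rw [isRoot_unique hy (h.root r hr), Fj]
      exact h₂.root r hr

end

end Glued

end LabelledMap

/-! ### Existence of gluings -/

namespace LabelledMap

open CombMap Equiv.Perm

theorem sum_eq_zero_of_faces {M : LabelledMap} {a w : Fin M.N → ZMod 2}
    (ha : ∀ x, a (M.φ x) = a x) (hw : ∀ F : M.Face, ∑ x ∈ M.faceDarts F, w x = 0) :
    ∑ x, a x * w x = 0 := by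
  classical
  have : Fintype M.Face := Fintype.ofFinite _
  rw [← Finset.sum_fiberwise (Finset.univ) M.faceOf]
  refine Finset.sum_eq_zero fun F _ => ?_
  obtain ⟨y, rfl⟩ := exists_faceOf F
  have e1 : ∀ x ∈ Finset.univ.filter (fun x => M.faceOf x = M.faceOf y), a x * w x = a y * w x :=
    fun x hx => by rw [eq_of_sameCycle ha (faceOf_eq.1 (Finset.mem_filter.1 hx).2)]
  rw [Finset.sum_congr rfl e1, ← Finset.mul_sum]
  have e2 : Finset.univ.filter (fun x => M.faceOf x = M.faceOf y) = M.faceDarts (M.faceOf y) := by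
    ext x; simp [mem_faceDarts]
  rw [e2, hw, mul_zero]

/-- Exactness in dual form. Vertex potentials are convenient for gluing: those of two pieces only
have to agree along the common boundary. -/
theorem exists_vertex_potential {M : LabelledMap} {w : Fin M.N → ZMod 2}
    (hα : ∀ x, w (M.α x) = w x) (hw : ∀ F : M.Face, ∑ x ∈ M.faceDarts F, w x = 0) :
    ∃ a : Fin M.N → ZMod 2, (∀ x, a (M.φ x) = a (M.α x)) ∧ ∀ x, w x = a x + a (M.α x) := by
  by_cases hN : Nonempty (Fin M.N)
  · obtain ⟨a, h1, h2⟩ := (isExact_dual M.α_involutive M.α_ne M.isConn).2 M.isExact w hα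
      (fun a ha => sum_eq_zero_of_faces (fun x => by
        have := ha x
        rwa [Equiv.Perm.mul_apply, M.α_involutive] at this) hw)
    refine ⟨a, fun x => ?_, h2⟩
    have := h1 (M.α x)
    rwa [Equiv.Perm.mul_apply, M.α_involutive] at this
  · rw [not_nonempty_iff] at hN
    exact ⟨w, fun x => isEmptyElim x, fun x => isEmptyElim x⟩

theorem sum_faceDarts_eq {M : LabelledMap} {β : Type*} [AddCommMonoid β] (x : Fin M.N)
    (g : Fin M.N → β) : ∑ y ∈ M.faceDarts (M.faceOf x), g y =
      ∑ i ∈ Finset.range (M.degree (M.faceOf x)), g ((M.φ ^ i) x) := by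
  symm
  rw [degree_faceOf]
  refine Finset.sum_bij (fun i _ => (M.φ ^ i) x) ?_ ?_ ?_ (fun _ _ => rfl)
  · intro k _
    rw [mem_faceDarts, eq_comm, faceOf_eq]
    exact ⟨k, rfl⟩
  · intro k hk l hl e
    have := (pow_eq_pow_iff rfl).1 e
    rw [Nat.ModEq, Nat.mod_eq_of_lt (Finset.mem_range.1 hk),
      Nat.mod_eq_of_lt (Finset.mem_range.1 hl)] at this
    exact this
  · intro y hy
    rw [mem_faceDarts, eq_comm, faceOf_eq, sameCycle_iff_iterate] at hy
    obtain ⟨k, hk, e⟩ := hy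
    exact ⟨k, by simpa using hk, by rw [← Equiv.Perm.iterate_eq_pow, e]⟩

theorem sum_faceDarts_eq_inv {M : LabelledMap} {β : Type*} [AddCommMonoid β] (x : Fin M.N)
    (g : Fin M.N → β) : ∑ y ∈ M.faceDarts (M.faceOf x), g y =
      ∑ i ∈ Finset.range (M.degree (M.faceOf x)), g ((M.φ⁻¹ ^ i) x) := by
  symm
  rw [degree_faceOf]
  have hmem : ∀ i : ℕ, (M.φ⁻¹ ^ i) x ∈ M.faceDarts (M.faceOf x) := by
    intro i
    rw [mem_faceDarts, eq_comm, faceOf_eq, ← sameCycle_inv]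
    exact ⟨i, rfl⟩
  have hinj : ∀ k ∈ Finset.range (Function.minimalPeriod M.φ x),
      ∀ l ∈ Finset.range (Function.minimalPeriod M.φ x),
      (M.φ⁻¹ ^ k) x = (M.φ⁻¹ ^ l) x → k = l := by
    intro k hk l hl e
    have := (inv_pow_eq_inv_pow_iff rfl).1 e
    rw [Nat.ModEq, Nat.mod_eq_of_lt (Finset.mem_range.1 hk),
      Nat.mod_eq_of_lt (Finset.mem_range.1 hl)] at this
    exact this
  refine Finset.sum_bij (fun i _ => (M.φ⁻¹ ^ i) x) (fun i _ => hmem i) hinj ?_ (fun _ _ => rfl)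
  intro y hy
  obtain ⟨k, hk, e⟩ := Finset.surj_on_of_inj_on_of_card_le (fun i _ => (M.φ⁻¹ ^ i) x)
    (fun i _ => hmem i) (fun k l hk hl e => hinj k hk l hl e)
    (by rw [card_faceDarts, degree_faceOf, Finset.card_range]) y hy
  exact ⟨k, hk, e.symm⟩

/-- The darts of a gluing. -/
abbrev GlueDart (M : LabelledMap) (d : ℕ) (m : M.InnerFace d → LabelledMap) : Type :=
  {x // ¬ ∃ f : M.InnerFace d, f.1 = M.faceOf x} ⊕
    (Σ f, {x // ¬ (m f).IsOuter ((m f).faceOf x)})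

instance (M : LabelledMap) (d : ℕ) : Finite (M.InnerFace d) := by
  unfold InnerFace; infer_instance

section Construct

variable {M : LabelledMap} {d : ℕ} {e : M.InnerFace d → Fin M.N}
  {m : M.InnerFace d → LabelledMap}

/-- The identification of the darts along the boundaries of the fillings. -/
theorem exists_glueDart_maps (hM : M.IsIrreducible d) (he : ∀ f, M.faceOf (e f) = f.1)
    (hm : ∀ f, (m f).IsFilling d) :
    ∃ (J : Fin M.N → GlueDart M d m) (K : ∀ f, Fin (m f).N → GlueDart M d m),
      (∀ x hx, J x = Sum.inl ⟨x, hx⟩) ∧ (∀ f z hz, K f z = Sum.inr ⟨f, z, hz⟩) ∧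
      (∀ f r, (m f).IsRoot r → ∀ i : ℕ, K f (((m f).φ ^ i) r) = J (M.α ((M.φ⁻¹ ^ i) (e f)))) ∧
      (∀ f r, (m f).IsRoot r → ∀ i : ℕ,
        J ((M.φ⁻¹ ^ i) (e f)) = K f ((m f).α (((m f).φ ^ i) r))) := by
  classical
  choose r hr using fun f => (hm f).exists_root
  have hg := (isIrreducible_iff.1 hM).1
  have hon : ∀ x, (∃ f : M.InnerFace d, f.1 = M.faceOf x) →
      ∃ f, ∃ i : ℕ, (M.φ⁻¹ ^ i) (e f) = x := by
    rintro x ⟨f, hf⟩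
    rw [← he f, faceOf_eq, ← sameCycle_inv] at hf
    obtain ⟨n, -, -, hn⟩ := hf.exists_pow_eq M.φ⁻¹
    exact ⟨f, n, hn⟩
  have hface : ∀ f (i : ℕ), M.faceOf ((M.φ⁻¹ ^ i) (e f)) = f.1 := by
    intro f i
    rw [← he f, eq_comm, faceOf_eq, ← sameCycle_inv]
    exact ⟨i, by rw [zpow_natCast]⟩
  have hper : ∀ f, Function.minimalPeriod M.φ (e f) = d := fun f => by
    rw [← degree_faceOf, he, f.2.2]
  have hin : ∀ f (i : ℕ), ¬ (m f).IsOuter ((m f).faceOf ((m f).α (((m f).φ ^ i) (r f)))) :=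
    fun f i => (hm f).not_outer_α (((hm f).outer_iff (hr f)).2 ⟨i, rfl⟩)
  choose! F I hFI using hon
  -- A dart of a filled face is represented by a dart on an inner face of the filling, opposite to
  -- the outer dart matched with its edge.
  let J : Fin M.N → GlueDart M d m := fun x =>
    if hx : ∃ f : M.InnerFace d, f.1 = M.faceOf x then
      Sum.inr ⟨F x hx, (m (F x hx)).α (((m (F x hx)).φ ^ (I x)) (r (F x hx))), hin _ _⟩
    else Sum.inl ⟨x, hx⟩
  have hJoff : ∀ x hx, J x = Sum.inl ⟨x, hx⟩ := fun x hx => dif_neg hx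
  have hJon : ∀ f (i : ℕ), J ((M.φ⁻¹ ^ i) (e f)) =
      Sum.inr ⟨f, (m f).α (((m f).φ ^ i) (r f)), hin f i⟩ := by
    intro f i
    have hx : ∃ f' : M.InnerFace d, f'.1 = M.faceOf ((M.φ⁻¹ ^ i) (e f)) := ⟨f, (hface f i).symm⟩
    have hJ : J ((M.φ⁻¹ ^ i) (e f)) = _ := dif_pos hx
    rw [hJ]
    have h1 := hFI _ hx
    set f' := F ((M.φ⁻¹ ^ i) (e f)) hx with hf'
    have hff : f' = f := by
      apply Subtype.ext
      rw [← hface f i, ← h1, hface]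
    set i' := I ((M.φ⁻¹ ^ i) (e f)) with hi'
    clear_value f' i'
    subst hff
    rw [inv_pow_eq_inv_pow_iff (hper f')] at h1
    have h2 := (pow_eq_pow_iff ((hm f').minimalPeriod (hr f'))).2 h1
    simp only [h2]
  have hout : ∀ f z, (m f).IsOuter ((m f).faceOf z) → ∃ i : ℕ, ((m f).φ ^ i) (r f) = z :=
    fun f z => ((hm f).outer_iff (hr f)).1
  choose! I' hI' using hout
  -- An outer dart of a filling goes through `J`, as the other side of the matched edge may belong
  -- to another filled face.
  let K : ∀ f, Fin (m f).N → GlueDart M d m := fun f z =>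
    if hz : (m f).IsOuter ((m f).faceOf z) then J (M.α ((M.φ⁻¹ ^ (I' f z)) (e f)))
    else Sum.inr ⟨f, z, hz⟩
  have hKin : ∀ f z hz, K f z = Sum.inr ⟨f, z, hz⟩ := fun f z hz => dif_neg hz
  refine ⟨J, K, hJoff, hKin, ?_, ?_⟩
  · intro f r' hr' i
    obtain rfl := isRoot_unique hr' (hr f)
    have hz : (m f).IsOuter ((m f).faceOf (((m f).φ ^ i) (r f))) :=
      ((hm f).outer_iff (hr f)).2 ⟨i, rfl⟩
    have hK : K f (((m f).φ ^ i) (r f)) = _ := dif_pos hz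
    rw [hK]
    congr 2
    have := hI' f _ hz
    rw [pow_eq_pow_iff ((hm f).minimalPeriod (hr f))] at this
    exact (inv_pow_eq_inv_pow_iff (hper f)).2 this
  · intro f r' hr' i
    obtain rfl := isRoot_unique hr' (hr f)
    rw [hJon, hKin f _ (hin f i)]

/-- Faces are taken from the pieces unchanged, and only the edges are rejoined. Planarity is checked
in dual form, by assembling vertex potentials of the pieces. -/
theorem exists_glued (hM : M.IsIrreducible d) (he : ∀ f, M.faceOf (e f) = f.1)
    (hm : ∀ f, (m f).IsFilling d) : ∃ M' j k, M.Glued d e m M' j k := by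
  classical
  rcases Nat.eq_zero_or_pos M.N with h0 | h0
  · have hE : IsEmpty (Fin M.N) := by rw [h0]; infer_instance
    have hE' : IsEmpty (M.InnerFace d) := ⟨fun f => hE.false (e f)⟩
    refine ⟨M, id, fun f => hE'.elim f, hM, he, hm, fun x h => h, fun _ => rfl,
      fun f => hE'.elim f, fun _ _ => rfl, fun f => hE'.elim f, fun f => hE'.elim f, ?_, ?_⟩
    · rintro (⟨x, -⟩ | ⟨f, -⟩)
      · exact (hE.false x).elim
      · exact (hE'.false f).elim
    · exact fun y => hE.elim y
  obtain ⟨J, K, hJ, hK, hKo, hJo⟩ := exists_glueDart_maps hM he hm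
  choose r hr using fun f => (hm f).exists_root
  have hg := (isIrreducible_iff.1 hM).1
  have hon : ∀ x, (∃ f : M.InnerFace d, f.1 = M.faceOf x) →
      ∃ f, ∃ i : ℕ, (M.φ⁻¹ ^ i) (e f) = x := by
    rintro x ⟨f, hf⟩
    rw [← he f, faceOf_eq, ← sameCycle_inv] at hf
    obtain ⟨n, -, -, hn⟩ := hf.exists_pow_eq M.φ⁻¹
    exact ⟨f, n, hn⟩
  have hface : ∀ f (i : ℕ), M.faceOf ((M.φ⁻¹ ^ i) (e f)) = f.1 := by
    intro f i
    rw [← he f, eq_comm, faceOf_eq, ← sameCycle_inv]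
    exact ⟨i, by rw [zpow_natCast]⟩
  have hin : ∀ f (i : ℕ), ¬ (m f).IsOuter ((m f).faceOf ((m f).α (((m f).φ ^ i) (r f)))) :=
    fun f i => (hm f).not_outer_α (((hm f).outer_iff (hr f)).2 ⟨i, rfl⟩)
  have hout : ∀ f z, (m f).IsOuter ((m f).faceOf z) → ∃ i : ℕ, ((m f).φ ^ i) (r f) = z :=
    fun f z => ((hm f).outer_iff (hr f)).1
  let A : GlueDart M d m → GlueDart M d m :=
    Sum.elim (fun x => J (M.α x.1)) (fun y => K y.1 ((m y.1).α y.2.1))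
  have hAJ : ∀ x, A (J x) = J (M.α x) := by
    intro x
    by_cases hx : ∃ f : M.InnerFace d, f.1 = M.faceOf x
    · obtain ⟨f, i, rfl⟩ := hon x hx
      rw [hJo f _ (hr f), hK f _ (hin f i)]
      change K f ((m f).α ((m f).α _)) = _
      rw [(m f).α_involutive, hKo f _ (hr f)]
    · rw [hJ x hx]; rfl
  have hAK : ∀ f z, A (K f z) = K f ((m f).α z) := by
    intro f z
    by_cases hz : (m f).IsOuter ((m f).faceOf z)
    · obtain ⟨i, rfl⟩ := hout f z hz
      rw [hKo f _ (hr f), hAJ, M.α_involutive, hJo f _ (hr f)]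
    · rw [hK f z hz]; rfl
  have hAA : Function.Involutive A := by
    rintro (⟨x, hx⟩ | ⟨f, z, hz⟩)
    · rw [← hJ x hx, hAJ, hAJ, M.α_involutive]
    · rw [← hK f z hz, hAK, hAK, (m f).α_involutive]
  let α' : Equiv.Perm (GlueDart M d m) := hAA.toPerm A
  have hα'J : ∀ x, α' (J x) = J (M.α x) := hAJ
  have hα'K : ∀ f z, α' (K f z) = K f ((m f).α z) := hAK
  let φ' : Equiv.Perm (GlueDart M d m) :=
    Equiv.sumCongr (M.φ.subtypePerm (fun x => by rw [faceOf_φ]))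
      (Equiv.sigmaCongrRight fun f => (m f).φ.subtypePerm (fun x => by rw [faceOf_φ]))
  have hφJ : ∀ x, (¬ ∃ f : M.InnerFace d, f.1 = M.faceOf x) → φ' (J x) = J (M.φ x) := by
    intro x hx
    rw [hJ x hx, hJ (M.φ x) (by rwa [faceOf_φ])]; rfl
  have hφK : ∀ f z, (¬ (m f).IsOuter ((m f).faceOf z)) → φ' (K f z) = K f ((m f).φ z) := by
    intro f z hz
    rw [hK f z hz, hK f _ (by rwa [faceOf_φ])]; rfl
  have hrec : ∀ p : GlueDart M d m → Prop,
      (∀ x, (¬ ∃ f : M.InnerFace d, f.1 = M.faceOf x) → p (J x)) →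
      (∀ f z, (¬ (m f).IsOuter ((m f).faceOf z)) → p (K f z)) → ∀ y, p y := by
    rintro p h1 h2 (⟨x, hx⟩ | ⟨f, z, hz⟩)
    · exact hJ x hx ▸ h1 x hx
    · exact hK f z hz ▸ h2 f z hz
  have hαα : ∀ y, α' (α' y) = y := hAA
  have hne : ∀ y, α' y ≠ y := by
    refine hrec _ (fun x hx => ?_) (fun f z hz => ?_)
    · rw [hα'J]
      by_cases hx' : ∃ f : M.InnerFace d, f.1 = M.faceOf (M.α x)
      · obtain ⟨f, i, hi⟩ := hon _ hx'
        rw [← hi, hJo f _ (hr f), hK f _ (hin f i), hJ x hx]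
        exact Sum.inr_ne_inl
      · rw [hJ _ hx', hJ x hx]
        intro h
        exact M.α_ne x (congrArg Subtype.val (Sum.inl.inj h))
    · rw [hα'K]
      by_cases hz' : (m f).IsOuter ((m f).faceOf ((m f).α z))
      · obtain ⟨i, hi⟩ := hout f _ hz'
        rw [← hi, hKo f _ (hr f), hK f z hz]
        -- The edge may separate two filled faces; they are distinct, because an edge of `M` cannot
        -- have a face of degree `d` on both sides.
        by_cases hx' : ∃ f' : M.InnerFace d, f'.1 = M.faceOf (M.α ((M.φ⁻¹ ^ i) (e f)))
        · obtain ⟨f', i', hi'⟩ := hon _ hx'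
          rw [← hi', hJo f' _ (hr f'), hK f' _ (hin f' i')]
          intro h
          have hff : f' = f := congrArg Sigma.fst (Sum.inr.inj h)
          subst hff
          have h1 := hface f' i
          rw [← mem_faceDarts, ← bd_faceDarts hg f', mem_bd] at h1
          exact h1.2 (mem_faceDarts.2 (hi' ▸ hface f' i'))
        · rw [hJ _ hx']
          exact Sum.inl_ne_inr
      · rw [hK _ _ hz', hK f z hz]
        intro h
        have := Sum.inr.inj h
        rw [Sigma.mk.injEq] at this
        exact (m f).α_ne z (congrArg Subtype.val (eq_of_heq this.2))
  have : Fintype (M.InnerFace d) := Fintype.ofFinite _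
  have hconn : IsConn α' φ' := by
    intro p h1 h2 y y' hy
    have q1 : ∀ y, p (α' y) = p y := fun y =>
      propext ⟨fun h => by simpa [hαα] using h1 _ h, h1 y⟩
    have q2 : ∀ y, p (φ' y) = p y := fun y => by
      have := IsRegion.iff (φ := φ') (S := Finset.univ.filter p)
        (fun x hx => by simpa using h2 x (by simpa using hx)) y
      simpa using this
    -- On a filling `p` is constant; invariance at the outer darts, where `φ'` does not follow the
    -- filling, comes from `rot_eq`.
    have cK : ∀ f z z', p (K f z) = p (K f z') := by
      intro f
      have ga : ∀ z, p (K f ((m f).α z)) = p (K f z) := fun z => by rw [← hα'K, q1]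
      refine (m f).isConn.eq (h := fun z => p (K f z)) ga (fun z => ?_)
      rw [(hm f).rot_eq (g := fun z => p (K f z)) (fun z hz => ?_) z]
      · exact ga z
      · rw [← hφK f z hz, q2, ga]
    have cJ : ∀ x x', p (J x) = p (J x') := by
      refine M.isConn.eq (h := fun x => p (J x)) (fun x => by rw [← hα'J, q1]) (fun x => ?_)
      by_cases hx : ∃ f : M.InnerFace d, f.1 = M.faceOf x
      · have hx' : ∃ f : M.InnerFace d, f.1 = M.faceOf (M.φ x) := by rwa [faceOf_φ]
        obtain ⟨f, i, hi⟩ := hon _ hx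
        obtain ⟨f', i', hi'⟩ := hon _ hx'
        have hff : f = f' := by
          apply Subtype.ext
          rw [← hface f i, ← hface f' i', hi, hi', faceOf_φ]
        subst hff
        rw [← hi', ← hi, hJo f _ (hr f), hJo f _ (hr f)]
        exact cK f _ _
      · rw [← hφJ x hx, q2]
    have call : ∀ y, p y = p (J ⟨0, h0⟩) := by
      refine hrec _ (fun x _ => cJ _ _) (fun f z _ => ?_)
      rw [cK f z ((m f).α (((m f).φ ^ 0) (r f))), ← hJo f _ (hr f)]
      exact cJ _ _
    rw [call y', ← call y]
    exact hy
  have hroff := not_exists_innerFace_root (M := M) (d := d) (r := ⟨0, h0⟩) rfl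
  have : Nonempty (GlueDart M d m) := ⟨J ⟨0, h0⟩⟩
  have hex : IsExact α' φ' := by
    rw [← isExact_dual hαα hne hconn]
    intro w hw1 hw2
    -- In the dual, orthogonality is tested on functions constant on faces; indicators of faces show
    -- that `w` has zero sum around each face of the gluing.
    have hw2' : ∀ (a : Fin M.N → ZMod 2) (b : ∀ f, Fin (m f).N → ZMod 2),
        (∀ x, a (M.φ x) = a x) → (∀ f z, b f ((m f).φ z) = b f z) →
        ∑ x : {x // ¬ ∃ f : M.InnerFace d, f.1 = M.faceOf x}, a x.1 * w (J x.1) +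
          ∑ f, ∑ z : {x // ¬ (m f).IsOuter ((m f).faceOf x)}, b f z.1 * w (K f z.1) = 0 := by
      intro a b ha hb
      have := hw2 (Sum.elim (fun x => a x.1) (fun y => b y.1 y.2.1)) (by
        intro y
        rw [Equiv.Perm.mul_apply, hαα]
        rcases y with ⟨x, hx⟩ | ⟨f, z, hz⟩
        · exact ha x
        · exact hb f z)
      rw [Fintype.sum_sum_type, Fintype.sum_sigma] at this
      rw [← this]
      congr 1
      · exact Finset.sum_congr rfl fun x _ => by rw [hJ x.1 x.2]; rfl
      · exact Finset.sum_congr rfl fun f _ => Finset.sum_congr rfl fun z _ => by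
          rw [hK f z.1 z.2]; rfl
    have hindic : ∀ (L : LabelledMap) (F : L.Face) (x : Fin L.N),
        (if L.faceOf (L.φ x) = F then (1 : ZMod 2) else 0) = if L.faceOf x = F then 1 else 0 :=
      fun L F x => by rw [faceOf_φ]
    have sub_sum : ∀ (L : LabelledMap) (F : L.Face) (P : Fin L.N → Prop) [DecidablePred P]
        (g : Fin L.N → ZMod 2),
        (∀ x, L.faceOf x = F → P x) →
        ∑ x : {x // P x}, (if L.faceOf x.1 = F then (1 : ZMod 2) else 0) * g x.1 =
          ∑ x ∈ L.faceDarts F, g x := by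
      intro L F P _ g hP
      simp only [ite_mul, one_mul, zero_mul]
      rw [← Finset.sum_subtype (Finset.univ.filter P) (by simp)
        (fun x => if L.faceOf x = F then g x else 0), Finset.sum_filter, faceDarts,
        Finset.sum_filter]
      refine Finset.sum_congr rfl fun x _ => ?_
      by_cases hx : L.faceOf x = F
      · simp [hx, hP x hx]
      · simp [hx]
    have faceK : ∀ f F, ¬ (m f).IsOuter F → ∑ z ∈ (m f).faceDarts F, w (K f z) = 0 := by
      intro f F hF
      have := hw2' 0 (Pi.single f fun z => if (m f).faceOf z = F then 1 else 0) (fun _ => rfl) (by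
        intro f' z
        by_cases hff : f' = f
        · subst hff
          rw [Pi.single_eq_same]
          exact hindic _ _ _
        · rw [Pi.single_eq_of_ne hff]; rfl)
      rw [Finset.sum_eq_zero (fun x _ => by simp), zero_add, Finset.sum_eq_single f] at this
      · simp only [Pi.single_eq_same] at this
        rw [sub_sum (m f) F _ (fun z => w (K f z)) (fun z hz => hz ▸ hF)] at this
        exact this
      · intro f' _ hff
        simp [Pi.single_eq_of_ne hff]
      · exact fun h => absurd (Finset.mem_univ f) h
    have wKα : ∀ f z, w (K f ((m f).α z)) = w (K f z) := fun f z => by rw [← hα'K, hw1]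
    have wJα : ∀ x, w (J (M.α x)) = w (J x) := fun x => by rw [← hα'J, hw1]
    -- The total over all darts of a filling vanishes, hence so does the sum around the one
    -- remaining face, the outer one.
    have faceK' : ∀ f F, ∑ z ∈ (m f).faceDarts F, w (K f z) = 0 := by
      intro f F
      by_cases hF : (m f).IsOuter F
      · have htot := sum_eq_zero_of_invol (m f).α_involutive (m f).α_ne
          (w := fun z => w (K f z)) (wKα f)
        have : Fintype (m f).Face := Fintype.ofFinite _
        rw [← Finset.sum_fiberwise Finset.univ (m f).faceOf, Finset.sum_eq_single F] at htot
        · rw [← htot, faceDarts]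
        · intro F' _ hF'
          have := faceK f F' (fun h => hF' (by
            rw [isOuter_iff (hr f)] at h hF
            rw [← h, hF]))
          rw [faceDarts] at this
          exact this
        · exact fun h => absurd (Finset.mem_univ F) h
      · exact faceK f F hF
    -- Through the matching, a filled face has the same sum as the outer face of its filling.
    have faceJ : ∀ F, ∑ x ∈ M.faceDarts F, w (J x) = 0 := by
      intro F
      by_cases hF : ∃ f : M.InnerFace d, f.1 = F
      · obtain ⟨f, rfl⟩ := hF
        have h1 := faceK' f ((m f).faceOf (r f))
        rw [sum_faceDarts_eq, degree_faceOf, (hm f).minimalPeriod (hr f)] at h1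
        rw [← he f, sum_faceDarts_eq_inv, he f, f.2.2, ← h1]
        refine Finset.sum_congr rfl fun i _ => ?_
        rw [hKo f _ (hr f), wJα]
      · have := hw2' (fun x => if M.faceOf x = F then 1 else 0) 0 (hindic M F) (fun _ _ => rfl)
        rw [sub_sum M F _ (fun x => w (J x)) (fun x hx => hx ▸ hF)] at this
        simpa using this
    obtain ⟨a, ha1, ha2⟩ := exists_vertex_potential wJα faceJ
    choose b hb1 hb2 using fun f => exists_vertex_potential (wKα f) (faceK' f)
    -- The constant makes the two potentials agree at `e f`. Both have increments given by `w`, so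
    -- `hmatch` carries the agreement around the boundary.
    let b' : ∀ f, Fin (m f).N → ZMod 2 := fun f z => b f z + (b f ((m f).α (r f)) + a (e f))
    have hb1' : ∀ f z, b' f ((m f).φ z) = b' f ((m f).α z) := fun f z => by simp only [b', hb1]
    have hb2' : ∀ f z, w (K f z) = b' f z + b' f ((m f).α z) := fun f z => by
      rw [hb2]; simp only [b']
      linear_combination -(b f ((m f).α (r f)) + a (e f)) * (CharTwo.two_eq_zero (R := ZMod 2))
    have hsolve : ∀ x y z : ZMod 2, x = y + z → y = z + x := by decide
    have hmatch : ∀ f (i : ℕ),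
        b' f ((m f).α (((m f).φ ^ i) (r f))) = a ((M.φ⁻¹ ^ i) (e f)) := by
      intro f i
      induction i with
      | zero =>
        simp only [b', pow_zero, Equiv.Perm.one_apply]
        linear_combination (b f ((m f).α (r f))) * (CharTwo.two_eq_zero (R := ZMod 2))
      | succ i ih =>
        have h1 := hsolve _ _ _ (ha2 ((M.φ⁻¹ ^ (i + 1)) (e f)))
        have hφ : M.φ ((M.φ⁻¹ ^ (i + 1)) (e f)) = (M.φ⁻¹ ^ i) (e f) := by
          rw [pow_succ', Equiv.Perm.mul_apply]; simp
        rw [← ha1, hφ, ← ih] at h1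
        have h2 := hsolve _ _ _ ((hb2' f (((m f).φ ^ (i + 1)) (r f))).trans (add_comm _ _))
        rw [hKo f _ (hr f), wJα] at h2
        rw [h1, h2]
        congr 1
        rw [pow_succ', Equiv.Perm.mul_apply, hb1']
    let A' : GlueDart M d m → ZMod 2 := Sum.elim (fun x => a x.1) (fun y => b' y.1 y.2.1)
    have A'J : ∀ x, A' (J x) = a x := by
      intro x
      by_cases hx : ∃ f : M.InnerFace d, f.1 = M.faceOf x
      · obtain ⟨f, i, rfl⟩ := hon x hx
        rw [hJo f _ (hr f), hK f _ (hin f i)]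
        exact hmatch f i
      · rw [hJ x hx]; rfl
    have A'K : ∀ f z, A' (K f z) = b' f z := by
      intro f z
      by_cases hz : (m f).IsOuter ((m f).faceOf z)
      · obtain ⟨i, rfl⟩ := hout f z hz
        rw [hKo f _ (hr f), A'J]
        have h1 := ha2 ((M.φ⁻¹ ^ i) (e f))
        rw [add_comm] at h1
        rw [hsolve _ _ _ h1, hsolve _ _ _ (hb2' f (((m f).φ ^ i) (r f))), hmatch, hKo f _ (hr f),
          wJα]
      · rw [hK f z hz]; rfl
    have key : ∀ y, A' (φ' y) = A' (α' y) := by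
      refine hrec _ (fun x hx => ?_) (fun f z hz => ?_)
      · rw [hφJ x hx, hα'J, A'J, A'J, ha1]
      · rw [hφK f z hz, hα'K, A'K, A'K, hb1']
    refine ⟨A', fun y => ?_, ?_⟩
    · rw [Equiv.Perm.mul_apply, key, hαα]
    · refine hrec _ (fun x hx => ?_) (fun f z hz => ?_)
      · rw [hα'J, A'J, A'J, ha2]
      · rw [hα'K, A'K, A'K, hb2']
  obtain ⟨M', E, E1, E2, E3⟩ := exists_ofType α' φ' (J ⟨0, h0⟩) hαα hne hconn hex
  refine ⟨M', fun x => E (J x), fun f z => E (K f z), hM, he, hm, ?_, ?_, ?_, ?_, ?_, ?_, ?_⟩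
  · intro x hx
    rw [E3, isRoot_unique hx (r' := ⟨0, h0⟩) rfl]
  · intro x; rw [← hα'J, E1]
  · intro f x; rw [← hα'K, E1]
  · intro x hx; rw [← hφJ x hx, E2]
  · intro f x hx; rw [← hφK f x hx, E2]
  · intro f r' hr' i
    rw [hKo f r' hr']
  · convert E.bijective using 1
    ext1 y
    rcases y with ⟨x, hx⟩ | ⟨f, z, hz⟩
    · exact congrArg E (hJ x hx)
    · exact congrArg E (hK f z hz)

end Construct

end LabelledMap

/-! ### The gluing bijection -/

namespace LabelledMap

open CombMap Equiv.Perm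

theorem Glued.comp_iso {M : LabelledMap} {d : ℕ} {e : M.InnerFace d → Fin M.N}
    {m : M.InnerFace d → LabelledMap} {M' M'' : LabelledMap} {j : Fin M.N → Fin M'.N}
    {k : ∀ f, Fin (m f).N → Fin M'.N} (h : M.Glued d e m M' j k) (g : Fin M'.N ≃ Fin M''.N)
    (g1 : ∀ x, g (M'.α x) = M''.α (g x)) (g2 : ∀ x, g (M'.φ x) = M''.φ (g x))
    (g3 : ∀ x, M''.IsRoot (g x) ↔ M'.IsRoot x) :
    M.Glued d e m M'' (fun x => g (j x)) (fun f z => g (k f z)) := by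
  refine ⟨h.irr, h.face_e, h.fill, fun x hx => (g3 _).2 (h.root x hx), fun x => ?_,
    fun f z => ?_, fun x hx => ?_, fun f z hz => ?_, fun f r hr i => ?_, ?_⟩
  · rw [h.j_α, g1]
  · rw [h.k_α, g1]
  · rw [h.j_φ x hx, g2]
  · rw [h.k_φ f z hz, g2]
  · rw [h.matching f r hr]
  · convert g.bijective.comp h.bij using 1
    ext1 y
    rcases y with y | y <;> rfl

theorem Glued.isGluing {M : LabelledMap} {d : ℕ} {e : M.InnerFace d → Fin M.N}
    {m : M.InnerFace d → LabelledMap} {M' : LabelledMap} {j : Fin M.N → Fin M'.N}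
    {k : ∀ f, Fin (m f).N → Fin M'.N} (h : M.Glued d e m M' j k) : M.IsGluing d e m M' :=
  ⟨j, k, h.root, h.j_α, h.k_α, h.j_φ, h.k_φ, h.matching, h.bij⟩

theorem IsGluing.exists_glued {M : LabelledMap} {d : ℕ} {e : M.InnerFace d → Fin M.N}
    {m : M.InnerFace d → LabelledMap} {M' : LabelledMap} (h : M.IsGluing d e m M')
    (hM : M.IsIrreducible d) (he : ∀ f, M.faceOf (e f) = f.1) (hm : ∀ f, (m f).IsFilling d) :
    ∃ j k, M.Glued d e m M' j k := by
  obtain ⟨j, k, h1, h2, h3, h4, h5, h6, h7⟩ := h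
  exact ⟨j, k, hM, he, hm, h1, h2, h3, h4, h5, h6, h7⟩

end LabelledMap

theorem RootedMap.rep_mk_iso (L : LabelledMap) : LabelledMap.Iso (RootedMap.rep ⟦L⟧) L :=
  Quotient.mk_out L

theorem RootedMap.eq_of_iso {M M' : RootedMap} (h : LabelledMap.Iso M.rep M'.rep) : M = M' :=
  Quotient.out_equiv_out.1 h

open LabelledMap CombMap

theorem GirthEqMap.isFilling {d : ℕ} (hd : 1 ≤ d) (m : GirthEqMap d) : m.1.rep.IsFilling d :=
  ⟨hd, m.2.1, m.2.2⟩

section Bijection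

variable {d n : ℕ}

/-- The gluing relation, for a choice of distinguished edges. -/
def GluesTo (e : EdgeSelection d n) (P : FilledMap d n) (M' : RootedMap) : Prop :=
  P.1.1.rep.IsGluing d (fun f => (e P.1 f).1) (fun f => (P.2 f).1.rep) M'.rep

theorem GluesTo.exists_glued (hd : 1 ≤ d) {e : EdgeSelection d n} {P : FilledMap d n}
    {M' : RootedMap} (h : GluesTo e P M') :
    ∃ j k, P.1.1.rep.Glued d (fun f => (e P.1 f).1) (fun f => (P.2 f).1.rep) M'.rep j k :=
  IsGluing.exists_glued h P.1.2.2 (fun f => (e P.1 f).2) (fun f => (P.2 f).isFilling hd)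

theorem exists_gluesTo (hd : 1 ≤ d) (e : EdgeSelection d n) (P : FilledMap d n) :
    ∃ M' : GirthGeMap d n, GluesTo e P M'.1 := by
  obtain ⟨M', j, k, h⟩ := LabelledMap.exists_glued (e := fun f => (e P.1 f).1)
    (m := fun f => (P.2 f).1.rep) P.1.2.2 (fun f => (e P.1 f).2) (fun f => (P.2 f).isFilling hd)
  obtain ⟨g, g1, g2, g3⟩ := isoSetoid.iseqv.symm (RootedMap.rep_mk_iso M')
  have h' := h.comp_iso g g1 g2 g3
  exact ⟨⟨⟦M'⟧, by rw [h'.outerDegree_eq, P.1.2.1], natCast_le_girth.2 h'.girthGe⟩, h'.isGluing⟩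

theorem GluesTo.right_unique (hd : 1 ≤ d) {e : EdgeSelection d n} {P : FilledMap d n}
    {M' M'' : RootedMap} (h : GluesTo e P M') (h' : GluesTo e P M'') : M' = M'' := by
  obtain ⟨j, k, g⟩ := h.exists_glued hd
  obtain ⟨j', k', g'⟩ := h'.exists_glued hd
  exact RootedMap.eq_of_iso (g.iso_right g')

theorem GluesTo.left_unique (hd : 1 ≤ d) {e : EdgeSelection d n} {P P' : FilledMap d n}
    {M' : RootedMap} (h : GluesTo e P M') (h' : GluesTo e P' M') : P = P' := by
  obtain ⟨j, k, g⟩ := h.exists_glued hd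
  obtain ⟨j', k', g'⟩ := h'.exists_glued hd
  obtain ⟨M, m⟩ := P
  obtain ⟨M₂, m₂⟩ := P'
  obtain rfl : M = M₂ := Subtype.ext (RootedMap.eq_of_iso (g.iso_left g'))
  congr 1
  funext f
  exact Subtype.ext (RootedMap.eq_of_iso (g.iso_fill g' f))

theorem exists_gluesTo_left (hd : 1 ≤ d) (e : EdgeSelection d n) (M' : GirthGeMap d n) :
    ∃ P : FilledMap d n, GluesTo e P M'.1 := by
  have hg := natCast_le_girth.1 M'.2.2
  obtain ⟨L, ι, hL, hr⟩ := exists_isCollapse_maxCells hg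
  obtain ⟨g, g1, g2, g3⟩ := RootedMap.rep_mk_iso L
  have hL' := hL.comp_iso g g1 g2
  have hr' : ∀ x, (RootedMap.rep ⟦L⟧).IsRoot x ↔ M'.1.rep.IsRoot ((ι ∘ g) x) := fun x => by
    rw [Function.comp_apply, ← hr, g3]
  let N : IrrMap d n := ⟨⟦L⟧, by rw [hL'.outerDegree_eq hr', M'.2.1], hL'.isIrreducible hg hr'⟩
  have hC : ∀ f, ∃ C ∈ M'.1.rep.maxCells d, (ι ∘ g) (e N f).1 ∈ C := fun f =>
    hL'.exists_maxCell hg hr' f (e N f).2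
  choose C hCm hCe using hC
  have hm : ∀ f, ∃ (m : GirthEqMap d) (k : Fin m.1.rep.N → Fin M'.1.rep.N),
      m.1.rep.IsCollapse M'.1.rep {(C f)ᶜ} k ∧
        ∀ x, m.1.rep.IsRoot x ↔ k x = M'.1.rep.α ((ι ∘ g) (e N f).1) := by
    intro f
    have hz : (ι ∘ g) (e N f).1 ∈ bd M'.1.rep.α (C f) :=
      mem_bd.2 ⟨hCe f, hL'.notMem (hCm f) (hCe f)⟩
    obtain ⟨m, k, h1, h2⟩ := exists_isCollapse hg {(C f)ᶜ}
      (by rintro _ rfl; exact (hCm f).1.1.region.compl) (by rintro _ rfl _ rfl _ _ _; rfl)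
      (by rintro _ rfl; rw [card_bd_compl M'.1.rep.α_involutive, (hCm f).1.2])
      (M'.1.rep.α ((ι ∘ g) (e N f).1)) (by
        rintro _ rfl -
        rw [M'.1.rep.α_involutive, Finset.mem_compl, not_not]
        exact hCe f)
    obtain ⟨g', g1', g2', g3'⟩ := RootedMap.rep_mk_iso m
    have h1' := h1.comp_iso g' g1' g2'
    have h2' : ∀ x, (RootedMap.rep ⟦m⟧).IsRoot x ↔
        (k ∘ g') x = M'.1.rep.α ((ι ∘ g) (e N f).1) := fun x => by
      rw [Function.comp_apply, ← h2, g3']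
    have hfill := h1'.isFilling hd hg (hCm f).1.2 hz h2'
    exact ⟨⟨⟦m⟧, hfill.outerDegree, hfill.girth⟩, k ∘ g', h1', h2'⟩
  choose m k hm1 hm2 using hm
  exact ⟨⟨N, m⟩, (hL'.glued hd hg hr' (fun f => (e N f).2) hCm hCe hm1 hm2).isGluing⟩

theorem exists_gluing_equiv (hd : 1 ≤ d) (e : EdgeSelection d n) :
    ∃ Φ : FilledMap d n ≃ GirthGeMap d n, ∀ (P : FilledMap d n) (M' : GirthGeMap d n),
      GluesTo e P M'.1 ↔ Φ P = M' := by
  choose F hF using exists_gluesTo hd e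
  have hbij : Function.Bijective F := by
    constructor
    · intro P P' h
      exact (hF P).left_unique hd (h ▸ hF P')
    · intro M'
      obtain ⟨P, hP⟩ := exists_gluesTo_left hd e M'
      exact ⟨P, Subtype.ext ((hF P).right_unique hd hP)⟩
  refine ⟨Equiv.ofBijective F hbij, fun P M' => ⟨fun h => ?_, ?_⟩⟩
  · exact Subtype.ext ((hF P).right_unique hd h)
  · rintro rfl
    exact hF P

end Bijection

/-! ### Counting inner faces -/

namespace LabelledMap

open Equiv.Perm

/-- The darts of the inner faces of degree `k`. -/
def IsInnerDart (M : LabelledMap) (k : ℕ) (x : Fin M.N) : Prop :=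
  ¬ M.IsOuter (M.faceOf x) ∧ Function.minimalPeriod M.φ x = k

/-- Faces are counted through their darts, because a gluing is described by a bijection on darts. -/
theorem card_isInnerDart (M : LabelledMap) (k : ℕ) :
    Nat.card {x // M.IsInnerDart k x} = Nat.card (M.InnerFace k) * k := by
  classical
  have : Fintype (M.InnerFace k) := Fintype.ofFinite _
  let E : {x // M.IsInnerDart k x} ≃ Σ f : M.InnerFace k, {x // M.faceOf x = f.1} :=
    { toFun := fun x => ⟨⟨M.faceOf x.1, x.2.1, by rw [degree_faceOf, x.2.2]⟩, x.1, rfl⟩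
      invFun := fun y => ⟨y.2.1, by rw [y.2.2]; exact y.1.2.1, by
        rw [← degree_faceOf, y.2.2, y.1.2.2]⟩
      left_inv := fun x => rfl
      right_inv := by
        rintro ⟨⟨f, hf⟩, x, hx⟩
        change M.faceOf x = f at hx
        subst hx
        rfl }
  rw [Nat.card_congr E, Nat.card_sigma, Finset.sum_congr rfl (fun f _ => f.2.2)]
  simp

theorem card_innerFace_zero (M : LabelledMap) : Nat.card (M.InnerFace 0) = 0 := by
  have : IsEmpty (M.InnerFace 0) := by
    refine ⟨fun f => ?_⟩
    have := faceDarts_nonempty f.1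
    rw [← Finset.card_pos, card_faceDarts, f.2.2] at this
    exact lt_irrefl _ this
  exact Nat.card_of_isEmpty

theorem le_of_innerFace {M : LabelledMap} {d k : ℕ} (hg : GirthGe M.α M.φ d)
    (f : M.InnerFace k) : d ≤ k := by
  have h := isInnerRegion_faceDarts f.2.1
  rw [← f.2.2, ← card_faceDarts]
  exact (hg _ h.region h.nonempty h.ne_univ).trans (Finset.card_le_card (bd_subset _ _))

theorem IsCollapse.sameCycle_iff {L M : LabelledMap} {𝒞 : Set (Finset (Fin M.N))}
    {ι : Fin L.N → Fin M.N} (h : L.IsCollapse M 𝒞 ι) {x y : Fin L.N}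
    (hx : ∀ C ∈ 𝒞, ι x ∉ C) : M.φ.SameCycle (ι x) (ι y) ↔ L.φ.SameCycle x y := by
  have key : ∀ n : ℕ, (∀ C ∈ 𝒞, ι ((L.φ ^ n) x) ∉ C) ∧ ι ((L.φ ^ n) x) = (M.φ ^ n) (ι x) := by
    intro n
    induction n with
    | zero => exact ⟨hx, rfl⟩
    | succ n ih =>
      rw [pow_succ', pow_succ', Equiv.Perm.mul_apply, Equiv.Perm.mul_apply, ← ih.2,
        h.map_φ _ ih.1]
      refine ⟨fun C hC => ?_, rfl⟩
      rw [← h.map_φ _ ih.1, h.φ_mem_iff hC]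
      exact ih.1 C hC
  constructor
  · intro hxy
    obtain ⟨n, -, -, hn⟩ := hxy.exists_pow_eq M.φ
    exact ⟨n, h.injective (by rw [zpow_natCast, (key n).2, hn])⟩
  · intro hxy
    obtain ⟨n, -, -, hn⟩ := hxy.exists_pow_eq L.φ
    exact ⟨n, by rw [zpow_natCast, ← (key n).2, hn]⟩

theorem Glued.card_innerFace {M : LabelledMap} {d : ℕ} {e : M.InnerFace d → Fin M.N}
    {m : M.InnerFace d → LabelledMap} {M' : LabelledMap} {j : Fin M.N → Fin M'.N}
    {k : ∀ f, Fin (m f).N → Fin M'.N} (h : M.Glued d e m M' j k) [Fintype (M.InnerFace d)]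
    (i : ℕ) : Nat.card (M'.InnerFace i) =
      (if i = d then 0 else Nat.card (M.InnerFace i)) + ∑ f, Nat.card ((m f).InnerFace i) := by
  classical
  rcases Nat.eq_zero_or_pos i with rfl | hi
  -- Degree zero is set apart because the count of darts is finally divided by `i`.
  · simp [card_innerFace_zero]
  have hoff : ∀ x, (¬ ∃ f : M.InnerFace d, f.1 = M.faceOf x) →
      ∀ C ∈ Set.range h.inside, j x ∉ C := by
    rintro x hx _ ⟨f, rfl⟩ hC
    exact hx ⟨f, (h.j_mem_inside.1 hC).symm⟩
  have hj : ∀ x, (¬ ∃ f : M.InnerFace d, f.1 = M.faceOf x) →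
      (M'.IsInnerDart i (j x) ↔ M.IsInnerDart i x) := by
    intro x hx
    obtain ⟨r, hr⟩ := exists_isRoot x
    unfold IsInnerDart
    rw [h.isCollapse_j.minimalPeriod_eq (hoff x hx), isOuter_iff hr, isOuter_iff (h.root r hr),
      faceOf_eq, faceOf_eq, h.isCollapse_j.sameCycle_iff (hoff r (not_exists_innerFace_root hr))]
  have hk : ∀ f z, ¬ (m f).IsOuter ((m f).faceOf z) →
      (M'.IsInnerDart i (k f z) ↔ (m f).IsInnerDart i z) := by
    intro f z hz
    have hin := h.k_mem_inside.2 hz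
    unfold IsInnerDart
    rw [(h.isCollapse_k f).minimalPeriod_eq (by
      rintro _ rfl
      rwa [Finset.mem_compl, not_not])]
    refine and_congr_left fun _ => iff_of_true ?_ hz
    rintro ⟨r, hr, hrf⟩
    rw [eq_comm, faceOf_eq] at hrf
    exact (h.isInnerRegion_inside f).root r hr
      (mem_of_sameCycle (h.isInnerRegion_inside f).region hrf hin)
  have hcount : ∀ L : LabelledMap, Nat.card (L.InnerFace i) * i =
      ∑ x, if L.IsInnerDart i x then 1 else 0 := by
    intro L
    rw [← card_isInnerDart, ← Finset.card_filter, Nat.card_eq_fintype_card, Fintype.card_subtype]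
  have main : Nat.card (M'.InnerFace i) * i =
      (if i = d then 0 else Nat.card (M.InnerFace i) * i) +
        ∑ f, Nat.card ((m f).InnerFace i) * i := by
    rw [hcount, ← Equiv.sum_comp (Equiv.ofBijective _ h.bij), Fintype.sum_sum_type,
      Fintype.sum_sigma]
    congr 1
    · have e1 : ∀ x : {x // ¬ ∃ f : M.InnerFace d, f.1 = M.faceOf x},
          (if M'.IsInnerDart i ((Equiv.ofBijective _ h.bij) (Sum.inl x)) then 1 else 0) =
          if M.IsInnerDart i x.1 then 1 else 0 := fun x => if_congr (hj x.1 x.2) rfl rfl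
      rw [Finset.sum_congr rfl (fun x _ => e1 x), ← Finset.sum_subtype
        (Finset.univ.filter (fun x => ¬ ∃ f : M.InnerFace d, f.1 = M.faceOf x)) (by simp)
        (fun x => if M.IsInnerDart i x then 1 else 0), Finset.sum_filter]
      by_cases hid : i = d
      · rw [if_pos hid]
        refine Finset.sum_eq_zero fun x _ => ?_
        rw [ite_eq_right_iff]
        intro hx
        rw [if_neg]
        rintro ⟨h1, h2⟩
        exact hx ⟨⟨M.faceOf x, h1, by rw [degree_faceOf, h2, hid]⟩, rfl⟩
      · rw [if_neg hid, hcount]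
        refine Finset.sum_congr rfl fun x _ => ?_
        rw [ite_eq_left_iff, not_not]
        rintro ⟨f, hf⟩
        rw [if_neg]
        rintro ⟨h1, h2⟩
        rw [← degree_faceOf, ← hf, f.2.2] at h2
        exact hid h2.symm
    · refine Finset.sum_congr rfl fun f _ => ?_
      have e1 : ∀ z : {z // ¬ (m f).IsOuter ((m f).faceOf z)},
          (if M'.IsInnerDart i ((Equiv.ofBijective _ h.bij) (Sum.inr ⟨f, z⟩)) then 1 else 0) =
          if (m f).IsInnerDart i z.1 then 1 else 0 := fun z => if_congr (hk f z.1 z.2) rfl rfl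
      rw [Finset.sum_congr rfl (fun z _ => e1 z), ← Finset.sum_subtype
        (Finset.univ.filter (fun z => ¬ (m f).IsOuter ((m f).faceOf z))) (by simp)
        (fun z => if (m f).IsInnerDart i z then 1 else 0), Finset.sum_filter, hcount]
      refine Finset.sum_congr rfl fun z _ => ?_
      rw [ite_eq_left_iff, not_not]
      intro hz
      rw [if_neg]
      exact fun h' => h'.1 hz
  apply Nat.eq_of_mul_eq_mul_right hi
  rw [main, add_mul, Finset.sum_mul, ite_mul, zero_mul]

/-- The number of darts in terms of the degrees. -/
theorem card_darts (M : LabelledMap) :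
    M.N = M.outerDegree + ∑ k ∈ Finset.range (M.N + 1), Nat.card (M.InnerFace k) * k := by
  classical
  have h1 : M.N = Nat.card {x // M.IsOuter (M.faceOf x)} +
      Nat.card {x // ¬ M.IsOuter (M.faceOf x)} := by
    rw [Nat.card_eq_fintype_card, Nat.card_eq_fintype_card, Fintype.card_subtype_compl,
      Fintype.card_fin, Nat.add_sub_cancel']
    exact (Fintype.card_subtype_le _).trans (by simp)
  conv_lhs => rw [h1]
  rw [outerDegree]
  congr 1
  rw [Nat.card_eq_fintype_card, Fintype.card_subtype, Finset.card_eq_sum_card_fiberwise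
    (f := fun x => Function.minimalPeriod M.φ x) (t := Finset.range (M.N + 1))]
  · refine Finset.sum_congr rfl fun k _ => ?_
    rw [← card_isInnerDart, Nat.card_eq_fintype_card, Fintype.card_subtype, Finset.filter_filter]
    refine congrArg Finset.card (Finset.ext fun x => ?_)
    rw [Finset.mem_filter, Finset.mem_filter]
    rfl
  · intro x _
    simp only [Finset.coe_range, Set.mem_Iio]
    rw [← degree_faceOf, ← card_faceDarts]
    have := Finset.card_le_univ (M.faceDarts (M.faceOf x))
    rw [Fintype.card_fin] at this
    omega

end LabelledMap

/-! ### Generating functions of weighted families -/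

section GenFun

variable {T U : Type*}

/-- The generating function of a family of objects, `x ^ wt t` marking the object `t`. -/
noncomputable def genFun (wt : T → ℕ →₀ ℕ) : MvPowerSeries ℕ ℤ :=
  fun μ => (Nat.card {t // wt t = μ} : ℤ)

theorem coeff_genFun (wt : T → ℕ →₀ ℕ) (μ : ℕ →₀ ℕ) :
    coeff μ (genFun wt) = (Nat.card {t // wt t = μ} : ℤ) := rfl

theorem genFun_congr (e : T ≃ U) {wt : T → ℕ →₀ ℕ} {wt' : U → ℕ →₀ ℕ}
    (h : ∀ t, wt' (e t) = wt t) : genFun wt = genFun wt' := by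
  ext μ
  rw [coeff_genFun, coeff_genFun]
  exact_mod_cast Nat.card_congr (e.subtypeEquiv fun t => by rw [h])

theorem genFun_unique [Unique T] (wt : T → ℕ →₀ ℕ) :
    genFun wt = monomial (wt default) 1 := by
  classical
  ext μ
  rw [coeff_genFun, coeff_monomial]
  split_ifs with h
  · have : Unique {t // wt t = μ} :=
      ⟨⟨⟨default, h.symm⟩⟩, fun t => Subtype.ext (Subsingleton.elim _ _)⟩
    simp
  · have : IsEmpty {t // wt t = μ} :=
      ⟨fun t => h (by rw [← t.2, Subsingleton.elim t.1 default])⟩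
    simp

theorem genFun_sum {wt : T → ℕ →₀ ℕ} {wt' : U → ℕ →₀ ℕ} (h : ∀ μ, Finite {t // wt t = μ})
    (h' : ∀ μ, Finite {t // wt' t = μ}) :
    genFun (Sum.elim wt wt') = genFun wt + genFun wt' := by
  ext μ
  have h1 : Finite {t // Sum.elim wt wt' (Sum.inl t) = μ} := h μ
  have h2 : Finite {t // Sum.elim wt wt' (Sum.inr t) = μ} := h' μ
  rw [map_add, coeff_genFun, coeff_genFun, coeff_genFun, Nat.card_congr Equiv.subtypeSum,
    Nat.card_sum]
  push_cast
  rfl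

theorem finite_fiber_add {wt : T → ℕ →₀ ℕ} {wt' : U → ℕ →₀ ℕ} (h : ∀ μ, Finite {t // wt t = μ})
    (h' : ∀ μ, Finite {t // wt' t = μ}) (μ : ℕ →₀ ℕ) :
    Finite {p : T × U // wt p.1 + wt' p.2 = μ} := by
  classical
  refine Finite.of_injective (β := Σ p : Finset.HasAntidiagonal.antidiagonal μ,
    {t // wt t = p.1.1} × {t // wt' t = p.1.2})
    (fun p => ⟨⟨(wt p.1.1, wt' p.1.2), Finset.HasAntidiagonal.mem_antidiagonal.2 p.2⟩, ⟨p.1.1, rfl⟩,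
      ⟨p.1.2, rfl⟩⟩) ?_
  rintro ⟨⟨a, b⟩, hp⟩ ⟨⟨a', b'⟩, hp'⟩ hh
  have h1 := congrArg (fun q : Σ p : Finset.HasAntidiagonal.antidiagonal μ,
    {t // wt t = p.1.1} × {t // wt' t = p.1.2} => (q.2.1.1, q.2.2.1)) hh
  exact Subtype.ext h1

theorem genFun_prod {wt : T → ℕ →₀ ℕ} {wt' : U → ℕ →₀ ℕ} (h : ∀ μ, Finite {t // wt t = μ})
    (h' : ∀ μ, Finite {t // wt' t = μ}) :
    genFun (fun p : T × U => wt p.1 + wt' p.2) = genFun wt * genFun wt' := by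
  classical
  ext μ
  rw [coeff_mul, coeff_genFun]
  let E : {p : T × U // wt p.1 + wt' p.2 = μ} ≃ Σ p : Finset.HasAntidiagonal.antidiagonal μ,
      {t // wt t = p.1.1} × {t // wt' t = p.1.2} :=
    { toFun := fun p => ⟨⟨(wt p.1.1, wt' p.1.2), Finset.HasAntidiagonal.mem_antidiagonal.2 p.2⟩, ⟨p.1.1, rfl⟩,
        ⟨p.1.2, rfl⟩⟩
      invFun := fun q => ⟨(q.2.1.1, q.2.2.1), by
        rw [q.2.1.2, q.2.2.2]; exact Finset.HasAntidiagonal.mem_antidiagonal.1 q.1.2⟩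
      left_inv := fun p => rfl
      right_inv := by
        rintro ⟨⟨⟨a, b⟩, hp⟩, ⟨t, ht⟩, ⟨u, hu⟩⟩
        dsimp only at ht hu
        subst ht hu
        rfl }
  rw [Nat.card_congr E, Nat.card_sigma]
  push_cast
  rw [← Finset.sum_coe_sort (Finset.HasAntidiagonal.antidiagonal μ)]
  refine Finset.sum_congr rfl fun p _ => ?_
  rw [Nat.card_prod, coeff_genFun, coeff_genFun]
  push_cast
  rfl

theorem genFun_pi_fin {wt : T → ℕ →₀ ℕ} (h : ∀ μ, Finite {t // wt t = μ}) (k : ℕ) :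
    (∀ μ, Finite {m : Fin k → T // ∑ i, wt (m i) = μ}) ∧
      genFun (fun m : Fin k → T => ∑ i, wt (m i)) = genFun wt ^ k := by
  induction k with
  | zero =>
    refine ⟨fun μ => inferInstance, ?_⟩
    rw [genFun_unique, pow_zero]
    simp [monomial_zero_one]
  | succ k ih =>
    have key : ∀ m : Fin (k + 1) → T,
        wt ((Fin.consEquiv fun _ => T).symm m).1 +
          ∑ i, wt (((Fin.consEquiv fun _ => T).symm m).2 i) = ∑ i, wt (m i) := fun m => by
      rw [Fin.sum_univ_succ]
      rfl
    constructor
    · intro μ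
      have := finite_fiber_add h ih.1 μ
      exact Finite.of_equiv _ (((Fin.consEquiv fun _ => T).symm.subtypeEquiv
        (p := fun m => ∑ i, wt (m i) = μ)
        (q := fun p => wt p.1 + ∑ i, wt (p.2 i) = μ) fun m => by rw [key]).symm)
    · rw [pow_succ', ← ih.2, ← genFun_prod h ih.1]
      exact genFun_congr (wt' := fun p : T × (Fin k → T) => wt p.1 + ∑ i, wt (p.2 i))
        (Fin.consEquiv fun _ => T).symm key

theorem genFun_pi {wt : T → ℕ →₀ ℕ} (h : ∀ μ, Finite {t // wt t = μ}) (ι : Type*) [Fintype ι] :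
    (∀ μ, Finite {m : ι → T // ∑ i, wt (m i) = μ}) ∧
      genFun (fun m : ι → T => ∑ i, wt (m i)) = genFun wt ^ Fintype.card ι := by
  have e := Fintype.equivFin ι
  have key : ∀ m : ι → T, ∑ i, wt ((e.arrowCongr (Equiv.refl T)) m i) = ∑ i, wt (m i) := fun m =>
    Equiv.sum_comp e.symm (fun i => wt (m i))
  obtain ⟨h1, h2⟩ := genFun_pi_fin h (Fintype.card ι)
  constructor
  · intro μ
    have := h1 μ
    exact Finite.of_equiv _ (((e.arrowCongr (Equiv.refl T)).subtypeEquiv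
      (p := fun m => ∑ i, wt (m i) = μ) (q := fun m => ∑ i, wt (m i) = μ)
      fun m => by rw [key]).symm)
  · rw [← h2]
    exact genFun_congr (wt' := fun m : Fin (Fintype.card ι) → T => ∑ i, wt (m i))
      (e.arrowCongr (Equiv.refl T)) key

theorem finsum_card_fiber {A : Type*} [Finite A] (g : A → U) :
    ∑ᶠ u, (Nat.card {a // g a = u} : ℤ) = Nat.card A := by
  classical
  have : Fintype A := Fintype.ofFinite A
  rw [finsum_eq_sum_of_support_subset (s := Finset.univ.image g)]
  · rw [Nat.card_eq_fintype_card, ← Finset.card_univ,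
      Finset.card_eq_sum_card_image g Finset.univ]
    push_cast
    refine Finset.sum_congr rfl fun u _ => ?_
    rw [Nat.card_eq_fintype_card, Fintype.card_subtype]
  · intro u hu
    rw [Function.mem_support, Nat.cast_ne_zero] at hu
    obtain ⟨a⟩ := (Nat.card_ne_zero.1 hu).1
    simpa using ⟨a.1, a.2⟩

/-- Substituting `z` for `x_d`, when the smaller variables do not occur. -/
theorem prod_weights {d : ℕ} {z : MvPowerSeries ℕ ℤ} {μ : ℕ →₀ ℕ} (hμ : ∀ i < d, μ i = 0) :
    (μ.prod fun s k => weights d z X s ^ k) = monomial (μ.erase d) 1 * z ^ μ d := by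
  rw [← Finsupp.mul_prod_erase' μ d _ (fun i => pow_zero _), mul_comm, monomial_one_eq]
  congr 1
  · refine Finset.prod_congr rfl fun i hi => ?_
    rw [Finsupp.support_erase, Finset.mem_erase, Finsupp.mem_support_iff] at hi
    have hid : ¬ i < d := fun hid => hi.2 (hμ i hid)
    simp only [weights, if_neg hid, if_neg hi.1]
  · simp only [weights, if_neg (lt_irrefl d), if_true]

/-- All but finitely many variables are left unchanged, so each monomial occurs in only finitely
many of the substituted series. -/
theorem hasSubst_of_forall_ge {a : ℕ → MvPowerSeries ℕ ℤ} (h : ∀ i, constantCoeff (a i) = 0)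
    (d : ℕ) (ha : ∀ i, d ≤ i → a i = X i) : HasSubst a := by
  refine ⟨fun i => by rw [h]; exact IsNilpotent.zero, fun μ => ?_⟩
  refine ((Finset.range d).finite_toSet.union μ.support.finite_toSet).subset fun i hi => ?_
  by_cases hid : i < d
  · exact Or.inl (by simpa using hid)
  · right
    rw [Set.mem_ofPred_eq, ha i (not_lt.1 hid), coeff_X] at hi
    split_ifs at hi with hμ
    · simp [hμ]
    · exact absurd rfl hi

theorem hasSubst_weights {d : ℕ} {z : MvPowerSeries ℕ ℤ} {x : ℕ → MvPowerSeries ℕ ℤ}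
    (hz : constantCoeff z = 0) (hx : ∀ i, constantCoeff (x i) = 0) (k : ℕ)
    (hk : ∀ i, k ≤ i → x i = X i) : HasSubst (weights d z x) := by
  refine hasSubst_of_forall_ge (fun i => ?_) (max k (d + 1)) fun i hi => ?_
  · rw [weights]
    split_ifs
    · exact map_zero _
    · exact hz
    · exact hx i
  · rw [weights, if_neg, if_neg]
    · exact hk i ((le_max_left _ _).trans hi)
    · have := (le_max_right _ _).trans hi
      omega
    · have := (le_max_right _ _).trans hi
      omega

theorem hasSubst_weights_X {d : ℕ} {z : MvPowerSeries ℕ ℤ} (hz : constantCoeff z = 0) :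
    HasSubst (weights d z X) :=
  hasSubst_weights hz (fun i => constantCoeff_X i) 0 fun _ _ => rfl

theorem constantCoeff_subst_eq {a : ℕ → MvPowerSeries ℕ ℤ} (ha : HasSubst a)
    (h : ∀ i, constantCoeff (a i) = 0) (f : MvPowerSeries ℕ ℤ) :
    constantCoeff (subst a f) = constantCoeff f := by
  rw [constantCoeff_subst ha, finsum_eq_single _ 0]
  · simp
  · intro μ hμ
    obtain ⟨i, hi⟩ := Finsupp.ne_iff.1 hμ
    rw [Finsupp.prod, map_prod, Finset.prod_eq_zero (Finsupp.mem_support_iff.2 hi), smul_zero]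
    rw [map_pow, h, zero_pow hi]

end GenFun

/-! ### The inner degrees of a map -/

namespace LabelledMap

theorem finite_innerDegrees (M : LabelledMap) :
    (Function.support fun k => Nat.card (M.InnerFace k)).Finite := by
  refine (Finset.range (M.N + 1)).finite_toSet.subset fun k hk => ?_
  obtain ⟨f⟩ := (Nat.card_ne_zero.1 hk).1
  have h1 := Finset.card_le_univ (M.faceDarts f.1)
  rw [card_faceDarts, f.2.2, Fintype.card_fin] at h1
  simpa using Nat.lt_succ_of_le h1

/-- The number of inner faces of each degree. -/
noncomputable def innerDegrees (M : LabelledMap) : ℕ →₀ ℕ :=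
  Finsupp.ofSupportFinite _ M.finite_innerDegrees

@[simp]
theorem innerDegrees_apply (M : LabelledMap) (k : ℕ) :
    M.innerDegrees k = Nat.card (M.InnerFace k) := rfl

theorem card_darts_eq (M : LabelledMap) :
    M.N = M.outerDegree + M.innerDegrees.sum fun k a => a * k := by
  conv_lhs => rw [M.card_darts]
  rw [Finsupp.sum_of_support_subset _ (s := Finset.range (M.N + 1)) _ _ (fun k _ => zero_mul k)]
  · rfl
  · intro k hk
    rw [Finsupp.mem_support_iff, innerDegrees_apply] at hk
    obtain ⟨f⟩ := (Nat.card_ne_zero.1 hk).1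
    have h1 := Finset.card_le_univ (M.faceDarts f.1)
    rw [card_faceDarts, f.2.2, Fintype.card_fin] at h1
    simpa using Nat.lt_succ_of_le h1

end LabelledMap

theorem hasInnerDegrees_iff {M : RootedMap} {μ : ℕ →₀ ℕ} :
    HasInnerDegrees M μ ↔ M.rep.innerDegrees = μ :=
  ⟨fun h => Finsupp.ext h, fun h k => by rw [← h]; rfl⟩

/-- The degrees determine the number of darts, and a rooted map is then determined by two
permutations of a fixed finite set. -/
theorem finite_hasInnerDegrees (n : ℕ) (μ : ℕ →₀ ℕ) :
    {M : RootedMap | M.rep.outerDegree = n ∧ HasInnerDegrees M μ}.Finite := by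
  have hN : ∀ M : {M : RootedMap | M.rep.outerDegree = n ∧ HasInnerDegrees M μ},
      M.1.rep.N = n + μ.sum fun k a => a * k := fun M => by
    rw [M.1.rep.card_darts_eq, M.2.1, hasInnerDegrees_iff.1 M.2.2]
  let F : {M : RootedMap | M.rep.outerDegree = n ∧ HasInnerDegrees M μ} →
      Equiv.Perm (Fin (n + μ.sum fun k a => a * k)) ×
        Equiv.Perm (Fin (n + μ.sum fun k a => a * k)) := fun M =>
    ((finCongr (hN M)).permCongr M.1.rep.α, (finCongr (hN M)).permCongr M.1.rep.φ)
  refine Set.finite_coe_iff.1 (Finite.of_injective F fun M M' h => Subtype.ext ?_)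
  refine RootedMap.eq_of_iso ⟨(finCongr (hN M)).trans (finCongr (hN M')).symm, fun x => ?_,
    fun x => ?_, fun x => Iff.rfl⟩
  · have := congrArg (fun g => g (finCongr (hN M) x)) (Prod.ext_iff.1 h).1
    rw [Equiv.trans_apply, Equiv.symm_apply_eq]
    simpa [F, Equiv.permCongr_apply] using this
  · have := congrArg (fun g => g (finCongr (hN M) x)) (Prod.ext_iff.1 h).2
    rw [Equiv.trans_apply, Equiv.symm_apply_eq]
    simpa [F, Equiv.permCongr_apply] using this

/-! ### The basic substitution identity -/

section Composition

variable {T U : Type*}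

theorem genFun_const_add (e : ℕ →₀ ℕ) (wt : T → ℕ →₀ ℕ) :
    genFun (fun t => e + wt t) = monomial e 1 * genFun wt := by
  ext μ
  rw [coeff_monomial_mul, one_mul, coeff_genFun]
  split_ifs with h
  · rw [coeff_genFun]
    refine congrArg Nat.cast (Nat.card_congr (Equiv.subtypeEquivRight fun t => ?_))
    rw [eq_tsub_iff_add_eq_of_le h, add_comm]
  · have : IsEmpty {t // e + wt t = μ} := ⟨fun t => h (t.2 ▸ le_self_add)⟩
    simp

theorem coeff_evalAt {d : ℕ} {f z : MvPowerSeries ℕ ℤ} (hz : constantCoeff z = 0)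
    (hf : ∀ μ, coeff μ f ≠ 0 → ∀ i < d, μ i = 0) (ν : ℕ →₀ ℕ) :
    coeff ν (evalAt d f z X) =
      ∑ᶠ μ, coeff μ f * coeff ν (monomial (μ.erase d) 1 * z ^ μ d) := by
  rw [evalAt, coeff_subst (hasSubst_weights_X hz)]
  refine finsum_congr fun μ => ?_
  by_cases h : coeff μ f = 0
  · rw [h, zero_smul, zero_mul]
  · rw [prod_weights (hf μ h), smul_eq_mul]

theorem coeff_evalAt_zero {d : ℕ} {f : MvPowerSeries ℕ ℤ}
    (hf : ∀ μ, coeff μ f ≠ 0 → ∀ i < d, μ i = 0) (ν : ℕ →₀ ℕ) :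
    coeff ν (evalAt d f 0 X) = if ν d = 0 then coeff ν f else 0 := by
  classical
  rw [coeff_evalAt (map_zero _) hf, finsum_eq_single _ ν]
  · split_ifs with h
    · rw [h, pow_zero, mul_one, Finsupp.erase_of_notMem_support (by simpa using h),
        coeff_monomial_same, mul_one]
    · rw [zero_pow h, mul_zero, map_zero, mul_zero]
  · intro μ hμ
    by_cases h : μ d = 0
    · rw [h, pow_zero, mul_one, Finsupp.erase_of_notMem_support (by simpa using h),
        coeff_monomial_ne hμ.symm, mul_zero]
    · rw [zero_pow h, mul_zero, map_zero, mul_zero]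

/-- Substitution of generating functions, combinatorially. -/
theorem evalAt_genFun {d : ℕ} {wt : T → ℕ →₀ ℕ} {wt' : U → ℕ →₀ ℕ}
    (hT : ∀ μ, Finite {t // wt t = μ}) (hU : ∀ μ, Finite {u // wt' u = μ})
    (h0 : ∀ u, wt' u ≠ 0) (hwt : ∀ t, ∀ i < d, wt t i = 0) (I : T → Type*)
    [∀ t, Fintype (I t)] (hI : ∀ t, Fintype.card (I t) = wt t d)
    (hfin : ∀ ν, Finite {P : Σ t, (I t → U) // (wt P.1).erase d + ∑ i, wt' (P.2 i) = ν}) :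
    evalAt d (genFun wt) (genFun wt') X =
      genFun (fun P : Σ t, (I t → U) => (wt P.1).erase d + ∑ i, wt' (P.2 i)) := by
  have hz : constantCoeff (genFun wt') = 0 := by
    have : IsEmpty {u // wt' u = 0} := ⟨fun u => h0 _ u.2⟩
    rw [← coeff_zero_eq_constantCoeff_apply, coeff_genFun, Nat.card_of_isEmpty, Nat.cast_zero]
  have hf : ∀ μ, coeff μ (genFun wt) ≠ 0 → ∀ i < d, μ i = 0 := by
    intro μ hμ
    rw [coeff_genFun, Nat.cast_ne_zero] at hμ
    obtain ⟨t, rfl⟩ := (Nat.card_ne_zero.1 hμ).1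
    exact hwt t
  ext ν
  have := hfin ν
  rw [coeff_evalAt hz hf, coeff_genFun, ← finsum_card_fiber
    (fun P : {P : Σ t, (I t → U) // (wt P.1).erase d + ∑ i, wt' (P.2 i) = ν} => wt P.1.1)]
  refine finsum_congr fun μ => ?_
  -- For a fixed base object, its `μ d` slots are filled independently, which yields a power of the
  -- inner series.
  have key : ∀ t : {t // wt t = μ}, (Nat.card {m : I t.1 → U // μ.erase d + ∑ i, wt' (m i) = ν} : ℤ)
      = coeff ν (monomial (μ.erase d) 1 * genFun wt' ^ μ d) := by
    rintro ⟨t, rfl⟩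
    rw [← hI t, ← (genFun_pi hU (I t)).2, ← genFun_const_add, coeff_genFun]
  let E : {P : {P : Σ t, (I t → U) // (wt P.1).erase d + ∑ i, wt' (P.2 i) = ν} // wt P.1.1 = μ} ≃
      Σ t : {t // wt t = μ}, {m : I t.1 → U // μ.erase d + ∑ i, wt' (m i) = ν} :=
    { toFun := fun P => ⟨⟨P.1.1.1, P.2⟩, P.1.1.2,
        (congrArg (fun κ : ℕ →₀ ℕ => κ.erase d + _) P.2).symm.trans P.1.2⟩
      invFun := fun Q => ⟨⟨⟨Q.1.1, Q.2.1⟩, by rw [Q.1.2, Q.2.2]⟩, Q.1.2⟩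
      left_inv := fun P => rfl
      right_inv := fun Q => rfl }
  have := hT μ
  have : Fintype {t // wt t = μ} := Fintype.ofFinite _
  have hfin' : ∀ t : {t // wt t = μ},
      Finite {m : I t.1 → U // μ.erase d + ∑ i, wt' (m i) = ν} := fun t =>
    Finite.of_injective (fun m => (⟨⟨t.1, m.1⟩, by rw [t.2, m.2]⟩ :
      {P : Σ t, (I t → U) // (wt P.1).erase d + ∑ i, wt' (P.2 i) = ν})) fun m m' h => by
        simpa [Subtype.ext_iff] using h
  rw [Nat.card_congr E, Nat.card_sigma, Nat.cast_sum, Finset.sum_congr rfl (fun t _ => key t),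
    Finset.sum_const, Finset.card_univ, coeff_genFun, Nat.card_eq_fintype_card, nsmul_eq_mul]

end Composition

/-! ### The gluing bijection as an identity between series -/

open LabelledMap CombMap

theorem finite_fiber_rootedMap {p : RootedMap → Prop} {n : ℕ}
    (hp : ∀ M, p M → M.rep.outerDegree = n) (μ : ℕ →₀ ℕ) :
    Finite {M : {M // p M} // M.1.rep.innerDegrees = μ} := by
  have := (finite_hasInnerDegrees n μ).to_subtype
  refine Finite.of_injective (fun M => (⟨M.1.1, hp _ M.1.2, hasInnerDegrees_iff.2 M.2⟩ :
    {M : RootedMap | M.rep.outerDegree = n ∧ HasInnerDegrees M μ})) fun M M' h => ?_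
  exact Subtype.ext (Subtype.ext (congrArg (fun M => M.1) h :))

theorem genFun_rootedMap_apply (p : RootedMap → Prop) (μ : ℕ →₀ ℕ) :
    genFun (fun M : {M // p M} => M.1.rep.innerDegrees) μ =
      (Nat.card {M : RootedMap // p M ∧ HasInnerDegrees M μ} : ℤ) := by
  refine congrArg Nat.cast (Nat.card_congr ?_)
  refine (Equiv.subtypeSubtypeEquivSubtypeInter p
    (fun M : RootedMap => M.rep.innerDegrees = μ)).trans (Equiv.subtypeEquivRight fun M => ?_)
  rw [hasInnerDegrees_iff]

theorem irrSeries_eq (d n : ℕ) :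
    irrSeries d n = genFun (fun M : IrrMap d n => M.1.rep.innerDegrees) :=
  funext fun μ => (genFun_rootedMap_apply _ μ).symm

theorem girthSeries_eq (d : ℕ) :
    girthSeries d = genFun (fun M : GirthEqMap d => M.1.rep.innerDegrees) :=
  funext fun μ => (genFun_rootedMap_apply _ μ).symm

namespace LabelledMap

theorem innerDegrees_eq_zero {M : LabelledMap} {d i : ℕ} (hg : GirthGe M.α M.φ d) (hi : i < d) :
    M.innerDegrees i = 0 := by
  have : IsEmpty (M.InnerFace i) := ⟨fun f => absurd (le_of_innerFace hg f) (not_le.2 hi)⟩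
  rw [innerDegrees_apply, Nat.card_of_isEmpty]

/-- In an irreducible map every cycle of length `d` surrounds an inner face of degree `d`; without
such faces there is no such cycle. -/
theorem girthGe_succ_iff {M : LabelledMap} {d : ℕ} :
    GirthGe M.α M.φ (d + 1) ↔ M.IsIrreducible d ∧ M.innerDegrees d = 0 := by
  rw [isIrreducible_iff]
  constructor
  · intro h
    refine ⟨⟨fun S h1 h2 h3 => (Nat.le_succ d).trans (h S h1 h2 h3), fun S hS hd => ?_⟩,
      innerDegrees_eq_zero h (Nat.lt_succ_self d)⟩
    have := h S hS.region hS.nonempty hS.ne_univ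
    omega
  · rintro ⟨⟨h1, h2⟩, h3⟩
    have : IsEmpty (M.InnerFace d) := by
      rw [innerDegrees_apply, Finite.card_eq_zero_iff] at h3
      exact h3
    refine girthGe_of_inner fun S hS => ?_
    rcases (h1 S hS.region hS.nonempty hS.ne_univ).lt_or_eq with h | h
    · exact h
    · exact isEmptyElim (h2 S hS h.symm).choose

end LabelledMap

theorem coeff_irrSeries_ne_zero {d n : ℕ} {μ : ℕ →₀ ℕ} (h : coeff μ (irrSeries d n) ≠ 0) :
    ∀ i < d, μ i = 0 := by
  rw [irrSeries_eq, coeff_genFun, Nat.cast_ne_zero] at h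
  obtain ⟨M, rfl⟩ := (Nat.card_ne_zero.1 h).1
  exact fun i hi => innerDegrees_eq_zero (isIrreducible_iff.1 M.2.2).1 hi

/-- Setting `z` to zero keeps the maps without inner faces of degree `d`, identified by
`girthGe_succ_iff`. -/
theorem evalAt_irrSeries_zero (d n : ℕ) :
    evalAt d (irrSeries d n) 0 X =
      genFun (fun M : GirthGeMap (d + 1) n => M.1.rep.innerDegrees) := by
  ext ν
  rw [coeff_evalAt_zero fun μ => coeff_irrSeries_ne_zero]
  have e2 : coeff ν (irrSeries d n) = (Nat.card {M : RootedMap //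
    (M.rep.outerDegree = n ∧ M.rep.IsIrreducible d) ∧ HasInnerDegrees M ν} : ℤ) := rfl
  have e1 := genFun_rootedMap_apply
    (fun M => M.rep.outerDegree = n ∧ ((d + 1 : ℕ) : ℕ∞) ≤ M.rep.girth) ν
  refine Eq.trans ?_ e1.symm
  split_ifs with h
  · rw [e2]
    refine congrArg Nat.cast (Nat.card_congr (Equiv.subtypeEquivRight fun M => ?_))
    rw [natCast_le_girth, girthGe_succ_iff, hasInnerDegrees_iff]
    constructor
    · rintro ⟨⟨h1, h2⟩, rfl⟩
      exact ⟨⟨h1, h2, h⟩, rfl⟩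
    · rintro ⟨⟨h1, h2, -⟩, h3⟩
      exact ⟨⟨h1, h2⟩, h3⟩
  · have : IsEmpty {M : RootedMap // (M.rep.outerDegree = n ∧
        ((d + 1 : ℕ) : ℕ∞) ≤ M.rep.girth) ∧ HasInnerDegrees M ν} := by
      refine ⟨fun M => h ?_⟩
      have := M.2.1.2
      rw [natCast_le_girth, girthGe_succ_iff] at this
      rw [← hasInnerDegrees_iff.1 M.2.2]
      exact this.2
    rw [Nat.card_of_isEmpty, Nat.cast_zero]

/-- Makes the constant term of `girthSeries d` vanish, so that it can be substituted. -/
theorem GirthEqMap.innerDegrees_ne_zero {d : ℕ} (hd : 1 ≤ d) (m : GirthEqMap d) :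
    m.1.rep.innerDegrees ≠ 0 := by
  have hm := m.isFilling hd
  obtain ⟨r, hr⟩ := hm.exists_root
  obtain ⟨x, hx⟩ : ∃ x, ¬ m.1.rep.IsOuter (m.1.rep.faceOf x) := ⟨_, hm.not_outer_α ⟨r, hr, rfl⟩⟩
  intro h
  have := DFunLike.congr_fun h (m.1.rep.degree (m.1.rep.faceOf x))
  rw [innerDegrees_apply, Finsupp.zero_apply, Finite.card_eq_zero_iff] at this
  exact this.false ⟨_, hx, rfl⟩

theorem constantCoeff_girthSeries {d : ℕ} (hd : 1 ≤ d) : constantCoeff (girthSeries d) = 0 := by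
  have : IsEmpty {M : GirthEqMap d // M.1.rep.innerDegrees = 0} :=
    ⟨fun u => GirthEqMap.innerDegrees_ne_zero hd u.1 u.2⟩
  rw [girthSeries_eq, ← coeff_zero_eq_constantCoeff_apply, coeff_genFun, Nat.card_of_isEmpty,
    Nat.cast_zero]

theorem evalAt_irrSeries_girthSeries {d : ℕ} (hd : 1 ≤ d) (n : ℕ) :
    evalAt d (irrSeries d n) (girthSeries d) X =
      genFun (fun M : GirthGeMap d n => M.1.rep.innerDegrees) := by
  have he : ∀ (M : IrrMap d n) (f : M.1.rep.InnerFace d), ∃ x, M.1.rep.faceOf x = f.1 :=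
    fun M f => exists_faceOf f.1
  choose e he using he
  obtain ⟨Φ, hΦ⟩ := exists_gluing_equiv hd fun M f => ⟨e M f, he M f⟩
  have (M : IrrMap d n) : Fintype (M.1.rep.InnerFace d) := Fintype.ofFinite _
  have key : ∀ P : FilledMap d n, (Φ P).1.rep.innerDegrees =
      P.1.1.rep.innerDegrees.erase d + ∑ f, (P.2 f).1.rep.innerDegrees := by
    intro P
    obtain ⟨j, k, h⟩ := GluesTo.exists_glued hd ((hΦ P (Φ P)).2 rfl)
    ext i
    rw [innerDegrees_apply, h.card_innerFace i, Finsupp.add_apply, Finsupp.finsetSum_apply]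
    congr 1
    rw [Finsupp.erase_apply]
    rfl
  rw [irrSeries_eq, girthSeries_eq, evalAt_genFun (finite_fiber_rootedMap fun M hM => hM.1)
    (finite_fiber_rootedMap fun M hM => hM.1) (fun u => GirthEqMap.innerDegrees_ne_zero hd u)
    (fun M i hi => innerDegrees_eq_zero (isIrreducible_iff.1 M.2.2).1 hi)
    (fun M => M.1.rep.InnerFace d)
    (fun M => by rw [innerDegrees_apply, Nat.card_eq_fintype_card])]
  · exact genFun_congr Φ key
  · intro ν
    have := finite_fiber_rootedMap (p := fun M : RootedMap => M.rep.outerDegree = n ∧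
      (d : ℕ∞) ≤ M.rep.girth) (fun M hM => hM.1) ν
    exact Finite.of_equiv _ (Φ.subtypeEquiv (q := fun M => M.1.rep.innerDegrees = ν)
      (fun P => by rw [key])).symm

/-- Both sides count the rooted maps of girth at least `d` and outer degree `n`. -/
theorem evalAt_irrSeries_eq {d : ℕ} (hd : 1 ≤ d) (n : ℕ) :
    evalAt (d - 1) (irrSeries (d - 1) n) 0 X = evalAt d (irrSeries d n) (girthSeries d) X := by
  obtain ⟨d, rfl⟩ := Nat.exists_eq_add_of_le' hd
  rw [evalAt_irrSeries_girthSeries hd, Nat.add_sub_cancel, evalAt_irrSeries_zero]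

/-! ### Noncrossing matchings -/

/-- A noncrossing perfect matching of `{0, …, n - 1}`, extended by the identity. -/
def IsNoncrossing (n : ℕ) (β : ℕ → ℕ) : Prop :=
  (∀ x, β (β x) = x) ∧ (∀ x, β x = x ↔ n ≤ x) ∧ ∀ i j, i < j → j < β i → β j ≤ β i

/-- The matching with an arc from `0` to `a + 1` enclosing `β`, followed by `γ`. -/
def encloseAppend (a : ℕ) (β γ : ℕ → ℕ) (x : ℕ) : ℕ :=
  if x = 0 then a + 1 else if x ≤ a then β (x - 1) + 1 else if x = a + 1 then 0
    else γ (x - (a + 2)) + (a + 2)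

namespace IsNoncrossing

variable {n : ℕ} {β : ℕ → ℕ}

theorem lt (h : IsNoncrossing n β) {x : ℕ} (hx : x < n) : β x < n := by
  by_contra hn
  have := (h.2.1 (β x)).2 (not_lt.1 hn)
  rw [h.1] at this
  omega

theorem ne (h : IsNoncrossing n β) {x : ℕ} (hx : x < n) : β x ≠ x :=
  fun hn => absurd ((h.2.1 x).1 hn) (not_le.2 hx)

theorem inj (h : IsNoncrossing n β) {x y : ℕ} (hxy : β x = β y) : x = y := by
  rw [← h.1 x, hxy, h.1]

theorem encloseAppend {a b : ℕ} {β γ : ℕ → ℕ} (hβ : IsNoncrossing a β)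
    (hγ : IsNoncrossing b γ) : IsNoncrossing (a + b + 2) (encloseAppend a β γ) := by
  have e0 : _root_.encloseAppend a β γ 0 = a + 1 := by simp [_root_.encloseAppend]
  have e1 : ∀ x, x < a → _root_.encloseAppend a β γ (x + 1) = β x + 1 := fun x hx => by
    simp [_root_.encloseAppend, Nat.succ_le_of_lt hx]
  have e2 : _root_.encloseAppend a β γ (a + 1) = 0 := by simp [_root_.encloseAppend]
  have e3 : ∀ x, _root_.encloseAppend a β γ (x + (a + 2)) = γ x + (a + 2) := fun x => by
    rw [_root_.encloseAppend, if_neg (by omega), if_neg (by omega), if_neg (by omega),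
      Nat.add_sub_cancel]
  have split : ∀ x, x = 0 ∨ (∃ y < a, x = y + 1) ∨ x = a + 1 ∨ ∃ y, x = y + (a + 2) := by
    intro x
    rcases Nat.eq_zero_or_pos x with h | h
    · exact Or.inl h
    rcases lt_trichotomy x (a + 1) with h' | h' | h'
    · exact Or.inr (Or.inl ⟨x - 1, by omega, by omega⟩)
    · exact Or.inr (Or.inr (Or.inl h'))
    · exact Or.inr (Or.inr (Or.inr ⟨x - (a + 2), by omega⟩))
  refine ⟨fun x => ?_, fun x => ?_, fun i j hij hj => ?_⟩
  · rcases split x with rfl | ⟨y, hy, rfl⟩ | rfl | ⟨y, rfl⟩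
    · rw [e0, e2]
    · rw [e1 y hy, e1 _ (hβ.lt hy), hβ.1]
    · rw [e2, e0]
    · rw [e3, e3, hγ.1]
  · rcases split x with rfl | ⟨y, hy, rfl⟩ | rfl | ⟨y, rfl⟩
    · rw [e0]; omega
    · rw [e1 y hy]
      have := hβ.ne hy
      omega
    · rw [e2]; omega
    · rw [e3]
      have := hγ.2.1 y
      omega
  · rcases split i with rfl | ⟨y, hy, rfl⟩ | rfl | ⟨y, rfl⟩
    · rw [e0] at hj ⊢
      rcases split j with rfl | ⟨z, hz, rfl⟩ | rfl | ⟨z, rfl⟩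
      · omega
      · rw [e1 z hz]
        have := hβ.lt hz
        omega
      · omega
      · omega
    · rw [e1 y hy] at hj ⊢
      have hy' := hβ.lt hy
      obtain ⟨z, rfl⟩ : ∃ z, j = z + 1 := ⟨j - 1, by omega⟩
      rw [e1 z (by omega)]
      have := hβ.2.2 y z (by omega) (by omega)
      omega
    · rw [e2] at hj
      omega
    · rw [e3] at hj ⊢
      obtain ⟨z, rfl⟩ : ∃ z, j = z + (a + 2) := ⟨j - (a + 2), by omega⟩
      rw [e3]
      have := hγ.2.2 y z (by omega) (by omega)
      omega

/-- The partner `a + 1` of `0` splits the matching: since arcs do not cross, the points under this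
arc and those after it are matched among themselves. -/
theorem exists_encloseAppend {δ : ℕ → ℕ} (hδ : IsNoncrossing n δ) (hn : 0 < n) :
    ∃ a b β γ, n = a + b + 2 ∧ IsNoncrossing a β ∧ IsNoncrossing b γ ∧
      δ = _root_.encloseAppend a β γ := by
  have h0 := hδ.lt hn
  have h0' := hδ.ne hn
  obtain ⟨a, ha⟩ : ∃ a, δ 0 = a + 1 := ⟨δ 0 - 1, by omega⟩
  obtain ⟨b, hb⟩ : ∃ b, n = a + b + 2 := ⟨n - (a + 2), by omega⟩
  have ha' : δ (a + 1) = 0 := by rw [← ha, hδ.1]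
  have hin : ∀ x, 1 ≤ x → x ≤ a → 1 ≤ δ x ∧ δ x ≤ a := by
    intro x h1 h2
    have h3 := hδ.2.2 0 x (by omega) (by omega)
    have h4 : δ x ≠ 0 := fun h => by
      have := hδ.inj (h.trans ha'.symm)
      omega
    have h5 : δ x ≠ a + 1 := fun h => by
      have := hδ.inj (h.trans ha.symm)
      omega
    omega
  have hout : ∀ x, a + 2 ≤ x → a + 2 ≤ δ x := by
    intro x hx
    by_contra hlt
    have h4 : δ x ≠ 0 := fun h => by
      have := hδ.inj (h.trans ha'.symm)
      omega
    have h5 : δ x ≠ a + 1 := fun h => by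
      have := hδ.inj (h.trans ha.symm)
      omega
    have := hin (δ x) (by omega) (by omega)
    rw [hδ.1] at this
    omega
  -- The inner matching is cut off at `a` to be the identity beyond; the other one inherits this
  -- from `δ`.
  refine ⟨a, b, fun x => if x < a then δ (x + 1) - 1 else x, fun x => δ (x + (a + 2)) - (a + 2),
    hb, ⟨fun x => ?_, fun x => ?_, fun i j hij hj => ?_⟩,
    ⟨fun x => ?_, fun x => ?_, fun i j hij hj => ?_⟩, funext fun x => ?_⟩
  · beta_reduce
    by_cases hx : x < a
    · have := hin (x + 1) (by omega) (by omega)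
      rw [if_pos hx, if_pos (by omega), Nat.sub_add_cancel this.1, hδ.1]
      rfl
    · rw [if_neg hx, if_neg hx]
  · beta_reduce
    by_cases hx : x < a
    · have := hin (x + 1) (by omega) (by omega)
      have := hδ.ne (x := x + 1) (by omega)
      rw [if_pos hx]
      omega
    · rw [if_neg hx]
      omega
  · beta_reduce at hj ⊢
    by_cases hi : i < a
    · have := hin (i + 1) (by omega) (by omega)
      rw [if_pos hi] at hj ⊢
      have h1 := hδ.2.2 (i + 1) (j + 1) (by omega) (by omega)
      rw [if_pos (by omega)]
      omega
    · rw [if_neg hi] at hj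
      omega
  · beta_reduce
    have := hout (x + (a + 2)) (by omega)
    rw [Nat.sub_add_cancel this, hδ.1]
    omega
  · beta_reduce
    have := hout (x + (a + 2)) (by omega)
    have h1 := hδ.2.1 (x + (a + 2))
    omega
  · beta_reduce at hj ⊢
    have h1 := hout (i + (a + 2)) (by omega)
    have := hδ.2.2 (i + (a + 2)) (j + (a + 2)) (by omega) (by omega)
    omega
  · rcases Nat.eq_zero_or_pos x with rfl | h1
    · rw [ha, _root_.encloseAppend, if_pos rfl]
    rw [_root_.encloseAppend, if_neg h1.ne']
    by_cases h2 : x ≤ a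
    · have := hin x h1 h2
      rw [if_pos h2, if_pos (by omega), Nat.sub_add_cancel h1]
      omega
    rw [if_neg h2]
    by_cases h3 : x = a + 1
    · rw [if_pos h3, h3, ha']
    · have := hout x (by omega)
      have h4 : x - (a + 2) + (a + 2) = x := by omega
      rw [if_neg h3, h4]
      omega

theorem encloseAppend_injective {a a' : ℕ} {β γ β' γ' : ℕ → ℕ} (hβ : IsNoncrossing a β)
    (hβ' : IsNoncrossing a' β')
    (h : _root_.encloseAppend a β γ = _root_.encloseAppend a' β' γ') :
    a = a' ∧ β = β' ∧ γ = γ' := by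
  have h0 := congrFun h 0
  simp only [_root_.encloseAppend, if_true, Nat.add_right_cancel_iff] at h0
  subst h0
  refine ⟨rfl, funext fun x => ?_, funext fun x => ?_⟩
  · by_cases hx : x < a
    · have := congrFun h (x + 1)
      simpa [_root_.encloseAppend, Nat.succ_le_of_lt hx] using this
    · rw [(hβ.2.1 x).2 (not_lt.1 hx), (hβ'.2.1 x).2 (not_lt.1 hx)]
  · have := congrFun h (x + (a + 2))
    rwa [_root_.encloseAppend, if_neg (by omega), if_neg (by omega), if_neg (by omega),
      _root_.encloseAppend, if_neg (by omega), if_neg (by omega), if_neg (by omega),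
      Nat.add_sub_cancel, Nat.add_right_cancel_iff] at this

end IsNoncrossing

/-- The noncrossing matching coded by a binary tree. -/
def treeMatching : BinaryTree Unit → ℕ → ℕ
  | .nil => id
  | .node _ l r => encloseAppend (2 * l.numNodes) (treeMatching l) (treeMatching r)

theorem isNoncrossing_treeMatching (t : BinaryTree Unit) :
    IsNoncrossing (2 * t.numNodes) (treeMatching t) := by
  induction t with
  | nil => exact ⟨fun x => rfl, fun x => by simp [treeMatching], fun i j h1 h2 => by
      simp only [treeMatching, id] at h2; omega⟩
  | node a l r hl hr =>
    have := hl.encloseAppend hr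
    rwa [show 2 * (BinaryTree.node a l r).numNodes = 2 * l.numNodes + 2 * r.numNodes + 2 by
      simp only [BinaryTree.numNodes]; ring]

theorem treeMatching_injective : Function.Injective treeMatching := by
  intro t
  induction t with
  | nil =>
    intro t' h
    cases t' with
    | nil => rfl
    | node a l r =>
      have := congrFun h 0
      simp [treeMatching, encloseAppend] at this
  | node a l r hl hr =>
    intro t' h
    cases t' with
    | nil =>
      have := congrFun h 0
      simp [treeMatching, encloseAppend] at this
    | node a' l' r' =>
      obtain ⟨-, h1, h2⟩ := IsNoncrossing.encloseAppend_injective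
        (isNoncrossing_treeMatching l) (isNoncrossing_treeMatching l') h
      rw [hl h1, hr h2]

/-- Splitting repeatedly at the arc of the first point produces a binary tree; in particular `n`
must be even. -/
theorem exists_treeMatching {n : ℕ} {β : ℕ → ℕ} (h : IsNoncrossing n β) :
    ∃ t, 2 * t.numNodes = n ∧ treeMatching t = β := by
  induction n using Nat.strong_induction_on generalizing β with
  | _ n ih =>
    rcases Nat.eq_zero_or_pos n with rfl | hn
    · exact ⟨.nil, rfl, funext fun x => ((h.2.1 x).2 (Nat.zero_le x)).symm⟩
    · obtain ⟨a, b, β', γ', rfl, h1, h2, rfl⟩ := h.exists_encloseAppend hn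
      obtain ⟨l, rfl, rfl⟩ := ih a (by omega) h1
      obtain ⟨r, rfl, rfl⟩ := ih b (by omega) h2
      exact ⟨.node () l r, by simp only [BinaryTree.numNodes]; ring, rfl⟩

theorem card_isNoncrossing (n : ℕ) :
    (Nat.card {β : ℕ → ℕ // IsNoncrossing n β} : ℤ) = catHalf n := by
  rw [catHalf]
  split_ifs with hn
  · obtain ⟨k, rfl⟩ := hn.two_dvd
    let F : BinaryTree.treesOfNumNodesEq k → {β : ℕ → ℕ // IsNoncrossing (2 * k) β} := fun t =>
      ⟨treeMatching t.1, by
        have := isNoncrossing_treeMatching t.1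
        rwa [BinaryTree.mem_treesOfNumNodesEq.1 t.2] at this⟩
    have hF : Function.Bijective F := by
      constructor
      · intro t t' h
        exact Subtype.ext (treeMatching_injective (congrArg Subtype.val h))
      · rintro ⟨β, hβ⟩
        obtain ⟨t, ht, rfl⟩ := exists_treeMatching hβ
        exact ⟨⟨t, BinaryTree.mem_treesOfNumNodesEq.2 (by omega)⟩, rfl⟩
    rw [Nat.mul_div_cancel_left k two_pos, ← BinaryTree.treesOfNumNodesEq_card_eq_catalan,
      ← Nat.card_congr (Equiv.ofBijective F hF), Nat.card_eq_fintype_card, Fintype.card_coe]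
  · have : IsEmpty {β : ℕ → ℕ // IsNoncrossing n β} := ⟨fun β => by
      obtain ⟨t, rfl, -⟩ := exists_treeMatching β.2
      exact hn (even_two_mul _)⟩
    rw [Nat.card_of_isEmpty, Nat.cast_zero]

/-! ### Plane trees -/

namespace IsNoncrossing

open CombMap

variable {m : ℕ} {β : ℕ → ℕ}

/-- The matching, as a permutation. -/
def perm (h : IsNoncrossing (m + 1) β) : Equiv.Perm (Fin (m + 1)) :=
  Function.Involutive.toPerm (fun x => ⟨β x, h.lt x.2⟩) fun x => Fin.ext (h.1 x)

theorem perm_apply (h : IsNoncrossing (m + 1) β) (x : Fin (m + 1)) : (h.perm x : ℕ) = β x := rfl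

theorem finRotate_pow_val (k : ℕ) (hk : k ≤ m) : ((finRotate (m + 1) ^ k) 0 : ℕ) = k := by
  induction k with
  | zero => rfl
  | succ k ih =>
    have := ih (by omega)
    rw [pow_succ', Equiv.Perm.mul_apply, coe_finRotate_of_ne_last, this]
    intro h
    rw [h, Fin.val_last] at this
    omega

theorem finRotate_pow (x : Fin (m + 1)) : (finRotate (m + 1) ^ (x : ℕ)) 0 = x :=
  Fin.ext (finRotate_pow_val x (Nat.le_of_lt_succ x.2))

theorem isConn (h : IsNoncrossing (m + 1) β) : IsConn h.perm (finRotate (m + 1)) := by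
  have key : ∀ p : Fin (m + 1) → Prop, (∀ x, p x → p (finRotate (m + 1) x)) → ∀ x k, p x →
      p ((finRotate (m + 1) ^ k) x) := by
    intro p hp x k hx
    induction k with
    | zero => exact hx
    | succ k ih => rw [pow_succ', Equiv.Perm.mul_apply]; exact hp _ ih
  intro p _ h2 x y hx
  rw [← finRotate_pow y]
  refine key p h2 0 y ?_
  have h0 : finRotate (m + 1) (Fin.last m) = 0 := finRotate_last
  rw [← h0]
  refine h2 _ ?_
  have h3 := key p h2 x (m - x) hx
  have h4 : m - (x : ℕ) + x = ((Fin.last m : Fin (m + 1)) : ℕ) := by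
    have := x.2
    rw [Fin.val_last]
    omega
  have h5 : (finRotate (m + 1) ^ (m - (x : ℕ))) x = Fin.last m := by
    conv_lhs => rw [← finRotate_pow x, finRotate_pow_val _ (Nat.le_of_lt_succ x.2)]
    rw [← Equiv.Perm.mul_apply, ← pow_add, h4, finRotate_pow]
  rwa [h5] at h3

/-- The corners under the arc from `i` to `β i`. -/
def Under (β : ℕ → ℕ) (i x : ℕ) : Prop := i < x ∧ x ≤ β i

/-- Lying under a given arc depends only on the vertex of a corner: the corners `y + 1` and `β y`
have the same origin, and arcs do not cross. -/
theorem under_succ (h : IsNoncrossing (m + 1) β) {i y : ℕ} (hi : i < m + 1) :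
    Under β i (y + 1) ↔ Under β i (β y) := by
  have h1 := h.2.2 i y
  have h2 := h.2.2 i (β y)
  have h3 := h.2.2 (β y) i
  have h4 := h.2.2 y i
  have h5 : β y = i → y = β i := fun h' => by rw [← h', h.1]
  have h6 : β y = β i → y = i := h.inj
  have h7 := h.ne hi
  rw [h.1] at h2 h3
  unfold Under
  by_cases hyi : y = i
  · subst hyi; omega
  · by_cases hyi' : y = β i
    · have : β y = i := by rw [hyi', h.1]
      omega
    · omega

theorem not_under_last (h : IsNoncrossing (m + 1) β) {i : ℕ} (hi : i < m + 1) :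
    ¬ Under β i (β m) := by
  have h2 := h.2.2 i (β m)
  have h6 : β m = β i → m = i := h.inj
  have h8 := h.lt hi
  rw [h.1] at h2
  unfold Under
  have h5 : β i = m → β m = i := fun h' => by rw [← h', h.1]
  omega

/-- In dual form, every `w` constant on edges has a potential: at a corner, sum `w` over the arcs
covering it. Each arc is counted only at its left end, as `Under β i` is empty when `β i < i`. Along
the edge of `z` only its own arc changes status. -/
theorem isExact (h : IsNoncrossing (m + 1) β) : IsExact h.perm (finRotate (m + 1)) := by
  classical
  have hinv : ∀ x, h.perm (h.perm x) = x := fun x => Fin.ext (h.1 x)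
  have hne : ∀ x, h.perm x ≠ x := fun x hx => h.ne x.2 (congrArg Fin.val hx)
  refine (isExact_dual hinv hne h.isConn).1 fun w hw _ => ?_
  let T : Fin (m + 1) → Fin (m + 1) → ZMod 2 := fun i x => if Under β i x then w i else 0
  have hrot : ∀ i y, T i (finRotate (m + 1) y) = T i (h.perm y) := by
    intro i y
    refine if_congr ?_ rfl rfl
    by_cases hy : y = Fin.last m
    · have := h.not_under_last i.2
      rw [hy, finRotate_last, perm_apply, Fin.val_last]
      refine iff_of_false (fun h' => ?_) this
      exact absurd h'.1 (Nat.not_lt_zero _)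
    · rw [coe_finRotate_of_ne_last hy, perm_apply]
      exact h.under_succ i.2
  refine ⟨fun x => ∑ i, T i x, fun x => ?_, fun x => ?_⟩
  · refine Finset.sum_congr rfl fun i _ => ?_
    rw [Equiv.Perm.mul_apply, hrot, hinv]
  · have key : ∀ z : Fin (m + 1), (z : ℕ) < β z → ∑ i, T i z + ∑ i, T i (h.perm z) = w z := by
      intro z hz
      rw [← Finset.sum_add_distrib, Finset.sum_eq_single z]
      · simp only [T]
        rw [if_neg (fun h' => lt_irrefl _ h'.1), if_pos, zero_add]
        exact ⟨hz, le_refl _⟩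
      · intro i _ hi
        have e : Under β i z ↔ Under β i (h.perm z) := by
          have hi' : (i : ℕ) ≠ z := fun h' => hi (Fin.ext h')
          have h1 := h.2.2 i z
          have h2 := h.2.2 i (β z)
          have h3 := h.2.2 z i
          have h5 : β z = i → (z : ℕ) = β i := fun h' => by rw [← h', h.1]
          have h6 : β z = β i → (z : ℕ) = i := h.inj
          have h7 : (z : ℕ) = β i → β z = i := fun h' => by rw [h', h.1]
          rw [h.1] at h2
          rw [perm_apply]
          unfold Under
          omega
        simp only [T]
        rw [if_congr e rfl rfl, CharTwo.add_self_eq_zero]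
      · simp
    rcases lt_trichotomy (x : ℕ) (β x) with hx | hx | hx
    · exact (key x hx).symm
    · exact absurd hx.symm (h.ne x.2)
    · have := key (h.perm x) (by rwa [perm_apply, h.1])
      rw [hinv, hw] at this
      rw [← this, add_comm]

end IsNoncrossing

/-! ### Maps with one face and their matchings -/

namespace LabelledMap

open CombMap

/-- The only face is the outer face, and `β` is the matching of the darts along it. -/
def IsCoded (M : LabelledMap) (n : ℕ) (β : ℕ → ℕ) : Prop :=
  M.N = n ∧ ∃ r, M.IsRoot r ∧ Function.minimalPeriod M.φ r = n ∧
    ∀ i < n, M.α (M.φ^[i] r) = M.φ^[β i] r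

theorem Iso.minimalPeriod_eq {M M' : LabelledMap} {e : Fin M.N ≃ Fin M'.N}
    (h : ∀ x, e (M.φ x) = M'.φ (e x)) (x : Fin M.N) :
    Function.minimalPeriod M'.φ (e x) = Function.minimalPeriod M.φ x :=
  minimalPeriod_eq_of_semiconj (fun _ => True) (fun _ _ => trivial)
    (fun _ _ _ _ hxy => e.injective hxy) (fun x _ => h x) trivial

theorem bijective_iterate {M : LabelledMap} {r : Fin M.N}
    (h : Function.minimalPeriod M.φ r = M.N) :
    Function.Bijective fun i : Fin M.N => M.φ^[i] r := by
  rw [Fintype.bijective_iff_injective_and_card]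
  refine ⟨fun i j hij => Fin.ext ?_, rfl⟩
  exact Function.iterate_injOn_Iio_minimalPeriod (f := M.φ) (x := r)
    (by rw [h]; exact i.2) (by rw [h]; exact j.2) hij

theorem IsCoded.of_iso {M M' : LabelledMap} {n : ℕ} {β : ℕ → ℕ} (h : M.IsCoded n β)
    (hh : Iso M M') : M'.IsCoded n β := by
  obtain ⟨hN, r, hr, hp, hα⟩ := h
  obtain ⟨e, h1, h2, h3⟩ := hh
  have hit : ∀ i x, e (M.φ^[i] x) = M'.φ^[i] (e x) := fun i x =>
    (Function.Semiconj.iterate_right (f := e) (ga := M.φ) (gb := M'.φ) h2 i) x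
  refine ⟨?_, e r, (h3 r).2 hr, ?_, fun i hi => ?_⟩
  · rw [← hN]
    simpa using (Fintype.card_congr e).symm
  · rw [Iso.minimalPeriod_eq h2, hp]
  · rw [← hit, ← h1, hα i hi, hit]

theorem IsCoded.iso {M M' : LabelledMap} {n : ℕ} {β : ℕ → ℕ} (h : M.IsCoded n β)
    (h' : M'.IsCoded n β) : Iso M M' := by
  obtain ⟨hN, r, hr, hp, hα⟩ := h
  obtain ⟨hN', r', hr', hp', hα'⟩ := h'
  let E := Equiv.ofBijective _ (bijective_iterate (hp.trans hN.symm))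
  let E' := Equiv.ofBijective _ (bijective_iterate (hp'.trans hN'.symm))
  let e := E.symm.trans ((finCongr (hN.trans hN'.symm)).trans E')
  have he : ∀ i, e (M.φ^[i] r) = M'.φ^[i] r' := by
    intro i
    rw [← Function.iterate_mod_minimalPeriod_eq (f := M.φ), hp,
      ← Function.iterate_mod_minimalPeriod_eq (f := M'.φ) (x := r'), hp']
    have hn : i % n < M.N := by
      rw [hN]
      exact Nat.mod_lt _ (by rw [← hN]; exact r.pos)
    have h1 : M.φ^[i % n] r = E ⟨i % n, hn⟩ := rfl
    rw [h1]
    simp only [e, Equiv.trans_apply, Equiv.symm_apply_apply]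
    rfl
  have hs : ∀ x, ∃ i < n, M.φ^[i] r = x := fun x => by
    obtain ⟨i, hi⟩ := E.surjective x
    exact ⟨i, hN ▸ i.2, hi⟩
  refine ⟨e, fun x => ?_, fun x => ?_, fun x => ?_⟩
  · obtain ⟨i, hi, rfl⟩ := hs x
    rw [hα i hi, he, he, hα' i hi]
  · obtain ⟨i, hi, rfl⟩ := hs x
    rw [he, ← Function.iterate_succ_apply' M.φ, he, Function.iterate_succ_apply']
  · have h0 : e r = r' := he 0
    constructor
    · intro hx
      have : e x = e r := by rw [h0]; exact isRoot_unique hx hr'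
      exact e.injective this ▸ hr
    · intro hx
      rw [isRoot_unique hx hr, h0]
      exact hr'

theorem innerDegrees_eq_zero_iff {M : LabelledMap} :
    M.innerDegrees = 0 ↔ M.N = M.outerDegree := by
  constructor
  · intro h
    have := M.card_darts_eq
    rwa [h, Finsupp.sum_zero_index, add_zero] at this
  · intro h
    have h1 := M.card_darts_eq
    have h2 : (M.innerDegrees.sum fun k a => a * k) = 0 := by omega
    ext k
    rcases Nat.eq_zero_or_pos k with rfl | hk
    · exact M.card_innerFace_zero
    · by_contra hne
      have h3 := (Finset.sum_eq_zero_iff.1 h2) k (Finsupp.mem_support_iff.2 hne)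
      rcases Nat.mul_eq_zero.1 h3 with h4 | h4
      · exact hne h4
      · omega

theorem IsCoded.outerDegree {M : LabelledMap} {n : ℕ} {β : ℕ → ℕ} (h : M.IsCoded n β) :
    M.outerDegree = n ∧ M.innerDegrees = 0 := by
  obtain ⟨hN, r, hr, hp, -⟩ := h
  have := outerDegree_eq hr
  exact ⟨this.trans hp, innerDegrees_eq_zero_iff.2 (by rw [this, hp, hN])⟩

theorem IsCoded.unique {M : LabelledMap} {n : ℕ} {β β' : ℕ → ℕ} (h : M.IsCoded n β)
    (h' : M.IsCoded n β') (hβ : IsNoncrossing n β) (hβ' : IsNoncrossing n β') : β = β' := by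
  obtain ⟨hN, r, hr, hp, hα⟩ := h
  obtain ⟨-, r', hr', -, hα'⟩ := h'
  obtain rfl := isRoot_unique hr hr'
  ext i
  by_cases hi : i < n
  · exact Function.iterate_injOn_Iio_minimalPeriod (f := M.φ) (x := r)
      (by rw [hp]; exact hβ.lt hi) (by rw [hp]; exact hβ'.lt hi)
      ((hα i hi).symm.trans (hα' i hi))
  · rw [(hβ.2.1 i).2 (not_lt.1 hi), (hβ'.2.1 i).2 (not_lt.1 hi)]

theorem exists_isCoded {n : ℕ} (hn : 1 ≤ n) {β : ℕ → ℕ} (h : IsNoncrossing n β) :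
    ∃ L : LabelledMap, L.IsCoded n β := by
  obtain ⟨m, rfl⟩ := Nat.exists_eq_add_of_le' hn
  obtain ⟨L, e, h1, h2, h3⟩ := exists_ofType h.perm (finRotate (m + 1)) 0
    (fun x => Fin.ext (h.1 x)) (fun x hx => h.ne x.2 (congrArg Fin.val hx)) h.isConn h.isExact
  have hN : L.N = m + 1 := by simpa using (Fintype.card_congr e).symm
  have hit : ∀ i : ℕ, L.φ^[i] (e 0) = e ((finRotate (m + 1) ^ i) 0) := fun i => by
    rw [Equiv.Perm.coe_pow]
    exact ((Function.Semiconj.iterate_right (f := e) (ga := finRotate (m + 1)) (gb := L.φ)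
      h2 i) 0).symm
  have hcyc : L.faceDarts (L.faceOf (e 0)) = Finset.univ := by
    ext x
    simp only [mem_faceDarts, Finset.mem_univ, iff_true]
    rw [faceOf_eq]
    refine Equiv.Perm.SameCycle.symm ⟨(e.symm x : Fin (m + 1)).1, ?_⟩
    rw [zpow_natCast, Equiv.Perm.coe_pow, hit, IsNoncrossing.finRotate_pow,
      Equiv.apply_symm_apply]
  refine ⟨L, hN, e 0, (h3 0).2 rfl, ?_, fun i hi => ?_⟩
  · rw [← degree_faceOf, ← card_faceDarts, hcyc, Finset.card_univ, Fintype.card_fin, hN]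
  · rw [hit, hit, ← h1]
    congr 1
    refine Fin.ext ?_
    rw [IsNoncrossing.perm_apply, IsNoncrossing.finRotate_pow_val i (by omega),
      IsNoncrossing.finRotate_pow_val _ (Nat.le_of_lt_succ (h.lt hi))]

end LabelledMap

namespace LabelledMap

open CombMap

/-- Planarity forbids crossings. The indicator of the edge of `i` has zero sum around the only face,
so it has a vertex potential, which changes along the face only at `i` and `β i`. An arc from `j`
crossing it would join corners with different potentials, although the indicator is zero on its
edge. -/
theorem exists_matching {M : LabelledMap} {n : ℕ} (hn : 1 ≤ n) (ho : M.outerDegree = n)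
    (hi : M.innerDegrees = 0) : ∃ β, IsNoncrossing n β ∧ M.IsCoded n β := by
  classical
  have hN : M.N = n := by rw [innerDegrees_eq_zero_iff.1 hi, ho]
  obtain ⟨r, hr⟩ := exists_root_of_outerDegree_pos (M := M) (by omega)
  have hp : Function.minimalPeriod M.φ r = n := by rw [← outerDegree_eq hr, ho]
  let E := Equiv.ofBijective _ (bijective_iterate (hp.trans hN.symm))
  have hE : ∀ i : ℕ, ∀ h : i < M.N, M.φ^[i] r = E ⟨i, h⟩ := fun i h => rfl
  let β : ℕ → ℕ := fun i => if h : i < M.N then E.symm (M.α (E ⟨i, h⟩)) else i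
  have hβ : ∀ i, ∀ h : i < M.N, β i = E.symm (M.α (E ⟨i, h⟩)) := fun i h => dif_pos h
  have hβ' : ∀ i, ¬ i < M.N → β i = i := fun i h => dif_neg h
  have hlt : ∀ i, i < M.N → β i < M.N := fun i h => by rw [hβ i h]; exact Fin.is_lt _
  have hα : ∀ i, i < M.N → M.α (M.φ^[i] r) = M.φ^[β i] r := by
    intro i h
    rw [hE _ (hlt i h), hE i h]
    simp only [hβ i h, Fin.eta, Equiv.apply_symm_apply]
  have hinj : ∀ i j, i < M.N → j < M.N → M.φ^[i] r = M.φ^[j] r → i = j := by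
    intro i j h1 h2 h
    rw [hE i h1, hE j h2] at h
    exact Fin.val_eq_of_eq (E.injective h)
  have hinv : ∀ i, β (β i) = i := by
    intro i
    by_cases h : i < M.N
    · refine hinj _ _ (hlt _ (hlt i h)) h ?_
      rw [← hα _ (hlt i h), ← hα i h, M.α_involutive]
    · rw [hβ' i h, hβ' i h]
  refine ⟨β, ⟨hinv, fun i => ⟨fun h => ?_, fun h => hβ' i (by omega)⟩, fun i j hij hj => ?_⟩,
    hN, r, hr, hp, fun i h => hα i (by omega)⟩
  · by_contra hlt'
    have := hα i (by omega)
    rw [h] at this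
    exact M.α_ne _ this
  by_contra hcross
  have hiN : i < M.N := by
    by_contra h
    rw [hβ' i h] at hj
    omega
  have hiN' := hlt i hiN
  have hjN : j < M.N := by omega
  have hjN' := hlt j hjN
  let w : Fin M.N → ZMod 2 := fun x => if x = M.φ^[i] r ∨ x = M.φ^[β i] r then 1 else 0
  have hwα : ∀ x, w (M.α x) = w x := by
    intro x
    refine if_congr ?_ rfl rfl
    rw [← hα i hiN]
    constructor
    · rintro (h | h)
      · right; rw [← h, M.α_involutive]
      · left; exact M.α.injective h
    · rintro (rfl | rfl)
      · right; rfl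
      · left; exact M.α_involutive _
  have huniv : ∀ F : M.Face, M.faceDarts F = Finset.univ := by
    intro F
    obtain ⟨y, rfl⟩ := exists_faceOf F
    ext x
    simp only [mem_faceDarts, Finset.mem_univ, iff_true]
    have hc : ∀ z, M.faceOf z = M.faceOf r := fun z => by
      obtain ⟨k, rfl⟩ := E.surjective z
      rw [faceOf_eq]
      refine Equiv.Perm.SameCycle.symm ⟨(k : ℕ), ?_⟩
      rw [zpow_natCast, Equiv.Perm.coe_pow]
      rfl
    rw [hc x, hc y]
  obtain ⟨a, ha, haw⟩ := exists_vertex_potential hwα fun F => by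
    rw [huniv]
    exact sum_eq_zero_of_invol M.α_involutive M.α_ne hwα
  have hw : ∀ k, k < M.N → w (M.φ^[k] r) = if k = i ∨ k = β i then 1 else 0 := by
    intro k hk
    refine if_congr (or_congr ?_ ?_) rfl rfl
    · exact ⟨hinj _ _ hk hiN, fun h => by rw [h]⟩
    · exact ⟨hinj _ _ hk hiN', fun h => by rw [h]⟩
  have hstep : ∀ k, a (M.φ^[k + 1] r) = a (M.φ^[k] r) + w (M.φ^[k] r) := by
    intro k
    rw [Function.iterate_succ_apply', ha, haw, ← add_assoc, CharTwo.add_self_eq_zero, zero_add]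
  have h1 : ∀ k, i < k → k ≤ β i → a (M.φ^[k] r) = a (M.φ^[i] r) + 1 := by
    intro k
    induction k with
    | zero => omega
    | succ k ih =>
      intro h1 h2
      rw [hstep, hw k (by omega)]
      rcases Nat.lt_succ_iff_lt_or_eq.1 h1 with h | rfl
      · rw [ih h (by omega), if_neg (by omega), add_zero]
      · rw [if_pos (Or.inl rfl)]
  have h2 : ∀ k, β i < k → k < M.N → a (M.φ^[k] r) = a (M.φ^[i] r) := by
    intro k
    induction k with
    | zero => omega
    | succ k ih =>
      intro h2 h3
      rw [hstep, hw k (by omega)]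
      rcases Nat.lt_succ_iff_lt_or_eq.1 h2 with h | rfl
      · rw [ih h (by omega), if_neg (by omega), add_zero]
      · rw [if_pos (Or.inr rfl), h1 _ (by omega) le_rfl, add_assoc, CharTwo.add_self_eq_zero,
          add_zero]
  have h3 := haw (M.φ^[j] r)
  rw [hw j hjN, if_neg (by omega), hα j hjN, h1 j hij hj.le, h2 _ (by omega) hjN', add_right_comm,
    CharTwo.add_self_eq_zero, zero_add] at h3
  exact zero_ne_one h3

theorem isOuter_of_innerDegrees_eq_zero {M : LabelledMap} (h : M.innerDegrees = 0)
    (f : M.Face) : M.IsOuter f := by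
  by_contra hf
  have := DFunLike.congr_fun h (M.degree f)
  rw [innerDegrees_apply, Finsupp.zero_apply, Finite.card_eq_zero_iff] at this
  exact this.false ⟨f, hf, rfl⟩

theorem girthGe_of_innerDegrees_eq_zero {M : LabelledMap} (h : M.innerDegrees = 0) (d : ℕ) :
    GirthGe M.α M.φ d := by
  refine girthGe_of_inner fun S hS => ?_
  obtain ⟨x, hx⟩ := hS.nonempty
  obtain ⟨r, hr, hf⟩ := isOuter_of_innerDegrees_eq_zero h (M.faceOf x)
  exact absurd (mem_of_sameCycle hS.region (faceOf_eq.1 hf.symm) hx) (hS.root r hr)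

/-- If there is an inner face, the outer face is a proper region with at most `d` boundary darts;
otherwise the map is a tree, of infinite girth. -/
theorem girth_eq_iff {M : LabelledMap} {d : ℕ} (hd : 1 ≤ d) (ho : M.outerDegree = d) :
    M.girth = (d : ℕ∞) ↔ (d : ℕ∞) ≤ M.girth ∧ M.innerDegrees ≠ 0 := by
  constructor
  · intro h
    refine ⟨h.ge, fun h0 => ?_⟩
    have := natCast_le_girth.2 (girthGe_of_innerDegrees_eq_zero h0 (d + 1))
    rw [h, Nat.cast_le] at this
    omega
  · rintro ⟨h1, h2⟩
    have hg := natCast_le_girth.1 h1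
    obtain ⟨k, hk⟩ := Finsupp.ne_iff.1 h2
    obtain ⟨f⟩ := (Nat.card_ne_zero.1 hk).1
    obtain ⟨r, hr⟩ := exists_root_of_outerDegree_pos (M := M) (by omega)
    obtain ⟨x, hx⟩ := exists_faceOf f.1
    have hne : M.faceDarts (M.faceOf r) ≠ Finset.univ := fun h => f.2.1 ⟨r, hr, by
      have : x ∈ M.faceDarts (M.faceOf r) := h ▸ Finset.mem_univ x
      rw [mem_faceDarts] at this
      rw [← hx, this]⟩
    have hcard : (M.faceDarts (M.faceOf r)).card = d := by
      rw [card_faceDarts, degree_faceOf, ← outerDegree_eq hr, ho]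
    refine girth_eq_natCast.2 ⟨hg, _, isRegion_faceDarts _, faceDarts_nonempty _, hne,
      le_antisymm ?_ (hg _ (isRegion_faceDarts _) (faceDarts_nonempty _) hne)⟩
    exact (Finset.card_le_card (bd_subset _ _)).trans hcard.le

end LabelledMap

/-- Plane trees, by their number of edge sides. -/
abbrev PlaneTree (n : ℕ) : Type :=
  {M : RootedMap // M.rep.outerDegree = n ∧ M.rep.innerDegrees = 0}

open LabelledMap CombMap

theorem card_planeTree {n : ℕ} (hn : 1 ≤ n) : (Nat.card (PlaneTree n) : ℤ) = catHalf n := by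
  rw [← card_isNoncrossing]
  choose L hL using fun β : {β : ℕ → ℕ // IsNoncrossing n β} => exists_isCoded hn β.2
  have hL' : ∀ β, (RootedMap.rep ⟦L β⟧).IsCoded n β.1 := fun β =>
    (hL β).of_iso (isoSetoid.symm (RootedMap.rep_mk_iso (L β)))
  let F : {β : ℕ → ℕ // IsNoncrossing n β} → PlaneTree n := fun β =>
    ⟨⟦L β⟧, (hL' β).outerDegree⟩
  have hF : Function.Bijective F := by
    constructor
    · intro β β' h
      have h1 : (RootedMap.rep ⟦L β⟧).IsCoded n β'.1 := by
        have : (⟦L β⟧ : RootedMap) = ⟦L β'⟧ := congrArg Subtype.val h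
        rw [this]
        exact hL' β'
      exact Subtype.ext ((hL' β).unique h1 β.2 β'.2)
    · rintro ⟨M, h1, h2⟩
      obtain ⟨β, hβ, hM⟩ := exists_matching hn h1 h2
      exact ⟨⟨β, hβ⟩, Subtype.ext (RootedMap.eq_of_iso ((hL' ⟨β, hβ⟩).iso hM))⟩
  rw [Nat.card_congr (Equiv.ofBijective F hF)]

/-- A map of girth at least `d` and outer degree `d` has girth `d` or is a plane tree, and plane
trees have weight one. -/
theorem girthSeries_eq_sub {d : ℕ} (hd : 1 ≤ d) :
    girthSeries d = evalAt (d - 1) (irrSeries (d - 1) d) 0 X - C (catHalf d) := by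
  classical
  rw [evalAt_irrSeries_eq hd, evalAt_irrSeries_girthSeries hd, girthSeries_eq]
  let E : GirthGeMap d d ≃ GirthEqMap d ⊕ PlaneTree d :=
    { toFun := fun M => if h : M.1.rep.innerDegrees = 0 then Sum.inr ⟨M.1, M.2.1, h⟩
        else Sum.inl ⟨M.1, M.2.1, (girth_eq_iff hd M.2.1).2 ⟨M.2.2, h⟩⟩
      invFun := Sum.elim (fun M => ⟨M.1, M.2.1, M.2.2.ge⟩)
        (fun M => ⟨M.1, M.2.1, natCast_le_girth.2 (girthGe_of_innerDegrees_eq_zero M.2.2 d)⟩)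
      left_inv := fun M => by
        dsimp only
        split_ifs <;> rfl
      right_inv := by
        rintro (M | M)
        · exact dif_neg ((girth_eq_iff hd M.2.1).1 M.2.2).2
        · exact dif_pos M.2.2 }
  have h1 := genFun_sum (wt := fun M : GirthEqMap d => M.1.rep.innerDegrees)
    (wt' := fun M : PlaneTree d => M.1.rep.innerDegrees)
    (finite_fiber_rootedMap fun M hM => hM.1) (finite_fiber_rootedMap fun M hM => hM.1)
  have h2 : genFun (fun M : PlaneTree d => M.1.rep.innerDegrees) = C (catHalf d) := by
    ext μ
    rw [coeff_genFun, coeff_C, ← card_planeTree hd]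
    split_ifs with hμ
    · rw [hμ, Nat.card_congr (Equiv.subtypeUnivEquiv fun M : PlaneTree d => M.2.2)]
    · have : IsEmpty {M : PlaneTree d // M.1.rep.innerDegrees = μ} :=
        ⟨fun M => hμ (M.2.symm.trans M.1.2.2)⟩
      rw [Nat.card_of_isEmpty, Nat.cast_zero]
  rw [eq_sub_iff_add_eq, ← h2, ← h1]
  refine genFun_congr E.symm ?_
  rintro (M | M) <;> rfl

/-! ### The map reduced to one cycle -/

theorem Finsupp.eq_single_of_sum_mul_eq {a : ℕ →₀ ℕ} {d : ℕ} (hd : 1 ≤ d)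
    (h : ∀ k, a k ≠ 0 → d ≤ k) (hs : (a.sum fun k n => n * k) = d) : a = Finsupp.single d 1 := by
  have h1 : ∀ k, a k ≠ 0 → k = d ∧ a k = 1 := by
    intro k hk
    have hle := (Finset.single_le_sum (f := fun k => a k * k) (fun _ _ => Nat.zero_le _)
      (Finsupp.mem_support_iff.2 hk)).trans hs.le
    have hdk := h k hk
    rcases (Nat.one_le_iff_ne_zero.2 hk).lt_or_eq with h2 | h2
    · have := Nat.mul_le_mul_right k h2
      omega
    · rw [← h2, one_mul] at hle
      exact ⟨le_antisymm hle hdk, h2.symm⟩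
  have h2 : a d ≠ 0 := by
    intro h0
    have : a = 0 := by
      ext k
      by_contra hk
      exact hk ((h1 k hk).1 ▸ h0)
    rw [this, Finsupp.sum_zero_index] at hs
    omega
  ext k
  rw [Finsupp.single_apply]
  split_ifs with hk
  · rw [← hk, (h1 d h2).2]
  · by_contra hne
    exact hk (h1 k hne).1.symm

namespace LabelledMap

open CombMap

/-- The map is a cycle of length `d`, with the outer face on one of its sides. -/
def IsPolygon (M : LabelledMap) (d : ℕ) : Prop :=
  M.N = d + d ∧ ∃ r, M.IsRoot r ∧ Function.minimalPeriod M.φ r = d ∧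
    (∀ i j, M.α (M.φ^[i] r) ≠ M.φ^[j] r) ∧ ∀ i, M.φ (M.α (M.φ^[i + 1] r)) = M.α (M.φ^[i] r)

theorem polygon_bijective {M : LabelledMap} {d : ℕ} (hN : M.N = d + d) {r : Fin M.N}
    (hp : Function.minimalPeriod M.φ r = d) (hα : ∀ i j, M.α (M.φ^[i] r) ≠ M.φ^[j] r) :
    Function.Bijective (Sum.elim (fun i : Fin d => M.φ^[i] r)
      (fun i : Fin d => M.α (M.φ^[i] r))) := by
  have hinj : Function.Injective fun i : Fin d => M.φ^[i] r := fun i j hij => Fin.ext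
    (Function.iterate_injOn_Iio_minimalPeriod (f := M.φ) (x := r) (by rw [hp]; exact i.2)
      (by rw [hp]; exact j.2) hij)
  rw [Fintype.bijective_iff_injective_and_card]
  refine ⟨Function.Injective.sumElim hinj (M.α.injective.comp hinj) fun i j h => hα _ _ h.symm, ?_⟩
  simp [hN]

theorem IsPolygon.of_iso {M M' : LabelledMap} {d : ℕ} (h : M.IsPolygon d) (hh : Iso M M') :
    M'.IsPolygon d := by
  obtain ⟨hN, r, hr, hp, h4, h5⟩ := h
  obtain ⟨e, h1, h2, h3⟩ := hh
  have hit : ∀ i x, e (M.φ^[i] x) = M'.φ^[i] (e x) := fun i x =>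
    (Function.Semiconj.iterate_right (f := e) (ga := M.φ) (gb := M'.φ) h2 i) x
  refine ⟨?_, e r, (h3 r).2 hr, ?_, fun i j => ?_, fun i => ?_⟩
  · rw [← hN]
    simpa using (Fintype.card_congr e).symm
  · rw [Iso.minimalPeriod_eq h2, hp]
  · rw [← hit, ← hit, ← h1]
    exact fun hh => h4 i j (e.injective hh)
  · rw [← hit, ← hit, ← h1, ← h1, ← h2, h5]

theorem IsPolygon.iso {M M' : LabelledMap} {d : ℕ} (h : M.IsPolygon d) (h' : M'.IsPolygon d) :
    Iso M M' := by
  obtain ⟨hN, r, hr, hp, h4, h5⟩ := h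
  obtain ⟨hN', r', hr', hp', h4', h5'⟩ := h'
  have hd : 0 < d := by
    have := r.pos
    omega
  let E := Equiv.ofBijective _ (polygon_bijective hN hp h4)
  let E' := Equiv.ofBijective _ (polygon_bijective hN' hp' h4')
  let e := E.symm.trans E'
  have heE : ∀ y, e (E y) = E' y := fun y => by
    simp only [e, Equiv.trans_apply, Equiv.symm_apply_apply]
  have he : ∀ i, e (M.φ^[i] r) = M'.φ^[i] r' := by
    intro i
    rw [← Function.iterate_mod_minimalPeriod_eq (f := M.φ), hp,
      ← Function.iterate_mod_minimalPeriod_eq (f := M'.φ) (x := r'), hp']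
    exact heE (Sum.inl ⟨i % d, Nat.mod_lt _ hd⟩)
  have heα : ∀ i, e (M.α (M.φ^[i] r)) = M'.α (M'.φ^[i] r') := by
    intro i
    rw [← Function.iterate_mod_minimalPeriod_eq (f := M.φ), hp,
      ← Function.iterate_mod_minimalPeriod_eq (f := M'.φ) (x := r'), hp']
    exact heE (Sum.inr ⟨i % d, Nat.mod_lt _ hd⟩)
  -- Exponents are made positive, since the relation for `φ` on the inner side is available at `i +
  -- 1` only.
  have hs : ∀ x, ∃ i, x = M.φ^[i + 1] r ∨ x = M.α (M.φ^[i + 1] r) := by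
    have hshift : ∀ i, M.φ^[i] r = M.φ^[i + (d - 1) + 1] r := fun i => by
      rw [add_assoc, Nat.sub_add_cancel hd, ← hp, Function.iterate_add_minimalPeriod_eq]
    intro x
    obtain ⟨i | i, rfl⟩ := E.surjective x
    · exact ⟨_, Or.inl (hshift i)⟩
    · exact ⟨_, Or.inr (congrArg M.α (hshift i))⟩
  refine ⟨e, fun x => ?_, fun x => ?_, fun x => ?_⟩
  · obtain ⟨i, rfl | rfl⟩ := hs x
    · rw [he, heα]
    · rw [M.α_involutive, he, heα, M'.α_involutive]
  · obtain ⟨i, rfl | rfl⟩ := hs x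
    · rw [he, ← Function.iterate_succ_apply' M.φ, he, Function.iterate_succ_apply']
    · rw [heα, h5, h5', heα]
  · have h0 : e r = r' := he 0
    constructor
    · intro hx
      have : e x = e r := by rw [h0]; exact isRoot_unique hx hr'
      exact e.injective this ▸ hr
    · intro hx
      rw [isRoot_unique hx hr, h0]
      exact hr'

/-- An inner region misses the outer darts, so it contains some reversed dart and then, following
the inner side, all `d` of them. The dart count leaves a single inner face of degree `d`. -/
theorem IsPolygon.isFilling {M : LabelledMap} {d : ℕ} (hd : 1 ≤ d) (h : M.IsPolygon d) :
    M.IsFilling d ∧ M.innerDegrees = Finsupp.single d 1 := by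
  classical
  obtain ⟨hN, r, hr, hp, h4, h5⟩ := h
  have ho : M.outerDegree = d := (outerDegree_eq hr).trans hp
  have hg : GirthGe M.α M.φ d := by
    refine girthGe_of_inner fun S hS => ?_
    have hout : ∀ i, M.φ^[i] r ∉ S := by
      intro i
      induction i with
      | zero => exact hS.root r hr
      | succ i ih => rwa [Function.iterate_succ_apply', hS.region.iff]
    have hstep : ∀ i, M.α (M.φ^[i] r) ∈ S ↔ M.α r ∈ S := by
      intro i
      induction i with
      | zero => rfl
      | succ i ih => rw [← hS.region.iff, h5, ih]
    have hin : ∀ i, M.α (M.φ^[i] r) ∈ S := by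
      obtain ⟨x, hx⟩ := hS.nonempty
      obtain ⟨i | i, rfl⟩ := (polygon_bijective hN hp h4).2 x
      · exact absurd hx (hout i)
      · exact fun j => (hstep j).2 ((hstep i).1 hx)
    have hinj : Function.Injective fun i : Fin d => M.α (M.φ^[i] r) :=
      (polygon_bijective hN hp h4).1.comp Sum.inr_injective
    calc d = (Finset.univ.image fun i : Fin d => M.α (M.φ^[i] r)).card := by
          rw [Finset.card_image_of_injective _ hinj, Finset.card_univ, Fintype.card_fin]
      _ ≤ (bd M.α S).card := by
          refine Finset.card_le_card fun x hx => ?_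
          obtain ⟨i, -, rfl⟩ := Finset.mem_image.1 hx
          exact mem_bd.2 ⟨hin i, by rw [M.α_involutive]; exact hout i⟩
  have hi : M.innerDegrees = Finsupp.single d 1 := by
    refine Finsupp.eq_single_of_sum_mul_eq hd (fun k hk => ?_) ?_
    · by_contra hlt
      exact hk (innerDegrees_eq_zero hg (not_le.1 hlt))
    · have := M.card_darts_eq
      omega
  refine ⟨⟨hd, ho, (girth_eq_iff hd ho).2 ⟨natCast_le_girth.2 hg, ?_⟩⟩, hi⟩
  rw [hi]
  simp

/-- The outer darts and their reversals exhaust the `d + d` darts. The outer boundary being simple,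
each vertex has one outer corner, which determines the successors of the reversed darts. -/
theorem IsFilling.isPolygon {M : LabelledMap} {d : ℕ} (h : M.IsFilling d)
    (hi : M.innerDegrees = Finsupp.single d 1) : M.IsPolygon d := by
  classical
  have hN : M.N = d + d := by
    rw [M.card_darts_eq, h.outerDegree, hi, Finsupp.sum_single_index (zero_mul d), one_mul]
  obtain ⟨r, hr⟩ := h.exists_root
  have hp := h.minimalPeriod hr
  have hout : ∀ i, M.IsOuter (M.faceOf (M.φ^[i] r)) := fun i =>
    (h.outer_iff hr).2 ⟨i, (Equiv.Perm.iterate_eq_pow _ _ ▸ rfl)⟩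
  have h4 : ∀ i j, M.α (M.φ^[i] r) ≠ M.φ^[j] r := by
    intro i j hij
    have := h.not_outer_α (hout i)
    rw [hij] at this
    exact this (hout j)
  have hb := polygon_bijective hN hp h4
  refine ⟨hN, r, hr, hp, h4, fun i => ?_⟩
  have hinner : ∀ y, ¬ M.IsOuter (M.faceOf y) → M.IsOuter (M.faceOf (M.α y)) := by
    intro y hy
    obtain ⟨j | j, rfl⟩ := hb.2 y
    · exact absurd (hout j) hy
    · simp only [Sum.elim_inr]
      rw [M.α_involutive]
      exact hout j
  set z := M.φ^[i] r with hz
  rw [Function.iterate_succ_apply', ← hz]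
  set y := M.φ (M.α (M.φ z)) with hy
  have hzo : M.IsOuter (M.faceOf z) := hout i
  have hyi : ¬ M.IsOuter (M.faceOf y) := by
    rw [hy, faceOf_φ]
    exact h.not_outer_α (by rwa [faceOf_φ])
  have e : M.φ (M.α y) = M.φ z := by
    refine h.eq_of_sameV (by rw [faceOf_φ]; exact hinner y hyi) (by rwa [faceOf_φ]) ?_
    exact (sameV_rot M.α M.φ y).trans (sameV_rot M.α M.φ (M.φ z))
  rw [← M.φ.injective e, M.α_involutive]

theorem exists_isPolygon {d : ℕ} (hd : 1 ≤ d) : ∃ L : LabelledMap, L.IsPolygon d := by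
  classical
  have : NeZero d := ⟨by omega⟩
  let α : Equiv.Perm (ZMod d × Bool) := Function.Involutive.toPerm (fun x => (x.1, !x.2))
    fun x => by simp
  let φ : Equiv.Perm (ZMod d × Bool) :=
    { toFun := fun x => (cond x.2 (x.1 + 1) (x.1 - 1), x.2)
      invFun := fun x => (cond x.2 (x.1 - 1) (x.1 + 1), x.2)
      left_inv := by rintro ⟨i, b⟩; cases b <;> simp
      right_inv := by rintro ⟨i, b⟩; cases b <;> simp }
  have α_apply : ∀ i b, α (i, b) = (i, !b) := fun _ _ => rfl
  have φ_true : ∀ i, φ (i, true) = (i + 1, true) := fun _ => rfl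
  have φ_false : ∀ i, φ (i, false) = (i - 1, false) := fun _ => rfl
  have hα : ∀ x, α (α x) = x := by rintro ⟨i, b⟩; simp [α_apply]
  have hne : ∀ x, α x ≠ x := by rintro ⟨i, b⟩; simp [α_apply]
  have hit : ∀ i : ℕ, φ^[i] (0, true) = ((i : ZMod d), true) := by
    intro i
    induction i with
    | zero => simp
    | succ i ih => rw [Function.iterate_succ_apply', ih, φ_true, Nat.cast_succ]
  have key : ∀ p : ZMod d → Prop, (∀ i, p i → p (i + 1)) → ∀ i j, p i → p j := by
    intro p hp i j hi
    have : ∀ n : ℕ, p (i + n) := by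
      intro n
      induction n with
      | zero => simpa using hi
      | succ n ih => rw [Nat.cast_succ, ← add_assoc]; exact hp _ ih
    have h := this (j - i).val
    rwa [ZMod.natCast_zmod_val, add_sub_cancel] at h
  have hc : IsConn α φ := by
    intro p h1 h2 x y hx
    have h3 : ∀ b i, p (i, b) → p (i, !b) := fun b i h => h1 _ h
    have h4 : ∀ i, p (i, true) → p (i + 1, true) := fun i h => h2 _ h
    have h5 : ∀ x, p x → p (x.1, true) := by
      rintro ⟨i, b⟩ h
      cases b
      · exact h3 _ _ h
      · exact h
    have h6 := key (fun i => p (i, true)) h4 x.1 y.1 (h5 x hx)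
    obtain ⟨j, b⟩ := y
    cases b
    · exact h3 _ _ h6
    · exact h6
  have hex : IsExact α φ := by
    intro w hw hw'
    -- The darts leaving a vertex are `(i + 1, true)` and `(i, false)`, so an even set of edges
    -- contains all edges or none.
    have hstep : ∀ i, w (i + 1, true) = w (i, true) := by
      intro i
      have h := hw' (fun x => if x = (i + 1, true) ∨ x = (i, false) then 1 else 0) (by
        rintro ⟨j, b⟩
        refine if_congr ?_ rfl rfl
        cases b
        · simp [α_apply, φ_true]
        · simp [α_apply, φ_false, sub_eq_iff_eq_add])
      have hsum : ∑ x, (if x = (i + 1, true) ∨ x = (i, false) then (1 : ZMod 2) else 0) * w x =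
          w (i + 1, true) + w (i, false) := by
        simp only [ite_mul, one_mul, zero_mul]
        rw [← Finset.sum_filter]
        have : Finset.univ.filter (fun x : ZMod d × Bool => x = (i + 1, true) ∨ x = (i, false)) =
            {(i + 1, true), (i, false)} := by ext; simp
        rw [this, Finset.sum_pair (by simp)]
      rw [hsum, ← hw (i, false), α_apply, Bool.not_false] at h
      exact (CharTwo.add_eq_zero.1 h)
    have hconst : ∀ i, w (i, true) = w (0, true) := fun i =>
      key (fun i => w (i, true) = w (0, true)) (fun i h => (hstep i).trans h) 0 i rfl
    -- Such a set is empty or the boundary of the face formed by the `true` darts.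
    refine ⟨fun x => cond x.2 (w (0, true)) 0, fun x => rfl, ?_⟩
    rintro ⟨i, b⟩
    cases b
    · rw [← hw, α_apply, Bool.not_false, hconst]
      simp
    · rw [α_apply, hconst]
      simp
  obtain ⟨L, e, h1, h2, h3⟩ := exists_ofType α φ (0, true) hα hne hc hex
  have hitL : ∀ i x, e (φ^[i] x) = L.φ^[i] (e x) := fun i x =>
    (Function.Semiconj.iterate_right (f := e) (ga := φ) (gb := L.φ) h2 i) x
  refine ⟨L, ?_, e (0, true), (h3 _).2 rfl, ?_, fun i j => ?_, fun i => ?_⟩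
  · have := Fintype.card_congr e
    rw [Fintype.card_prod, ZMod.card, Fintype.card_bool, Fintype.card_fin] at this
    omega
  · refine Nat.dvd_antisymm ?_ ?_
    · refine Function.IsPeriodicPt.minimalPeriod_dvd ?_
      rw [Function.IsPeriodicPt, Function.IsFixedPt, ← hitL, hit, ZMod.natCast_self]
    · have := Function.iterate_minimalPeriod (f := L.φ) (x := e (0, true))
      rw [← hitL, hit, e.injective.eq_iff, Prod.mk.injEq] at this
      exact (ZMod.natCast_eq_zero_iff _ _).1 this.1
  · rw [← hitL, ← hitL, ← h1, hit, hit, α_apply]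
    intro h
    simpa using e.injective h
  · rw [← hitL, ← hitL, ← h1, ← h1, ← h2, hit, hit, α_apply, α_apply, Bool.not_true, φ_false,
      Nat.cast_succ, add_sub_cancel_right]

end LabelledMap

open LabelledMap

/-- Only the `d`-gon has this weight. The coefficient being a unit is what allows `girthSeries d` to
be inverted over the integers. -/
theorem coeff_single_girthSeries {d : ℕ} (hd : 1 ≤ d) :
    coeff (Finsupp.single d 1) (girthSeries d) = 1 := by
  rw [girthSeries_eq, coeff_genFun]
  obtain ⟨L, hL⟩ := exists_isPolygon hd
  have hL' : (RootedMap.rep ⟦L⟧).IsPolygon d :=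
    hL.of_iso (isoSetoid.symm (RootedMap.rep_mk_iso L))
  obtain ⟨h1, h2⟩ := hL'.isFilling hd
  have : Unique {M : GirthEqMap d // M.1.rep.innerDegrees = Finsupp.single d 1} :=
    { default := ⟨⟨⟦L⟧, h1.outerDegree, h1.girth⟩, h2⟩
      uniq := fun M => Subtype.ext (Subtype.ext (RootedMap.eq_of_iso
        (((GirthEqMap.isFilling hd M.1).isPolygon M.2).iso hL'))) }
  rw [Nat.card_unique, Nat.cast_one]

theorem coeff_girthSeries_ne_zero {d : ℕ} {μ : ℕ →₀ ℕ} (h : coeff μ (girthSeries d) ≠ 0) :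
    ∀ i < d, μ i = 0 := by
  rw [girthSeries_eq, coeff_genFun, Nat.cast_ne_zero] at h
  obtain ⟨M, rfl⟩ := (Nat.card_ne_zero.1 h).1
  exact fun i hi => innerDegrees_eq_zero (natCast_le_girth.1 M.2.2.ge) hi

/-! ### Inverse series -/

/-- No variable of index less than `d` occurs. -/
def LowFree (d : ℕ) (f : MvPowerSeries ℕ ℤ) : Prop := ∀ μ, coeff μ f ≠ 0 → ∀ i < d, μ i = 0

namespace LowFree

variable {d : ℕ} {f g : MvPowerSeries ℕ ℤ}

theorem mul (hf : LowFree d f) (hg : LowFree d g) : LowFree d (f * g) := by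
  classical
  intro μ hμ i hi
  rw [coeff_mul] at hμ
  obtain ⟨p, hp, hne⟩ := Finset.exists_ne_zero_of_sum_ne_zero hμ
  rw [Finset.HasAntidiagonal.mem_antidiagonal] at hp
  rw [← hp, Finsupp.add_apply, hf _ (left_ne_zero_of_mul hne) i hi,
    hg _ (right_ne_zero_of_mul hne) i hi]

theorem sub (hf : LowFree d f) (hg : LowFree d g) : LowFree d (f - g) := by
  intro μ hμ
  rw [map_sub] at hμ
  by_cases h : coeff μ f = 0
  · exact hg μ fun h' => hμ (by rw [h, h', sub_zero])
  · exact hf μ h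

theorem monomial {ν : ℕ →₀ ℕ} (h : ∀ i < d, ν i = 0) (c : ℤ) :
    LowFree d (monomial ν c) := by
  classical
  intro μ hμ i hi
  rw [coeff_monomial] at hμ
  split_ifs at hμ with h'
  · rw [h', h i hi]
  · exact absurd rfl hμ

theorem X {k : ℕ} (h : d ≤ k) : LowFree d (X k) := by
  rw [MvPowerSeries.X]
  exact monomial (fun i hi => Finsupp.single_eq_of_ne (by omega)) 1

theorem pow (hf : LowFree d f) (k : ℕ) : LowFree d (f ^ k) := by
  induction k with
  | zero =>
    rw [pow_zero, ← monomial_zero_one]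
    exact monomial (fun _ _ => rfl) 1
  | succ k ih => rw [pow_succ]; exact ih.mul hf

theorem evalAt (hf : LowFree d f) (hg : LowFree d g) (h0 : constantCoeff g = 0) :
    LowFree d (evalAt d f g MvPowerSeries.X) := by
  intro ν hν i hi
  rw [coeff_evalAt h0 hf] at hν
  obtain ⟨μ, hμ⟩ : ∃ μ, coeff μ f * coeff ν (MvPowerSeries.monomial (μ.erase d) 1 * g ^ μ d) ≠ 0 := by
    by_contra! h
    exact hν (finsum_eq_zero_of_forall_eq_zero h)
  refine ((monomial (fun i hi => ?_) 1).mul (hg.pow (μ d))) ν (right_ne_zero_of_mul hμ) i hi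
  rw [Finsupp.erase_apply]
  split_ifs
  · rfl
  · exact hf μ (left_ne_zero_of_mul hμ) i hi

end LowFree

theorem weights_X_constantCoeff {d : ℕ} {z : MvPowerSeries ℕ ℤ} (hz : constantCoeff z = 0)
    (i : ℕ) : constantCoeff (weights d z X i) = 0 := by
  rw [weights]
  split_ifs
  · exact map_zero _
  · exact hz
  · exact constantCoeff_X i

theorem constantCoeff_evalAt {d : ℕ} {f z : MvPowerSeries ℕ ℤ} (hz : constantCoeff z = 0) :
    constantCoeff (evalAt d f z X) = constantCoeff f :=
  constantCoeff_subst_eq (hasSubst_weights_X hz) (weights_X_constantCoeff hz) f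

theorem coeff_eq_of_le_order_sub {f g : MvPowerSeries ℕ ℤ} {n : ℕ}
    (h : (n : ℕ∞) ≤ (f - g).order) {ν : ℕ →₀ ℕ} (hν : ν.degree < n) : coeff ν f = coeff ν g := by
  have := coeff_of_lt_order (f := f - g) (d := ν) (lt_of_lt_of_le (by exact_mod_cast hν) h)
  rwa [map_sub, sub_eq_zero] at this

/-- A difference of powers has a factor `f - g`, and the cofactor has order at least `k` because
constant terms vanish. -/
theorem le_order_pow_sub_pow {f g : MvPowerSeries ℕ ℤ} {n : ℕ}
    (hf : constantCoeff f = 0) (hg : constantCoeff g = 0) (h : (n : ℕ∞) ≤ (f - g).order) (k : ℕ) :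
    ((k + n : ℕ) : ℕ∞) ≤ (f ^ (k + 1) - g ^ (k + 1)).order := by
  induction k with
  | zero => simpa using h
  | succ k ih =>
    have e : f ^ (k + 1 + 1) - g ^ (k + 1 + 1) =
        f * (f ^ (k + 1) - g ^ (k + 1)) + g ^ (k + 1) * (f - g) := by ring
    rw [e]
    refine le_trans (le_min ?_ ?_) min_order_le_add
    · refine le_trans ?_ le_order_mul
      refine le_trans (le_of_eq ?_) (add_le_add (one_le_order_iff_constCoeff_eq_zero.2 hf) ih)
      push_cast
      ring
    · refine le_trans ?_ le_order_mul
      refine le_trans (le_of_eq ?_)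
        (add_le_add (le_order_pow_of_constantCoeff_eq_zero (k + 1) hg) h)
      push_cast
      ring

/-- Substitution into `R` is a contraction: in each monomial containing `z`, every factor beyond one
`z` raises the order of the difference. -/
theorem le_order_evalAt_sub {d n : ℕ} {R f g : MvPowerSeries ℕ ℤ} (hR : LowFree d R)
    (h1 : coeff (Finsupp.single d 1) R = 0) (hf : constantCoeff f = 0) (hg : constantCoeff g = 0)
    (h : (n : ℕ∞) ≤ (f - g).order) :
    ((n + 1 : ℕ) : ℕ∞) ≤ (evalAt d R f X - evalAt d R g X).order := by
  refine nat_le_order fun ν hν => ?_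
  rw [map_sub, coeff_evalAt hf hR, coeff_evalAt hg hR, sub_eq_zero]
  refine finsum_congr fun μ => ?_
  by_cases hμ : coeff μ R = 0
  · rw [hμ, zero_mul, zero_mul]
  congr 1
  rcases hk : μ d with _ | k
  · rw [pow_zero, pow_zero]
  refine coeff_eq_of_le_order_sub (n := n + 1) ?_ hν
  rw [← mul_sub]
  refine le_trans ?_ le_order_mul
  rw [order_monomial_of_ne_zero one_ne_zero]
  refine le_trans ?_ (add_le_add_right (le_order_pow_sub_pow hf hg h k) _)
  norm_cast
  -- No gain would force the monomial to be `z` alone, whose coefficient in `R` is zero.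
  by_contra hlt
  have hdeg : (μ.erase d).degree = 0 := by omega
  have hk0 : k = 0 := by omega
  rw [Finsupp.degree_eq_zero_iff] at hdeg
  refine hμ ?_
  have : μ = Finsupp.single d 1 := by
    rw [← Finsupp.erase_add_single d μ, hdeg, hk, hk0, zero_add, zero_add]
  rw [this, h1]

/-! ### Inversion by successive approximation -/

section Inverse

variable {d : ℕ} {G : MvPowerSeries ℕ ℤ}

theorem evalAt_eq_add {z : MvPowerSeries ℕ ℤ} (hz : constantCoeff z = 0) :
    evalAt d G z X = z + evalAt d (G - X d) z X := by
  have h := subst_add (hasSubst_weights_X (d := d) hz) (X d) (G - X d)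
  rw [add_sub_cancel, subst_X (hasSubst_weights_X hz)] at h
  rw [evalAt, h, evalAt]
  congr 1
  simp only [weights, lt_irrefl, if_false, if_true]

/-- With `R = G - X d`, the equation says that `Y` is a fixed point of `Y ↦ X d - R(Y)`, which
increases the order of differences by one. -/
theorem existsUnique_inverse (h0 : constantCoeff G = 0) (h1 : coeff (Finsupp.single d 1) G = 1)
    (hG : LowFree d G) : ∃! Y : MvPowerSeries ℕ ℤ,
      constantCoeff Y = 0 ∧ LowFree d Y ∧ evalAt d G Y X = X d := by
  set R := G - X d with hRdef
  have hR : LowFree d R := hG.sub (LowFree.X le_rfl)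
  have hR1 : coeff (Finsupp.single d 1) R = 0 := by
    rw [hRdef, map_sub, h1, coeff_index_single_self_X, sub_self]
  have hR0 : constantCoeff R = 0 := by rw [hRdef, map_sub, h0, constantCoeff_X, sub_self]
  have hfix : ∀ Y : MvPowerSeries ℕ ℤ, constantCoeff Y = 0 →
      (evalAt d G Y X = X d ↔ X d - evalAt d R Y X = Y) := by
    intro Y hY
    rw [evalAt_eq_add hY, sub_eq_iff_eq_add, eq_comm]
  let S : MvPowerSeries ℕ ℤ → MvPowerSeries ℕ ℤ := fun Y => X d - evalAt d R Y X
  have hS0 : ∀ Y, constantCoeff Y = 0 → constantCoeff (S Y) = 0 := fun Y hY => by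
    rw [map_sub, constantCoeff_X, constantCoeff_evalAt hY, hR0, sub_zero]
  have hSlow : ∀ Y, constantCoeff Y = 0 → LowFree d Y → LowFree d (S Y) := fun Y hY h =>
    (LowFree.X le_rfl).sub (hR.evalAt h hY)
  have hS : ∀ Y Y' (n : ℕ), constantCoeff Y = 0 → constantCoeff Y' = 0 →
      (n : ℕ∞) ≤ (Y - Y').order → ((n + 1 : ℕ) : ℕ∞) ≤ (S Y - S Y').order := by
    intro Y Y' n hY hY' h
    have := le_order_evalAt_sub hR hR1 hY hY' h
    have e : S Y - S Y' = -(evalAt d R Y X - evalAt d R Y' X) := by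
      change X d - evalAt d R Y X - (X d - evalAt d R Y' X) = _
      ring
    rwa [e, order_neg]
  have hit0 : ∀ k, constantCoeff (S^[k] 0) = 0 := by
    intro k
    induction k with
    | zero => exact map_zero _
    | succ k ih => rw [Function.iterate_succ_apply']; exact hS0 _ ih
  have hitlow : ∀ k, LowFree d (S^[k] 0) := by
    intro k
    induction k with
    | zero => exact fun μ hμ => absurd (map_zero _) hμ
    | succ k ih => rw [Function.iterate_succ_apply']; exact hSlow _ (hit0 k) ih
  have hitord : ∀ k : ℕ, (k : ℕ∞) ≤ (S^[k + 1] 0 - S^[k] 0).order := by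
    intro k
    induction k with
    | zero => simp
    | succ k ih =>
      rw [Function.iterate_succ_apply' S (k + 1)]
      nth_rewrite 2 [Function.iterate_succ_apply']
      exact hS _ _ k (hit0 (k + 1)) (hit0 k) ih
  have hstab : ∀ ν : ℕ →₀ ℕ, ∀ k, ν.degree + 1 ≤ k →
      coeff ν (S^[k] 0) = coeff ν (S^[ν.degree + 1] 0) := by
    intro ν k hk
    induction k, hk using Nat.le_induction with
    | base => rfl
    | succ k hk ih => rw [← ih]; exact coeff_eq_of_le_order_sub (hitord k) (by omega)
  -- The coefficient at `ν` no longer changes from the iterate `ν.degree + 1` on.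
  let Y : MvPowerSeries ℕ ℤ := fun ν => coeff ν (S^[ν.degree + 1] 0)
  have hYc : ∀ ν, coeff ν Y = coeff ν (S^[ν.degree + 1] 0) := fun ν => rfl
  have hY0 : constantCoeff Y = 0 := by
    rw [← coeff_zero_eq_constantCoeff_apply, hYc, coeff_zero_eq_constantCoeff_apply, hit0]
  have hYord : ∀ k : ℕ, (k : ℕ∞) ≤ (Y - S^[k] 0).order := fun k => by
    refine nat_le_order fun ν hν => ?_
    rw [map_sub, hYc, hstab ν k hν, sub_self]
  have hYfix : S Y = Y := by
    ext ν
    have e1 := hS _ _ (ν.degree + 1) hY0 (hit0 _) (hYord (ν.degree + 1))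
    rw [← Function.iterate_succ_apply' S] at e1
    rw [coeff_eq_of_le_order_sub e1 (by omega),
      coeff_eq_of_le_order_sub (hYord (ν.degree + 1 + 1)) (by omega)]
  refine ⟨Y, ⟨hY0, fun μ hμ => hitlow _ μ (hYc μ ▸ hμ), (hfix Y hY0).2 hYfix⟩, ?_⟩
  rintro Z ⟨hZ0, -, hZ⟩
  have hZfix : S Z = Z := (hfix Z hZ0).1 hZ
  have hord : ∀ n : ℕ, (n : ℕ∞) ≤ (Z - Y).order := by
    intro n
    induction n with
    | zero => simp
    | succ n ih =>
      have := hS _ _ n hZ0 hY0 ih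
      rwa [hZfix, hYfix] at this
  ext ν
  exact coeff_eq_of_le_order_sub (hord (ν.degree + 1)) (by omega)

end Inverse

theorem existsUnique_inverseSeries {d : ℕ} (hd : 1 ≤ d) : ∃! Y : MvPowerSeries ℕ ℤ,
    HasSubst (weights d Y X) ∧ IsInverseSeries d Y := by
  have key : ∀ Y : MvPowerSeries ℕ ℤ, (HasSubst (weights d Y X) ∧ IsInverseSeries d Y) ↔
      (constantCoeff Y = 0 ∧ LowFree d Y ∧ evalAt d (girthSeries d) Y X = X d) := by
    intro Y
    constructor
    · rintro ⟨-, h1, h2, h3⟩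
      refine ⟨h1, fun μ hμ i hi => ?_, h3⟩
      by_contra hne
      exact hμ (h2 μ ⟨i, hi, hne⟩)
    · rintro ⟨h1, h2, h3⟩
      refine ⟨hasSubst_weights_X h1, h1, ?_, h3⟩
      rintro μ ⟨i, hi, hne⟩
      by_contra hμ
      exact hne (h2 μ hμ i hi)
  obtain ⟨Y, hY, huniq⟩ := existsUnique_inverse (constantCoeff_girthSeries hd)
    (coeff_single_girthSeries hd) (fun μ => coeff_girthSeries_ne_zero)
  exact ⟨Y, (key Y).2 hY, fun Z hZ => huniq Z ((key Z).1 hZ)⟩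

/-! ### The general substitution relation -/

section Renorm

variable {Y : ℕ → MvPowerSeries ℕ ℤ}

theorem renorm_of_lt {d j : ℕ} (h : j < d) : renorm Y d j =
    evalAt j (Y j) 0 (fun i => if j < i ∧ i ≤ d then renorm Y d i else X i) := by
  rw [renorm, if_pos h]

theorem renorm_self (d : ℕ) : renorm Y d d = Y d := by
  rw [renorm, if_neg (lt_irrefl d), if_pos rfl]

theorem renorm_of_gt {d j : ℕ} (h : d < j) : renorm Y d j = X j := by
  rw [renorm, if_neg (by omega), if_neg (by omega)]

/-- Beyond `d` the family consists of the variables themselves, so the case distinction in the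
recursion disappears and `renorm Y d` is substituted as a whole. -/
theorem renorm_eq_subst {d j : ℕ} (h : j < d) :
    renorm Y d j = subst (weights j 0 (renorm Y d)) (Y j) := by
  rw [renorm_of_lt h, evalAt]
  congr 1
  funext i
  simp only [weights]
  split_ifs with h1 h2 h3
  · rfl
  · rfl
  · rfl
  · rw [renorm_of_gt (by omega)]

theorem hasSubst_weights_of {d j : ℕ}
    (h : ∀ i, j < i → constantCoeff (renorm Y d i) = 0) : HasSubst (weights j 0 (renorm Y d)) ∧
      ∀ i, constantCoeff (weights j 0 (renorm Y d) i) = 0 := by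
  have h' : ∀ i, constantCoeff (weights j 0 (renorm Y d) i) = 0 := fun i => by
    rw [weights]
    split_ifs
    · exact map_zero _
    · exact map_zero _
    · exact h i (by omega)
  refine ⟨hasSubst_of_forall_ge h' (max (d + 1) (j + 1)) fun i hi => ?_, h'⟩
  have := (le_max_left _ _).trans hi
  have := (le_max_right _ _).trans hi
  rw [weights, if_neg (by omega), if_neg (by omega), renorm_of_gt (by omega)]

variable (hY : ∀ d, 1 ≤ d → IsInverseSeries d (Y d))
include hY

theorem constantCoeff_renorm {d i : ℕ} (hi : 1 ≤ i) : constantCoeff (renorm Y d i) = 0 := by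
  induction hk : d - i using Nat.strong_induction_on generalizing i with
  | _ k ih =>
    rcases lt_trichotomy i d with h | rfl | h
    · rw [renorm_eq_subst h]
      obtain ⟨h1, h2⟩ := hasSubst_weights_of (Y := Y) (d := d) (j := i) fun m hm => by
        rcases le_or_gt m d with h' | h'
        · exact ih (d - m) (by omega) (by omega) rfl
        · rw [renorm_of_gt h', constantCoeff_X]
      rw [constantCoeff_subst_eq h1 h2, (hY i hi).1]
    · rw [renorm_self, (hY i hi).1]
    · rw [renorm_of_gt h, constantCoeff_X]

theorem hasSubst_renorm (d j : ℕ) : HasSubst (weights j 0 (renorm Y d)) :=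
  (hasSubst_weights_of fun _ hi => constantCoeff_renorm hY (by omega)).1

/-- The substitution sets the variable `z` of level `d` to zero and replaces the later ones by their
values at level `d + 1`. At `s = d` this is the recursive definition; smaller indices follow by
associativity of substitution and downward induction. -/
theorem subst_renorm_succ (d : ℕ) {s : ℕ} (hs : 1 ≤ s) :
    subst (weights d 0 (renorm Y (d + 1))) (renorm Y d s) = renorm Y (d + 1) s := by
  have hc := hasSubst_renorm hY (d + 1) d
  induction hk : d - s using Nat.strong_induction_on generalizing s with
  | _ k ih =>
    rcases lt_trichotomy s d with h | rfl | h
    · rw [renorm_eq_subst h, renorm_eq_subst (by omega : s < d + 1),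
        subst_comp_subst_apply (hasSubst_renorm hY d s) hc]
      congr 1
      funext i
      rcases lt_trichotomy i s with h1 | h1 | h1
      · simp only [weights, if_pos h1]
        rw [← coe_substAlgHom hc, map_zero]
      · simp only [weights, h1, lt_irrefl, if_false, if_true]
        rw [← coe_substAlgHom hc, map_zero]
      · have e : ∀ f : ℕ → MvPowerSeries ℕ ℤ, weights s 0 f i = f i := fun f => by
          rw [weights, if_neg (by omega), if_neg (by omega)]
        rw [e, e]
        exact ih (d - i) (by omega) (by omega) rfl
    · rw [renorm_self, renorm_eq_subst (Nat.lt_succ_self _)]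
    · rw [renorm_of_gt h, subst_X hc, weights, if_neg (by omega), if_neg (by omega)]

end Renorm

/-! ### Passage from level `d` to level `d + 1` -/

theorem evalAt_X {d : ℕ} {f : MvPowerSeries ℕ ℤ} (hf : LowFree d f) : evalAt d f (X d) X = f := by
  classical
  ext ν
  have e : ∀ μ : ℕ →₀ ℕ, monomial (μ.erase d) 1 * X d ^ μ d =
      (monomial μ 1 : MvPowerSeries ℕ ℤ) := fun μ => by
    rw [X_pow_eq, monomial_mul_monomial, Finsupp.erase_add_single, one_mul]
  rw [coeff_evalAt (constantCoeff_X d) hf, finsum_eq_single _ ν]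
  · rw [e, coeff_monomial_same, mul_one]
  · intro μ hμ
    rw [e, coeff_monomial_ne hμ.symm, mul_zero]

/-- By associativity of substitution, `G` followed by its inverse gives back the variable `z` and
leaves the others alone. -/
theorem evalAt_evalAt_inverse {d : ℕ} {f G Y : MvPowerSeries ℕ ℤ} (hf : LowFree d f)
    (hG : constantCoeff G = 0) (hY : constantCoeff Y = 0) (hinv : evalAt d G Y X = X d) :
    evalAt d (evalAt d f G X) Y X = f := by
  have hb := hasSubst_weights_X (d := d) hY
  conv_rhs => rw [← evalAt_X hf]
  rw [evalAt, evalAt, subst_comp_subst_apply (hasSubst_weights_X hG) hb, evalAt]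
  congr 1
  funext i
  rcases lt_trichotomy i d with h | rfl | h
  · simp only [weights, if_pos h]
    rw [← coe_substAlgHom hb, map_zero]
  · simp only [weights, lt_irrefl, if_false, if_true]
    exact hinv
  · have e : ∀ z, weights d z X i = X i := fun z => by
      rw [weights, if_neg (by omega), if_neg (by omega)]
    rw [e, e, subst_X hb, e]

/-- Inverting `G` at level `d + 1` in the basic identity writes the new series as the old one at `z
= 0` with `x_{d+1}` replaced by `Y (d + 1)`. Composing with the formula for `d`, the families
combine by `subst_renorm_succ`. -/
theorem irrSeries_eq_evalAt_renorm {Y : ℕ → MvPowerSeries ℕ ℤ}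
    (hY : ∀ d, 1 ≤ d → IsInverseSeries d (Y d)) (d n : ℕ) :
    irrSeries d n = evalAt 0 (irrSeries 0 n) 0 (renorm Y d) := by
  induction d with
  | zero =>
    have e : evalAt 0 (irrSeries 0 n) 0 (renorm Y 0) = evalAt 0 (irrSeries 0 n) 0 X := by
      rw [evalAt, evalAt]
      congr 1
      funext i
      rcases Nat.eq_zero_or_pos i with rfl | hi
      · rfl
      · simp only [weights]
        rw [renorm_of_gt hi]
    rw [e]
    ext ν
    rw [coeff_evalAt_zero fun _ _ i hi => absurd hi (Nat.not_lt_zero i)]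
    split_ifs with h
    · rfl
    -- Setting the variable of index zero to zero loses nothing, as no inner face has degree zero.
    · rw [irrSeries_eq, coeff_genFun]
      have : IsEmpty {M : IrrMap 0 n // M.1.rep.innerDegrees = ν} :=
        ⟨fun M => h (by rw [← M.2]; exact LabelledMap.card_innerFace_zero _)⟩
      rw [Nat.card_of_isEmpty, Nat.cast_zero]
  | succ d ih =>
    have hd : 1 ≤ d + 1 := Nat.le_add_left 1 d
    obtain ⟨hY0, -, hinv⟩ := hY (d + 1) hd
    have hb := hasSubst_weights_X (d := d + 1) hY0
    have hc := hasSubst_renorm hY (d + 1) d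
    have h1 : irrSeries (d + 1) n =
        evalAt (d + 1) (evalAt d (irrSeries d n) 0 X) (Y (d + 1)) X := by
      have := evalAt_irrSeries_eq hd n
      rw [Nat.add_sub_cancel] at this
      rw [this, evalAt_evalAt_inverse (fun μ => coeff_irrSeries_ne_zero)
        (constantCoeff_girthSeries hd) hY0 hinv]
    have h2 : evalAt (d + 1) (evalAt d (irrSeries d n) 0 X) (Y (d + 1)) X =
        subst (weights d 0 (renorm Y (d + 1))) (irrSeries d n) := by
      rw [evalAt, evalAt, subst_comp_subst_apply (hasSubst_weights_X (map_zero _)) hb]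
      congr 1
      funext i
      rcases lt_trichotomy i d with h | rfl | h
      · simp only [weights, if_pos h]
        rw [← coe_substAlgHom hb, map_zero]
      · simp only [weights, lt_irrefl, if_false, if_true]
        rw [← coe_substAlgHom hb, map_zero]
      · have e : ∀ f : ℕ → MvPowerSeries ℕ ℤ, weights d 0 f i = f i := fun f => by
          rw [weights, if_neg (by omega), if_neg (by omega)]
        rw [e, e, subst_X hb, weights, if_neg (by omega)]
        split_ifs with h'
        · rw [h', renorm_self]
        · rw [renorm_of_gt (by omega)]
    rw [h1, h2, ih, evalAt, subst_comp_subst_apply (hasSubst_renorm hY d 0) hc, evalAt]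
    congr 1
    funext i
    rcases Nat.eq_zero_or_pos i with rfl | hi
    · simp only [weights, lt_irrefl, if_false, if_true]
      rw [← coe_substAlgHom hc, map_zero]
    · have e : ∀ f : ℕ → MvPowerSeries ℕ ℤ, weights 0 0 f i = f i := fun f => by
        rw [weights, if_neg (by omega), if_neg (by omega)]
      rw [e, e, subst_renorm_succ hY d hi]

theorem mainTheorem3 :
    -- the generating functions have finite coefficients
    (∀ (n : ℕ) (μ : ℕ →₀ ℕ),
      {M : RootedMap | M.rep.outerDegree = n ∧ HasInnerDegrees M μ}.Finite) ∧
    -- gluing is a bijection, for every choice of distinguished edges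
    (∀ d n : ℕ, 1 ≤ d → ∀ e : EdgeSelection d n,
      ∃ Φ : FilledMap d n ≃ GirthGeMap d n, ∀ (P : FilledMap d n) (M' : GirthGeMap d n),
        P.1.1.rep.IsGluing d (fun f => (e P.1 f).1) (fun f => (P.2 f).1.rep) M'.1.rep ↔
          Φ P = M') ∧
    -- the formula for `G_d`
    (∀ d : ℕ, 1 ≤ d → girthSeries d =
      evalAt (d - 1) (irrSeries (d - 1) d) 0 X - C (catHalf d)) ∧
    -- the basic substitution identity
    (∀ d n : ℕ, 1 ≤ d →
      HasSubst (weights (d - 1) 0 X) ∧ HasSubst (weights d (girthSeries d) X) ∧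
      evalAt (d - 1) (irrSeries (d - 1) n) 0 X = evalAt d (irrSeries d n) (girthSeries d) X) ∧
    -- the series `X_d` exists and is unique
    (∀ d : ℕ, 1 ≤ d → ∃! Y : MvPowerSeries ℕ ℤ,
      HasSubst (weights d Y X) ∧ IsInverseSeries d Y) ∧
    -- the general substitution relation
    (∀ Y : ℕ → MvPowerSeries ℕ ℤ, (∀ d, 1 ≤ d → IsInverseSeries d (Y d)) →
      ∀ d n : ℕ, (∀ j, j ≤ d → HasSubst (weights j 0 (renorm Y d))) ∧
        irrSeries d n = evalAt 0 (irrSeries 0 n) 0 (renorm Y d)) := by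
  refine ⟨finite_hasInnerDegrees, fun d n hd e => exists_gluing_equiv hd e,
    fun d hd => girthSeries_eq_sub hd, fun d n hd => ⟨hasSubst_weights_X (map_zero _),
      hasSubst_weights_X (constantCoeff_girthSeries hd), evalAt_irrSeries_eq hd n⟩,
    fun d hd => existsUnique_inverseSeries hd, fun Y hY d n =>
      ⟨fun j _ => hasSubst_renorm hY d j, irrSeries_eq_evalAt_renorm hY d n⟩⟩
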